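/- **Setting.** Let $G=(V,E)$ be a finite simple graph, $X$ a compact metric space with a finite Borel measure $\mu$, and let $\psi_v:X\to(0,\infty)$ ($v\in V$) and $\psi_{uv}:X\times X\to(0,\infty)$ ($(u,v)\in E$) be continuous node and edge potentials. For a directed edge $v\to u$ and a collection $m=(m_{v\to u})$ of square-integrable probability densities (messages), the belief propagation (BP) update is $$[\mathcal F_{v\to u}(m)](x)=\kappa\int_X\psi_{uv}(x,y)\,\psi_v(y)\prod_{w\in N(v)\setminus\{u\}}m_{w\to v}(y)\,\mu(dy),$$ with $\kappa$ the normalizing constant. Let $\mathcal K$ be a set of such collections (the feasible messages), let $0<\gamma<2$, and suppose that BP is $\gamma$-contractive on $\mathcal K$: for all $m,m'\in\mathcal K$ and all directed edges $v\to u$ for which both updates are defined, $$\|\mathcal F_{v\to u}(m)-\mathcal F_{v\to u}(m')\|_{L^2}\le\Big(1-\frac\gamma2\Big)\sqrt{\frac1{|N(v)\setminus\{u\}|}\sum_{w\in N(v)\setminus\{u\}}\|m_{w\to v}-m'_{w\to v}\|_{L^2}^2}.$$ Let $m^*\in\mathcal K$ be a fixed point of BP. **Kernels.** Suppose that every $\psi_{uv}$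 is a symmetric positive semidefinite kernel whose integral operator on $L^2(\mu)$ has the eigenvalues $\lambda_1\ge\lambda_2\ge\dots\ge0$, with $\sum_j\lambda_j<\infty$, and continuous orthonormal eigenfunctions $(\phi_j)_{j\ge1}$ (the $\lambda_j$ are the same for all edges, the $\phi_j$ may depend on the edge; the operator vanishes on the orthogonal complement of the $\phi_j$). For $\delta>0$ let $r^*=r^*(\delta)$ be the smallest integer $r\ge1$ with $\lambda_r\le\delta$. **Algorithm (SOSMP with $r$ coefficients and $k\ge1$ samples).** Put $\beta_{uv}(y)=\psi_v(y)\int\psi_{uv}(x,y)\,\mu(dx)$ and $\Gamma_{uv}(x,y)=\psi_{uv}(x,y)\psi_v(y)/\beta_{uv}(y)$. Start with $a^0_{v\to u;j}=1/r$. In iteration $t=0,1,\dots$, for each directed edge $v\to u$: draw $k$ i.i.d. samples $Y_i$ from the density proportional to $\beta_{uv}(y)\prod_{w\in N(v)\setminus\{u\}}\widehat m^t_{w\to v}(y)$, where $\widehat m^t_{w\to v}=[\sum_{j\le r}a^t_{w\to v;j}\phi_j]_+$ (if its normalizing constant is zero, the samples are arbitrary); put $\tilde a^{t+1}_j=\frac1k\sum_{i\le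 k}\langle\Gamma_{uv}(\cdot,Y_i),\phi_j\rangle$ and $a^{t+1}=(1-\eta^t)a^t+\eta^t\tilde a^{t+1}$ with $\eta^t=1/(\gamma(t+1))$. The current messages are $m^t_{v\to u}=\sum_{j\le r}a^t_{v\to u;j}\phi_j$. The iterates are feasible: almost surely, for every $t$ for which all $\widehat m^t_{v\to u}$ have positive integral, the collection of the normalized $\widehat m^t_{v\to u}$ belongs to $\mathcal K$ (no condition if $\mathcal K$ consists of all collections of square-integrable densities). Operations are counted per directed edge: one for every arithmetic operation and every evaluation of a function $y\mapsto\langle\Gamma_{uv}(\cdot,y),\phi_j\rangle$ (computed in advance), and $c\,r$, with a fixed $c$, for drawing one sample. **Theorem.** There are constants $C>0$ and $\delta_0\in(0,1)$ that do not depend on $\delta$ such that for every $\delta\in(0,\delta_0)$ there is a number $T$ of iterations for which SOSMP with $r^*(\delta)$ coefficients, run for $T$ iterations, performs at most $$C\;r^*\Big(\sum_{j=1}^{r^*}\lambda_j^2\Big)\frac1\delta\log\frac1\delta$$ operations per edge and yields a $\delta$-accurate message vector: $$\max_{v\to u}\ \mathbb E\big[\|m^T_{v\to u}-m^*_{v\to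 u}\|_{L^2}^2\big]\le\delta .$$ -/

import Mathlib

open MeasureTheory

namespace SOSMP

/-! ## Pairwise Markov random fields and belief propagation -/

/-- The potential functions of a pairwise Markov random field on the graph `G`, with all variables
taking values in `X`: a positive function `nodePot v` for every vertex and a positive function
`edgePot u v (x_u) (x_v)` for every edge (one function per undirected edge, whence the last
field). -/
structure PairwiseMRF {V : Type*} (G : SimpleGraph V) (X : Type*) where
  nodePot : V → X → ℝ
  edgePot : V → V → X → X → ℝ
  nodePot_pos : ∀ v x, 0 < nodePot v x
  edgePot_pos : ∀ u v, G.Adj u v → ∀ x y, 0 < edgePot u v x y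
  edgePot_swap : ∀ u v, G.Adj u v → ∀ x y, edgePot u v x y = edgePot v u y x

section BP

variable {V : Type*} [Fintype V] [DecidableEq V] {G : SimpleGraph V} [DecidableRel G.Adj]
variable {X : Type*} [MeasurableSpace X]

/-- The `L²(μ)` norm of a real function. -/
noncomputable def l2norm (μ : Measure X) (f : X → ℝ) : ℝ := Real.sqrt (∫ x, f x ^ 2 ∂μ)

/-- Square-integrable probability densities with respect to `μ`. -/
def IsDensity (μ : Measure X) (m : X → ℝ) : Prop :=
  Measurable m ∧ (∀ x, 0 ≤ m x) ∧ MemLp m 2 μ ∧ ∫ x, m x ∂μ = 1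

/-- A directed edge `v → u` is a dart `e` with `e.fst = v` and `e.snd = u`. The messages that enter
its update are those on the directed edges `w → v` with `w` a neighbour of `v` other than `u`. -/
def incoming (e : G.Dart) : Finset G.Dart :=
  Finset.univ.filter fun d => d.snd = e.fst ∧ d.fst ≠ e.snd

/-- `y ↦ ψ_v(y) ∏_{w ∈ N(v) \ {u}} m_{w → v}(y)` for the directed edge `v → u`. -/
noncomputable def nodeProduct (M : PairwiseMRF G X) (e : G.Dart) (m : G.Dart → X → ℝ) (y : X) : ℝ :=
  M.nodePot e.fst y * ∏ d ∈ incoming e, m d y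

/-- The messages `m` can be updated along `e`: the normalisation constant of the update exists. -/
def BPDefined (μ : Measure X) (M : PairwiseMRF G X) (e : G.Dart) (m : G.Dart → X → ℝ) : Prop :=
  Integrable (nodeProduct M e m) μ ∧ 0 < ∫ y, nodeProduct M e m y ∂μ

/-- The unnormalised message
`x ↦ ∫ ψ_{uv}(x, y) ψ_v(y) ∏_{w ∈ N(v) \ {u}} m_{w → v}(y) μ(dy)`. -/
noncomputable def bpIntegral (μ : Measure X) (M : PairwiseMRF G X) (e : G.Dart)
    (m : G.Dart → X → ℝ) (x : X) : ℝ :=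
  ∫ y, M.edgePot e.snd e.fst x y * nodeProduct M e m y ∂μ

/-- The belief propagation update of the message on the directed edge `e`. -/
noncomputable def bpUpdate (μ : Measure X) (M : PairwiseMRF G X) (e : G.Dart)
    (m : G.Dart → X → ℝ) (x : X) : ℝ :=
  (∫ x', bpIntegral μ M e m x' ∂μ)⁻¹ * bpIntegral μ M e m x

/-- Fixed points of belief propagation: collections of densities that the update reproduces. -/
def IsBPFixedPoint (μ : Measure X) (M : PairwiseMRF G X) (m : G.Dart → X → ℝ) : Prop :=
  ∀ e, IsDensity μ (m e) ∧ BPDefined μ M e m ∧ bpUpdate μ M e m =ᵐ[μ] m e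

/-- Belief propagation is `γ`-contractive on the set `K` of feasible message collections. -/
def IsBPContractive (μ : Measure X) (M : PairwiseMRF G X) (γ : ℝ)
    (K : Set (G.Dart → X → ℝ)) : Prop :=
  ∀ m ∈ K, ∀ m' ∈ K, ∀ e : G.Dart, BPDefined μ M e m → BPDefined μ M e m' →
    l2norm μ (fun x => bpUpdate μ M e m x - bpUpdate μ M e m' x) ≤
      (1 - γ / 2) * Real.sqrt ((1 / ((incoming e).card : ℝ)) *
        ∑ d ∈ incoming e, l2norm μ (fun x => m d x - m' d x) ^ 2)

end BP

/-! ## Kernels and their eigenvalues -/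

/-- Symmetric positive semidefinite kernel functions. -/
def IsPSDKernel {X : Type*} (κ : X → X → ℝ) : Prop :=
  ∀ (n : ℕ) (x : Fin n → X), (Matrix.of fun i j => κ (x i) (x j)).PosSemidef

/-- `lam 0 ≥ lam 1 ≥ …` are the eigenvalues of the integral operator of `κ` on `L²(μ)`, repeated
according to multiplicity, and the `φ j` are corresponding continuous orthonormal eigenfunctions:
the operator vanishes on the orthogonal complement of the `φ j`. (An orthonormal basis of `L²(μ)`
that consists of eigenfunctions is the case in which this complement is zero.) -/
structure IsEigensystem {X : Type*} [TopologicalSpace X] [MeasurableSpace X] (μ : Measure X)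
    (κ : X → X → ℝ) (lam : ℕ → ℝ) (φ : ℕ → X → ℝ) : Prop where
  antitone : Antitone lam
  continuous : ∀ j, Continuous (φ j)
  orthonormal : ∀ i j, ∫ x, φ i x * φ j x ∂μ = if i = j then 1 else 0
  eigen : ∀ j x, ∫ y, κ x y * φ j y ∂μ = lam j * φ j x
  complete : ∀ f : X → ℝ, MemLp f 2 μ → (∀ j, ∫ x, f x * φ j x ∂μ = 0) →
    ∀ᵐ x ∂μ, ∫ y, κ x y * f y ∂μ = 0

/-- The critical dimension: the smallest integer `r ≥ 1` such that the `r`-th eigenvalue, which is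
`lam (r - 1)`, is at most `δ`. -/
noncomputable def criticalDim (lam : ℕ → ℝ) (δ : ℝ) : ℕ :=
  sInf {r : ℕ | 1 ≤ r ∧ lam (r - 1) ≤ δ}

/-! ## Computations with a count of their operations -/

/-- The result of a computation together with the number of operations spent on it. -/
structure Counted (α : Type*) where
  val : α
  ops : ℕ

namespace Counted

/-- A value that is already available. -/
def free {α : Type*} (a : α) : Counted α := ⟨a, 0⟩

/-- Run `x`, then `f` on its result; the counts add up. -/
def andThen {α β : Type*} (x : Counted α) (f : α → Counted β) : Counted β :=
  ⟨(f x.val).val, x.ops + (f x.val).ops⟩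

/-- Run `f i` for every `i : Fin n` and collect the results in a vector. -/
def forAll {α : Type*} {n : ℕ} (f : Fin n → Counted α) : Counted (Fin n → α) :=
  ⟨fun i => (f i).val, ∑ i, (f i).ops⟩

/-- One addition. -/
noncomputable def add (x y : ℝ) : Counted ℝ := ⟨x + y, 1⟩

/-- One subtraction. -/
noncomputable def sub (x y : ℝ) : Counted ℝ := ⟨x - y, 1⟩

/-- One multiplication. -/
noncomputable def mul (x y : ℝ) : Counted ℝ := ⟨x * y, 1⟩

/-- One division. -/
noncomputable def div (x y : ℝ) : Counted ℝ := ⟨x / y, 1⟩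

/-- One evaluation of a function computed in advance. -/
def eval {α : Type*} (f : α → ℝ) (a : α) : Counted ℝ := ⟨f a, 1⟩

/-- The sum of the values of the pre-computed function `f` at the points of a list. -/
noncomputable def sumEval {α : Type*} (f : α → ℝ) : List α → Counted ℝ
  | [] => free 0
  | a :: l => (sumEval f l).andThen fun s => (eval f a).andThen fun z => add z s

end Counted

/-! ## Stochastic orthogonal series message passing -/

section Algorithm

variable {V : Type*} [Fintype V] [DecidableEq V] {G : SimpleGraph V} [DecidableRel G.Adj]
variable {X : Type*} [MeasurableSpace X]

/-- `β_{uv}(y) = ψ_v(y) ∫ ψ_{uv}(x, y) μ(dx)` for the directed edge `v → u`. -/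
noncomputable def betaFun (μ : Measure X) (M : PairwiseMRF G X) (e : G.Dart) (y : X) : ℝ :=
  M.nodePot e.fst y * ∫ x, M.edgePot e.snd e.fst x y ∂μ

/-- The normalised compatibility function `Γ_{uv}(x, y) = ψ_{uv}(x, y) ψ_v(y) / β_{uv}(y)`. -/
noncomputable def normCompat (μ : Measure X) (M : PairwiseMRF G X) (e : G.Dart) (x y : X) : ℝ :=
  M.edgePot e.snd e.fst x y * (M.nodePot e.fst y / betaFun μ M e y)

/-- The inner products `y ↦ ⟨Γ_{uv}(·, y), φ_j⟩`, computed before the algorithm is run. -/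
noncomputable def compatCoeff (μ : Measure X) (M : PairwiseMRF G X) (φ : G.Dart → ℕ → X → ℝ)
    (e : G.Dart) (j : ℕ) (y : X) : ℝ :=
  ∫ x, normCompat μ M e x y * φ e j x ∂μ

/-- The message `∑_{j ≤ r} a_j φ_j` with coefficient vector `a` on the directed edge `e`. -/
noncomputable def message (φ : G.Dart → ℕ → X → ℝ) {r : ℕ} (a : G.Dart → Fin r → ℝ)
    (e : G.Dart) (x : X) : ℝ :=
  ∑ j, a e j * φ e j x

/-- The projected message `[∑_{j ≤ r} a_j φ_j]₊`. -/
noncomputable def posMessage (φ : G.Dart → ℕ → X → ℝ) {r : ℕ} (a : G.Dart → Fin r → ℝ)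
    (e : G.Dart) (x : X) : ℝ :=
  max 0 (message φ a e x)

/-- The unnormalised density `y ↦ β_{uv}(y) ∏_{w ∈ N(v) \ {u}} [∑_j a_{w → v; j} φ_j(y)]₊` from
which the samples for the directed edge `v → u` are drawn. -/
noncomputable def sampleWeight (μ : Measure X) (M : PairwiseMRF G X) (φ : G.Dart → ℕ → X → ℝ)
    {r : ℕ} (a : G.Dart → Fin r → ℝ) (e : G.Dart) (y : X) : ℝ :=
  betaFun μ M e y * ∏ d ∈ incoming e, posMessage φ a d y

/-- The distribution whose `μ`-density is proportional to `sampleWeight`. -/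
noncomputable def sampleLaw (μ : Measure X) (M : PairwiseMRF G X) (φ : G.Dart → ℕ → X → ℝ)
    {r : ℕ} (a : G.Dart → Fin r → ℝ) (e : G.Dart) : Measure X :=
  μ.withDensity fun y =>
    ENNReal.ofReal (sampleWeight μ M φ a e y / ∫ z, sampleWeight μ M φ a e z ∂μ)

/-- Iteration `t` of the algorithm on the directed edge `e`: draw the `k` samples `y`, average the
pre-computed functions over them, and move the coefficient vector `a` towards the average with step
size `η = 1 / (γ (t + 1))`. Every arithmetic operation and every evaluation of a pre-computed
function counts as one operation, and drawing one sample from a density that is given by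
`r`-dimensional coefficient vectors as `c * r` operations. -/
noncomputable def edgeStep (μ : Measure X) (M : PairwiseMRF G X) (φ : G.Dart → ℕ → X → ℝ)
    (γ : ℝ) (c r k : ℕ) (e : G.Dart) (t : ℕ) (y : Fin k → X) (a : Fin r → ℝ) :
    Counted (Fin r → ℝ) :=
  (Counted.forAll fun i => (⟨y i, c * r⟩ : Counted X)).andThen fun y =>
  (Counted.add t 1).andThen fun s =>
  (Counted.mul γ s).andThen fun s =>
  (Counted.div 1 s).andThen fun η =>
  (Counted.sub 1 η).andThen fun θ =>
  Counted.forAll fun j =>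
    (Counted.sumEval (compatCoeff μ M φ e j) (List.ofFn y)).andThen fun s =>
    (Counted.div s k).andThen fun b =>
    (Counted.mul θ (a j)).andThen fun p =>
    (Counted.mul η b).andThen fun q =>
    Counted.add p q

/-- The algorithm with `r` coefficients and `k` samples per update, run on the samples
`y t e i` (the `i`-th sample that iteration `t` draws for the directed edge `e`): the coefficient
vector on the directed edge `e` after `t` iterations, and the number of operations spent on this
edge. All coefficients are initially `1 / r`. -/
noncomputable def sosmp (μ : Measure X) (M : PairwiseMRF G X) (φ : G.Dart → ℕ → X → ℝ)
    (γ : ℝ) (c r k : ℕ) (y : ℕ → G.Dart → Fin k → X) : ℕ → G.Dart → Counted (Fin r → ℝ)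
  | 0, _ => Counted.forAll fun _ => Counted.div 1 r
  | t + 1, e => (sosmp μ M φ γ c r k y t e).andThen (edgeStep μ M φ γ c r k e t (y t e))

/-- The coefficient vectors on all directed edges after `t` iterations. (They do not depend on the
cost `c` of a sample, which enters the count only.) -/
noncomputable def coeffs (μ : Measure X) (M : PairwiseMRF G X) (φ : G.Dart → ℕ → X → ℝ)
    (γ : ℝ) (r k : ℕ) (y : ℕ → G.Dart → Fin k → X) (t : ℕ) (e : G.Dart) : Fin r → ℝ :=
  (sosmp μ M φ γ 0 r k y t e).val

variable {Ω : Type*} [MeasurableSpace Ω]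

/-- The σ-algebra generated by all samples that are drawn before iteration `t`. -/
@[reducible] def history {k : ℕ} (Y : ℕ → G.Dart → Fin k → Ω → X) (t : ℕ) : MeasurableSpace Ω :=
  ⨆ (s : Fin t) (e : G.Dart) (i : Fin k), MeasurableSpace.comap (Y s e i) inferInstance

/-- `Y t e i` are random samples as the algorithm draws them: given the past, the `k` samples that
iteration `t` draws for the directed edge `e` are independent with distribution `sampleLaw` at the
current coefficients. Nothing is required where the sampling density does not exist because its
normalisation constant vanishes, and nothing about the joint law of the samples for different
edges. -/
structure IsRun (P : Measure Ω) (μ : Measure X) (M : PairwiseMRF G X)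
    (φ : G.Dart → ℕ → X → ℝ) (γ : ℝ) (r k : ℕ) (Y : ℕ → G.Dart → Fin k → Ω → X) : Prop where
  measurable : ∀ t e i, Measurable (Y t e i)
  law : ∀ (t : ℕ) (e : G.Dart) (S : Set Ω), MeasurableSet[history Y t] S →
    (∀ ω ∈ S, 0 < ∫ y, sampleWeight μ M φ
      (coeffs μ M φ γ r k (fun s d i => Y s d i ω) t) e y ∂μ) →
    ∀ B : Set (Fin k → X), MeasurableSet B →
      P (S ∩ {ω | (fun i => Y t e i ω) ∈ B}) =
        ∫⁻ ω in S, Measure.pi (fun _ : Fin k => sampleLaw μ M φ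
          (coeffs μ M φ γ r k (fun s d i => Y s d i ω) t) e) B ∂P

/-- The iterates of the run are feasible: almost surely, whenever the projected messages of an
iterate can be normalised to probability densities, these densities belong to `K`. If `K` consists
of all collections of densities, this always holds. -/
def StaysIn (P : Measure Ω) (μ : Measure X) (M : PairwiseMRF G X)
    (φ : G.Dart → ℕ → X → ℝ) (γ : ℝ) (r k : ℕ) (Y : ℕ → G.Dart → Fin k → Ω → X)
    (K : Set (G.Dart → X → ℝ)) : Prop :=
  ∀ᵐ ω ∂P, ∀ t : ℕ, ∀ a, a = coeffs μ M φ γ r k (fun s d i => Y s d i ω) t →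
    (∀ e, 0 < ∫ x, posMessage φ a e x ∂μ) →
    (fun e x => posMessage φ a e x / ∫ z, posMessage φ a e z ∂μ) ∈ K

end Algorithm

end SOSMP

namespace SOSMP

set_option linter.unusedSectionVars false

/-! ## Square-integrable functions -/

section L2

variable {X : Type*} [MeasurableSpace X] {μ : Measure X}

/-! Put r = `criticalDim lam δ` and let S be the squared distance of the r coefficients of an
iterate from those of m* (`sqErr`). By Pythagoras the squared L² error of a message is S plus the
squared tail of m*. Since m* is an integral operator applied to a square-integrable function, its
tail has norm at most a constant times `lam r` ≤ δ, so its square is O(δ²). It remains to make E S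
at most δ/2.

Given the past, the mean of the sampled coefficients is the coefficient vector of the BP update of
the projected, normalised messages n (`integral_compatCoeff_mul_sampleDensity`). If ‖n − m*‖ ≤ √S +
τ on every edge, then expanding the square, Cauchy–Schwarz and contraction bound the next value of E
S by (1 − γη) b + η (2τ√b + τ²) + O(η²), where b bounds E S on all edges and γη = 1/(t+1)
(`integral_sqErr_succ_le`, `step_bound`). A constant τ leaves a limiting error of order τ², so τ =
O(√δ) with an uncontrolled constant would not be enough. What is proved is τ = ε√δ + C `decay γ t`
with ε arbitrary.

This is a matter of how far the normalising constant of the projected message is from 1. The same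
samples drive an untruncated recursion (`fullMessage`), whose values are affine combinations of the
densities Γ(·, y) with bounded total absolute weight. They have integral 1 and are eventually
bounded below by some c > 0. The actual message is the truncation of this function, up to a multiple
of `decay γ t` left over from the initial values. By the diagonal bound Σ λ_j φ_j(y)² ≤ κ(y, y), the
truncation error has norm O(√δ). Its integral is its inner product with the constant 1 and hence
with the tail of 1, which tends to 0 as r grows, so the integral is o(√δ)
(`eventually_abs_integral_resid_le`). Where the message is negative it differs from the untruncated
one by at least c, so taking the positive part changes the integral by at most the squared L²
distance over c, a second-order quantity. All these bounds hold for arbitrary sequences of points in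
place of the samples.

The resulting recursion gives E S = O((log T)/T) + O(ε²δ) (`exists_stochastic_recursion_bound`).
Here γ < 2 enters once more: `decay γ t` = (t+1)^(−1/γ) is then square summable, and summable after
division by √t. So T of order (1/δ) log(1/δ) is sufficient. The cost is at most a constant times r
T, and the factor Σ λ_j² of the claimed bound is at least λ_1² > 0. -/

theorem inner_toLp {f g : X → ℝ} (hf : MemLp f 2 μ) (hg : MemLp g 2 μ) :
    inner ℝ (hf.toLp f) (hg.toLp g) = ∫ x, f x * g x ∂μ := by
  rw [L2.inner_def]
  refine integral_congr_ae ?_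
  filter_upwards [hf.coeFn_toLp, hg.coeFn_toLp] with x h1 h2
  rw [h1, h2]
  simp [mul_comm]

theorem l2norm_nonneg (f : X → ℝ) : 0 ≤ l2norm μ f := Real.sqrt_nonneg _

theorem l2norm_sq (f : X → ℝ) : l2norm μ f ^ 2 = ∫ x, f x ^ 2 ∂μ :=
  Real.sq_sqrt (integral_nonneg fun _ => sq_nonneg _)

theorem l2norm_congr {f g : X → ℝ} (h : f =ᵐ[μ] g) : l2norm μ f = l2norm μ g := by
  unfold l2norm
  congr 1
  refine integral_congr_ae ?_
  filter_upwards [h] with x hx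
  rw [hx]

theorem norm_toLp {f : X → ℝ} (hf : MemLp f 2 μ) : ‖hf.toLp f‖ = l2norm μ f := by
  rw [← Real.sqrt_sq (norm_nonneg (hf.toLp f)), ← real_inner_self_eq_norm_sq, inner_toLp, l2norm]
  simp only [sq]

theorem abs_integral_mul_le {f g : X → ℝ} (hf : MemLp f 2 μ) (hg : MemLp g 2 μ) :
    |∫ x, f x * g x ∂μ| ≤ l2norm μ f * l2norm μ g := by
  rw [← inner_toLp hf hg, ← norm_toLp hf, ← norm_toLp hg]
  exact abs_real_inner_le_norm _ _

theorem l2norm_add_le {f g : X → ℝ} (hf : MemLp f 2 μ) (hg : MemLp g 2 μ) :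
    l2norm μ (fun x => f x + g x) ≤ l2norm μ f + l2norm μ g := by
  rw [← norm_toLp hf, ← norm_toLp hg]
  have h : l2norm μ (fun x => f x + g x) = ‖(hf.add hg).toLp (f + g)‖ := (norm_toLp _).symm
  rw [h, MemLp.toLp_add hf hg]
  exact norm_add_le _ _

theorem l2norm_const_mul (c : ℝ) (f : X → ℝ) :
    l2norm μ (fun x => c * f x) = |c| * l2norm μ f := by
  unfold l2norm
  simp only [mul_pow, integral_const_mul]
  rw [Real.sqrt_mul (sq_nonneg c), Real.sqrt_sq_eq_abs]

theorem l2norm_sub_le {f g : X → ℝ} (hf : MemLp f 2 μ) (hg : MemLp g 2 μ) :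
    l2norm μ (fun x => f x - g x) ≤ l2norm μ f + l2norm μ g := by
  have h := l2norm_add_le hf (hg.const_mul (-1))
  rw [l2norm_const_mul] at h
  simpa [sub_eq_add_neg] using h

theorem l2norm_sum_le {ι : Type*} (s : Finset ι) {f : ι → X → ℝ}
    (hf : ∀ i ∈ s, MemLp (f i) 2 μ) :
    l2norm μ (fun x => ∑ i ∈ s, f i x) ≤ ∑ i ∈ s, l2norm μ (f i) := by
  classical
  induction s using Finset.induction_on with
  | empty => simp [l2norm]
  | insert a s ha ih =>
    have h1 : MemLp (fun x => ∑ i ∈ s, f i x) 2 μ :=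
      memLp_finsetSum s fun i hi => hf i (Finset.mem_insert_of_mem hi)
    have h2 := l2norm_add_le (hf a (Finset.mem_insert_self _ _)) h1
    simp only [Finset.sum_insert ha]
    exact h2.trans (add_le_add le_rfl (ih fun i hi => hf i (Finset.mem_insert_of_mem hi)))

theorem l2norm_mono {f g : X → ℝ} (hg : MemLp g 2 μ) (h : ∀ x, |f x| ≤ |g x|) :
    l2norm μ f ≤ l2norm μ g :=
  Real.sqrt_le_sqrt (integral_mono_of_nonneg (Filter.Eventually.of_forall fun _ => sq_nonneg _)
    hg.integrable_sq (Filter.Eventually.of_forall fun x => sq_le_sq.2 (h x)))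

/-- An element of the closed span of an orthonormal sequence is the sum of its components. -/
theorem hasSum_inner_mul_inner {H : Type*} [NormedAddCommGroup H] [InnerProductSpace ℝ H]
    [CompleteSpace H] {v : ℕ → H} (hv : Orthonormal ℝ v) {u : H}
    (hu : ∀ f : H, (∀ j, inner ℝ (v j) f = 0) → inner ℝ u f = 0) (w : H) :
    HasSum (fun j => inner ℝ (v j) w * inner ℝ (v j) u) (inner ℝ w u) := by
  have hs : Summable fun j => inner ℝ (v j) u • v j := by
    have := (hv.orthogonalFamily.summable_iff_norm_sq_summable fun j => inner ℝ (v j) u).2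
      (hv.inner_products_summable u)
    simpa using this
  obtain ⟨s, hs⟩ := hs
  have hcomp : ∀ w : H, HasSum (fun j => inner ℝ (v j) u * inner ℝ w (v j)) (inner ℝ w s) := by
    intro w
    have := hs.mapL (innerSL ℝ w)
    simpa [inner_smul_right] using this
  have hj : ∀ j, inner ℝ (v j) (u - s) = 0 := by
    intro j
    have h1 := hcomp (v j)
    have h2 : HasSum (fun i => inner ℝ (v i) u * inner ℝ (v j) (v i)) (inner ℝ (v j) u) := by
      have := hasSum_single (f := fun i => inner ℝ (v i) u * inner ℝ (v j) (v i)) j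
        (fun i hi => by rw [hv.2 (Ne.symm hi), mul_zero])
      simpa [real_inner_self_eq_norm_sq, hv.1 j] using this
    rw [inner_sub_right, h1.unique h2, sub_self]
  -- The difference is orthogonal to u by `hu`, and to s because s is a limit of combinations of the
  -- `v j`. Hence it is orthogonal to itself.
  have h1 : inner ℝ u (u - s) = 0 := hu _ hj
  have h2 : inner ℝ (u - s) s = 0 := by
    have h := hcomp (u - s)
    have h0 : (fun j => inner ℝ (v j) u * inner ℝ (u - s) (v j)) = fun _ => (0 : ℝ) := by
      funext j
      rw [real_inner_comm (v j) (u - s), hj j, mul_zero]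
    rw [h0] at h
    exact h.unique hasSum_zero
  have h3 : u - s = 0 := by
    rw [← inner_self_eq_zero (𝕜 := ℝ)]
    nth_rewrite 1 [inner_sub_left]
    rw [h1, real_inner_comm, h2, sub_zero]
  rw [sub_eq_zero] at h3
  have := hcomp w
  rw [← h3] at this
  convert this using 2 with j
  rw [real_inner_comm, mul_comm]

/-- The coefficients of `f` with respect to the sequence `φ`. -/
noncomputable def coef (μ : Measure X) (φ : ℕ → X → ℝ) (f : X → ℝ) (j : ℕ) : ℝ :=
  ∫ x, f x * φ j x ∂μ

/-- What remains of `f` when its first `r` components are removed. -/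
noncomputable def resid (μ : Measure X) (φ : ℕ → X → ℝ) (r : ℕ) (f : X → ℝ) (x : X) : ℝ :=
  f x - ∑ j ∈ Finset.range r, coef μ φ f j * φ j x

/-- `φ` is an orthonormal sequence of square-integrable functions. -/
def OrthonormalSeq (μ : Measure X) (φ : ℕ → X → ℝ) : Prop :=
  (∀ j, MemLp (φ j) 2 μ) ∧ ∀ i j, ∫ x, φ i x * φ j x ∂μ = if i = j then 1 else 0

/-- `u` belongs to the closed span of `φ`: it is orthogonal to everything orthogonal to `φ`. -/
def InClosedSpan (μ : Measure X) (φ : ℕ → X → ℝ) (u : X → ℝ) : Prop :=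
  ∀ f, MemLp f 2 μ → (∀ j, ∫ x, f x * φ j x ∂μ = 0) → ∫ x, u x * f x ∂μ = 0

/-! ### Parseval and Bessel for coefficients and tails with respect to an orthonormal sequence -/

variable {φ : ℕ → X → ℝ}

theorem OrthonormalSeq.orthonormal (hφ : OrthonormalSeq μ φ) :
    Orthonormal ℝ fun j => (hφ.1 j).toLp (φ j) := by
  rw [orthonormal_iff_ite]
  intro i j
  rw [inner_toLp, hφ.2]

theorem OrthonormalSeq.summable_coef_sq (hφ : OrthonormalSeq μ φ) {w : X → ℝ}
    (hw : MemLp w 2 μ) : Summable fun j => coef μ φ w j ^ 2 := by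
  have := hφ.orthonormal.inner_products_summable (hw.toLp w)
  refine this.congr fun j => ?_
  rw [inner_toLp, Real.norm_eq_abs, sq_abs, coef]
  simp only [mul_comm]

theorem OrthonormalSeq.sum_coef_sq_le (hφ : OrthonormalSeq μ φ) {w : X → ℝ}
    (hw : MemLp w 2 μ) (s : Finset ℕ) : ∑ j ∈ s, coef μ φ w j ^ 2 ≤ ∫ x, w x ^ 2 ∂μ := by
  have := hφ.orthonormal.sum_inner_products_le (hw.toLp w) (s := s)
  rw [norm_toLp, l2norm_sq] at this
  refine le_trans (le_of_eq (Finset.sum_congr rfl fun j _ => ?_)) this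
  rw [inner_toLp, Real.norm_eq_abs, sq_abs, coef]
  simp only [mul_comm]

theorem OrthonormalSeq.hasSum_coef_mul (hφ : OrthonormalSeq μ φ) {u w : X → ℝ}
    (hu : MemLp u 2 μ) (hw : MemLp w 2 μ) (hspan : InClosedSpan μ φ u) :
    HasSum (fun j => coef μ φ w j * coef μ φ u j) (∫ x, w x * u x ∂μ) := by
  have h := hasSum_inner_mul_inner hφ.orthonormal (u := hu.toLp u) ?_ (hw.toLp w)
  · rw [inner_toLp] at h
    convert h using 2 with j
    rw [inner_toLp, inner_toLp, coef, coef]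
    simp only [mul_comm]
  · intro f hf
    have hfm : MemLp (f : X → ℝ) 2 μ := Lp.memLp f
    have hfe : hfm.toLp f = f := Lp.toLp_coeFn f _
    rw [← hfe, inner_toLp]
    refine hspan f hfm fun j => ?_
    have := hf j
    rw [← hfe, inner_toLp] at this
    simpa only [mul_comm] using this

theorem MemLp.integrable_mul_two {f g : X → ℝ} (hf : MemLp f 2 μ) (hg : MemLp g 2 μ) :
    Integrable (fun x => f x * g x) μ :=
  hf.integrable_mul hg

theorem OrthonormalSeq.memLp_sum (hφ : OrthonormalSeq μ φ) (s : Finset ℕ) (a : ℕ → ℝ) :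
    MemLp (fun x => ∑ j ∈ s, a j * φ j x) 2 μ :=
  memLp_finsetSum s fun j _ => (hφ.1 j).const_mul (a j)

theorem OrthonormalSeq.memLp_resid (hφ : OrthonormalSeq μ φ) {u : X → ℝ}
    (hu : MemLp u 2 μ) (r : ℕ) : MemLp (resid μ φ r u) 2 μ :=
  hu.sub (hφ.memLp_sum _ _)

theorem OrthonormalSeq.integral_mul_sum (hφ : OrthonormalSeq μ φ) {w : X → ℝ}
    (hw : MemLp w 2 μ) (s : Finset ℕ) (a : ℕ → ℝ) :
    ∫ x, w x * ∑ j ∈ s, a j * φ j x ∂μ = ∑ j ∈ s, a j * coef μ φ w j := by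
  simp only [Finset.mul_sum]
  rw [integral_finsetSum]
  · refine Finset.sum_congr rfl fun j _ => ?_
    rw [coef, ← integral_const_mul]
    congr 1 with x
    ring
  · intro j _
    exact MemLp.integrable_mul_two hw ((hφ.1 j).const_mul (a j))

theorem OrthonormalSeq.coef_sum (hφ : OrthonormalSeq μ φ) (s : Finset ℕ) (a : ℕ → ℝ) (i : ℕ) :
    coef μ φ (fun x => ∑ j ∈ s, a j * φ j x) i = if i ∈ s then a i else 0 := by
  have h := hφ.integral_mul_sum (hφ.1 i) s a
  have h2 : ∀ j, coef μ φ (φ i) j = if i = j then 1 else 0 := fun j => hφ.2 i j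
  simp only [h2, mul_ite, mul_one, mul_zero, Finset.sum_ite_eq] at h
  rw [← h, coef]
  simp only [mul_comm]

theorem OrthonormalSeq.integral_sum_sq (hφ : OrthonormalSeq μ φ) (s : Finset ℕ) (a : ℕ → ℝ) :
    ∫ x, (∑ j ∈ s, a j * φ j x) ^ 2 ∂μ = ∑ j ∈ s, a j ^ 2 := by
  simp only [sq]
  rw [hφ.integral_mul_sum (hφ.memLp_sum s a)]
  refine Finset.sum_congr rfl fun j hj => ?_
  rw [hφ.coef_sum, if_pos hj]

theorem OrthonormalSeq.integral_mul_resid (hφ : OrthonormalSeq μ φ) {u w : X → ℝ}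
    (hu : MemLp u 2 μ) (hw : MemLp w 2 μ) (r : ℕ) :
    ∫ x, w x * resid μ φ r u x ∂μ =
      ∫ x, w x * u x ∂μ - ∑ j ∈ Finset.range r, coef μ φ w j * coef μ φ u j := by
  simp only [resid, mul_sub]
  rw [integral_sub (MemLp.integrable_mul_two hw hu)
    (MemLp.integrable_mul_two hw (hφ.memLp_sum _ _)), hφ.integral_mul_sum hw]
  simp only [mul_comm]

theorem OrthonormalSeq.coef_resid (hφ : OrthonormalSeq μ φ) {u : X → ℝ}
    (hu : MemLp u 2 μ) (r i : ℕ) :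
    coef μ φ (resid μ φ r u) i = if i < r then 0 else coef μ φ u i := by
  have h := hφ.integral_mul_resid hu (hφ.1 i) r
  have h2 : ∀ j, coef μ φ (φ i) j = if i = j then 1 else 0 := fun j => hφ.2 i j
  simp only [h2, ite_mul, one_mul, zero_mul, Finset.sum_ite_eq, Finset.mem_range] at h
  have h3 : coef μ φ (resid μ φ r u) i = ∫ x, φ i x * resid μ φ r u x ∂μ := by
    simp only [coef, mul_comm]
  have h4 : coef μ φ u i = ∫ x, φ i x * u x ∂μ := by
    simp only [coef, mul_comm]
  rw [h3, h, ← h4]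
  split_ifs <;> simp

/-- Parseval with the first r terms removed. The sequence need not be complete: it is enough that
one of the two functions lies in its closed span. -/
theorem OrthonormalSeq.hasSum_tail (hφ : OrthonormalSeq μ φ) {u w : X → ℝ}
    (hu : MemLp u 2 μ) (hw : MemLp w 2 μ) (hspan : InClosedSpan μ φ u) (r : ℕ) :
    HasSum (fun j => coef μ φ w (j + r) * coef μ φ u (j + r))
      (∫ x, w x * resid μ φ r u x ∂μ) := by
  rw [hasSum_nat_add_iff (f := fun j => coef μ φ w j * coef μ φ u j) r,
    hφ.integral_mul_resid hu hw, sub_add_cancel]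
  exact hφ.hasSum_coef_mul hu hw hspan

theorem OrthonormalSeq.hasSum_resid_sq (hφ : OrthonormalSeq μ φ) {u : X → ℝ}
    (hu : MemLp u 2 μ) (hspan : InClosedSpan μ φ u) (r : ℕ) :
    HasSum (fun j => coef μ φ u (j + r) ^ 2) (∫ x, resid μ φ r u x ^ 2 ∂μ) := by
  -- The residual itself is the test function; from index r on its coefficients are those of u.
  have h := hφ.hasSum_tail hu (hφ.memLp_resid hu r) hspan r
  convert h using 2 with j j
  · rw [hφ.coef_resid hu, if_neg (by omega), sq]
  · exact sq _

theorem HasSum.sq_le_mul {a b : ℕ → ℝ} {s A B : ℝ} (h : HasSum (fun j => a j * b j) s)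
    (ha : HasSum (fun j => a j ^ 2) A) (hb : HasSum (fun j => b j ^ 2) B) : s ^ 2 ≤ A * B := by
  have h1 : Filter.Tendsto (fun F : Finset ℕ => (∑ j ∈ F, a j * b j) ^ 2) Filter.atTop
    (nhds (s ^ 2)) := Filter.Tendsto.pow h 2
  have h2 := Filter.Tendsto.mul ha hb
  exact le_of_tendsto_of_tendsto' h1 h2 fun F => Finset.sum_mul_sq_le_sq_mul_sq _ _ _

end L2

/-! ## Continuous positive semidefinite kernels -/

section Kernel

variable {X : Type*} [MetricSpace X] [CompactSpace X] [MeasurableSpace X] [BorelSpace X]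
  {μ : Measure X} [IsFiniteMeasure μ] {κ : X → X → ℝ}

theorem continuous_integral_right {E : Type*} [TopologicalSpace E] [FirstCountableTopology E]
    [LocallyCompactSpace E] {f : E → X → ℝ} (hf : Continuous (Function.uncurry f)) :
    Continuous fun a => ∫ y, f a y ∂μ := by
  have := continuous_parametric_integral_of_continuous (μ := μ) hf isCompact_univ
  simpa using this

theorem exists_bound_of_continuous {E : Type*} [TopologicalSpace E] [CompactSpace E]
    {f : E → ℝ} (hf : Continuous f) : ∃ C, 0 < C ∧ ∀ x, |f x| ≤ C := by
  obtain ⟨C, hC⟩ := isCompact_univ.exists_bound_of_continuousOn hf.continuousOn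
  exact ⟨max C 1, lt_max_of_lt_right one_pos, fun x => (hC x trivial).trans (le_max_left _ _)⟩

theorem memLp_of_continuous {f : X → ℝ} (hf : Continuous f) (p : ENNReal) : MemLp f p μ := by
  obtain ⟨C, _, hC⟩ := exists_bound_of_continuous hf
  exact MemLp.of_bound hf.aestronglyMeasurable C (Filter.Eventually.of_forall hC)

theorem integrable_of_continuous {f : X → ℝ} (hf : Continuous f) : Integrable f μ :=
  memLp_one_iff_integrable.1 (memLp_of_continuous hf 1)

theorem exists_kernel_bound (hκ : Continuous (Function.uncurry κ)) :
    ∃ C, 0 < C ∧ ∀ x y, |κ x y| ≤ C := by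
  obtain ⟨C, h0, hC⟩ := exists_bound_of_continuous hκ
  exact ⟨C, h0, fun x y => hC (x, y)⟩

theorem IsPSDKernel.symm {X : Type*} {κ : X → X → ℝ} (h : IsPSDKernel κ) (x y : X) :
    κ x y = κ y x := by
  have := (h 2 ![x, y]).isHermitian.apply 0 1
  simpa using this.symm

theorem IsPSDKernel.sum_nonneg {X : Type*} {κ : X → X → ℝ} (h : IsPSDKernel κ) (n : ℕ)
    (x : Fin n → X) (a : Fin n → ℝ) : 0 ≤ ∑ i, ∑ j, a i * κ (x i) (x j) * a j := by
  have := (h n x).dotProduct_mulVec_nonneg a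
  simp only [dotProduct, Matrix.mulVec, Pi.star_apply, star_trivial, Matrix.of_apply,
    Finset.mul_sum] at this
  refine this.trans (le_of_eq ?_)
  simp only [mul_assoc]

/-- The quadratic form at n + 1 points, with the last one singled out because it stays fixed when
the others are drawn at random below. -/
theorem IsPSDKernel.sum_add_point_nonneg {X : Type*} {κ : X → X → ℝ} (h : IsPSDKernel κ) (n : ℕ)
    (x : Fin n → X) (a : Fin n → ℝ) (y : X) (s : ℝ) :
    0 ≤ (∑ i, ∑ j, a i * κ (x i) (x j) * a j) + 2 * s * (∑ i, κ y (x i) * a i) +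
      s ^ 2 * κ y y := by
  have := h.sum_nonneg (n + 1) (Fin.cons y x) (Fin.cons s a)
  simp only [Fin.sum_univ_succ, Fin.cons_zero, Fin.cons_succ, Finset.sum_add_distrib] at this
  refine this.trans (le_of_eq ?_)
  have h1 : ∑ i, a i * κ (x i) y * s = s * ∑ i, κ y (x i) * a i := by
    rw [Finset.mul_sum]
    refine Finset.sum_congr rfl fun i _ => ?_
    rw [h.symm (x i) y]
    ring
  have h2 : ∑ i, s * κ y (x i) * a i = s * ∑ i, κ y (x i) * a i := by
    rw [Finset.mul_sum]
    refine Finset.sum_congr rfl fun i _ => ?_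
    ring
  rw [h1, h2]
  ring

theorem integrable_mul_kernel_mul (hκ : Continuous (Function.uncurry κ)) {f g : X → ℝ}
    (hf : Integrable f μ) (hg : Integrable g μ) :
    Integrable (fun z : X × X => f z.1 * κ z.1 z.2 * g z.2) (μ.prod μ) := by
  obtain ⟨C, _, hC⟩ := exists_kernel_bound hκ
  have h := (hf.mul_prod hg).bdd_mul (c := C) (f := fun z : X × X => κ z.1 z.2)
    hκ.aestronglyMeasurable (Filter.Eventually.of_forall fun z => hC z.1 z.2)
  refine h.congr (Filter.Eventually.of_forall fun z => ?_)
  simp only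
  ring

theorem integrable_kernel_mul (hκ : Continuous (Function.uncurry κ)) {f : X → ℝ}
    (hf : Integrable f μ) (x : X) : Integrable (fun y => κ x y * f y) μ := by
  obtain ⟨C, _, hC⟩ := exists_kernel_bound hκ
  have hc : Continuous (κ x) := hκ.comp (Continuous.prodMk_right x)
  exact hf.bdd_mul (c := C) hc.aestronglyMeasurable (Filter.Eventually.of_forall fun y => hC x y)

theorem integral_quadratic_swap (hκ : Continuous (Function.uncurry κ)) {f g : X → ℝ}
    (hf : Integrable f μ) (hg : Integrable g μ) :
    ∫ x, f x * ∫ y, κ x y * g y ∂μ ∂μ = ∫ y, (∫ x, f x * κ x y ∂μ) * g y ∂μ := by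
  have h := integral_integral_swap (μ := μ) (ν := μ) (f := fun x y => f x * κ x y * g y)
    (integrable_mul_kernel_mul hκ hf hg)
  simp only [mul_assoc, integral_const_mul] at h
  rw [h]
  congr 1 with y
  rw [← integral_mul_const]
  simp only [mul_assoc]

/-- A Monte Carlo argument: average the finite quadratic form over n independent points with law ν,
weighted by the values of f, together with the point y of weight nt. The diagonal terms contribute
only order n, so division by n² and n → ∞ leave the integral form. -/
theorem IsPSDKernel.quadratic_nonneg_of_isProbabilityMeasure {ν : Measure X}
    [IsProbabilityMeasure ν] (h : IsPSDKernel κ) (hκ : Continuous (Function.uncurry κ))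
    {f : X → ℝ} (hf : MemLp f 2 ν) (y : X) (t : ℝ) :
    0 ≤ (∫ x, f x * ∫ z, κ x z * f z ∂ν ∂ν) + 2 * t * (∫ x, κ y x * f x ∂ν) +
      t ^ 2 * κ y y := by
  set Q := ∫ x, f x * ∫ z, κ x z * f z ∂ν ∂ν with hQ
  set L := ∫ x, κ y x * f x ∂ν with hL
  set D := ∫ x, f x * κ x x * f x ∂ν with hD
  have hf1 : Integrable f ν := hf.integrable (by norm_num)
  have hdiag : Integrable (fun x => f x * κ x x * f x) ν := by
    obtain ⟨C, _, hC⟩ := exists_kernel_bound hκ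
    have hc : Continuous fun x => κ x x := hκ.comp (continuous_id.prodMk continuous_id)
    have h' := (MemLp.integrable_mul_two hf hf).bdd_mul (c := C) hc.aestronglyMeasurable
      (Filter.Eventually.of_forall fun y => hC y y)
    refine h'.congr (Filter.Eventually.of_forall fun z => ?_)
    simp only
    ring
  have key : ∀ n : ℕ, 0 ≤ (n : ℝ) * D + n * (n - 1) * Q + 2 * n ^ 2 * t * L +
      n ^ 2 * t ^ 2 * κ y y := by
    intro n
    let P := Measure.pi fun _ : Fin n => ν
    have heval : ∀ i : Fin n, MeasurePreserving (fun ω : Fin n → X => ω i) P ν := fun i =>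
      measurePreserving_eval (fun _ : Fin n => ν) i
    have hpair : ∀ i j : Fin n, i ≠ j →
        MeasurePreserving (fun ω : Fin n → X => (ω i, ω j)) P (ν.prod ν) := by
      intro i j hij
      refine ⟨by fun_prop, ?_⟩
      have hind := (ProbabilityTheory.iIndepFun_pi (μ := fun _ : Fin n => ν)
        (X := fun (_ : Fin n) (x : X) => x) fun _ => aemeasurable_id).indepFun hij
      rw [ProbabilityTheory.indepFun_iff_map_prod_eq_prod_map_map
        (measurable_pi_apply i).aemeasurable (measurable_pi_apply j).aemeasurable] at hind
      exact hind.trans (by rw [(heval i).map_eq, (heval j).map_eq])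
    have hI : ∀ i j : Fin n,
        Integrable (fun ω : Fin n → X => f (ω i) * κ (ω i) (ω j) * f (ω j)) P ∧
        ∫ ω, f (ω i) * κ (ω i) (ω j) * f (ω j) ∂P = if i = j then D else Q := by
      intro i j
      by_cases hij : i = j
      · subst hij
        refine ⟨(heval i).integrable_comp_of_integrable hdiag, ?_⟩
        rw [if_pos rfl]
        exact integral_comp_eval (μ := fun _ : Fin n => ν)
          (f := fun x => f x * κ x x * f x) hdiag.aestronglyMeasurable
      · have hint := integrable_mul_kernel_mul hκ hf1 hf1
        refine ⟨(hpair i j hij).integrable_comp_of_integrable hint, ?_⟩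
        rw [if_neg hij]
        have h1 := integral_map (μ := P) (hpair i j hij).measurable.aemeasurable
          (f := fun z : X × X => f z.1 * κ z.1 z.2 * f z.2)
          (by rw [(hpair i j hij).map_eq]; exact hint.aestronglyMeasurable)
        rw [(hpair i j hij).map_eq, integral_prod _ hint] at h1
        refine h1.symm.trans ?_
        simp only [mul_assoc, integral_const_mul, hQ]
    have hJ : ∀ i : Fin n, Integrable (fun ω : Fin n → X => κ y (ω i) * f (ω i)) P ∧
        ∫ ω, κ y (ω i) * f (ω i) ∂P = L := by
      intro i
      have hint := integrable_kernel_mul hκ hf1 y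
      exact ⟨(heval i).integrable_comp_of_integrable hint,
        integral_comp_eval (μ := fun _ : Fin n => ν) (f := fun x => κ y x * f x)
          hint.aestronglyMeasurable⟩
    -- The weight nt of the extra point makes all terms that survive in the limit of the same order
    -- n².
    have hpos : 0 ≤ ∫ ω, ((∑ i, ∑ j, f (ω i) * κ (ω i) (ω j) * f (ω j)) +
        2 * (n * t) * (∑ i, κ y (ω i) * f (ω i)) + (n * t) ^ 2 * κ y y) ∂P :=
      integral_nonneg fun ω => h.sum_add_point_nonneg n ω (fun i => f (ω i)) y (n * t)
    have i1 : Integrable (fun ω : Fin n → X =>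
        ∑ i, ∑ j, f (ω i) * κ (ω i) (ω j) * f (ω j)) P :=
      integrable_finsetSum _ fun i _ => integrable_finsetSum _ fun j _ => (hI i j).1
    have i2 : Integrable (fun ω : Fin n → X => ∑ i, κ y (ω i) * f (ω i)) P :=
      integrable_finsetSum _ fun i _ => (hJ i).1
    have c1 : ∫ ω, ∑ i, ∑ j, f (ω i) * κ (ω i) (ω j) * f (ω j) ∂P =
        n * D + n * (n - 1) * Q := by
      rw [integral_finsetSum _ fun i _ => integrable_finsetSum _ fun j _ => (hI i j).1]
      simp_rw [integral_finsetSum _ fun j _ => (hI _ j).1, (hI _ _).2]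
      have : ∀ i : Fin n, ∑ j, (if i = j then D else Q) = D + (n - 1) * Q := by
        intro i
        have : ∀ j : Fin n, (if i = j then D else Q) = Q + if i = j then D - Q else 0 := by
          intro j
          split_ifs <;> ring
        simp only [this, Finset.sum_add_distrib, Finset.sum_ite_eq, Finset.mem_univ, if_true,
          Finset.sum_const, Finset.card_univ, Fintype.card_fin, nsmul_eq_mul]
        ring
      simp only [this, Finset.sum_const, Finset.card_univ, Fintype.card_fin, nsmul_eq_mul]
      ring
    have c2 : ∫ ω, ∑ i, κ y (ω i) * f (ω i) ∂P = n * L := by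
      rw [integral_finsetSum _ fun i _ => (hJ i).1]
      simp only [(hJ _).2, Finset.sum_const, Finset.card_univ, Fintype.card_fin, nsmul_eq_mul]
    have i3 : Integrable (fun ω : Fin n → X => (∑ i, ∑ j, f (ω i) * κ (ω i) (ω j) * f (ω j)) +
        2 * (n * t) * ∑ i, κ y (ω i) * f (ω i)) P := i1.add (i2.const_mul _)
    rw [integral_add i3 (integrable_const _),
      integral_add i1 (i2.const_mul _), integral_const_mul, c1, c2, integral_const] at hpos
    simp only [probReal_univ, smul_eq_mul, one_mul] at hpos
    linarith [hpos]
  set S := Q + 2 * t * L + t ^ 2 * κ y y with hS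
  have hlim : ∀ n : ℕ, 0 ≤ S + (D - Q) * (1 / ((n : ℝ) + 1)) := by
    intro n
    have hn : (0 : ℝ) < (n : ℝ) + 1 := by positivity
    have h1 := key (n + 1)
    push_cast at h1
    have h2 : (S + (D - Q) * (1 / ((n : ℝ) + 1))) * ((n : ℝ) + 1) ^ 2 =
        ((n : ℝ) + 1) * D + (n + 1) * (n + 1 - 1) * Q + 2 * (n + 1) ^ 2 * t * L +
          (n + 1) ^ 2 * t ^ 2 * κ y y := by
      rw [hS]
      field_simp
      ring
    rw [← h2] at h1
    exact nonneg_of_mul_nonneg_left h1 (by positivity)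
  have ht := (tendsto_one_div_add_atTop_nhds_zero_nat (𝕜 := ℝ)).const_mul (D - Q) |>.const_add S
  rw [mul_zero, add_zero] at ht
  exact ge_of_tendsto' ht hlim

/-- The quadratic form of a continuous positive semidefinite kernel on the functions of
`L²(μ)`, together with a point mass at an arbitrary point. -/
theorem IsPSDKernel.quadratic_nonneg (h : IsPSDKernel κ) (hκ : Continuous (Function.uncurry κ))
    {f : X → ℝ} (hf : MemLp f 2 μ) (y : X) (t : ℝ) :
    0 ≤ (∫ x, f x * ∫ z, κ x z * f z ∂μ ∂μ) + 2 * t * (∫ x, κ y x * f x ∂μ) +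
      t ^ 2 * κ y y := by
  rcases eq_or_ne μ 0 with h0 | h0
  · subst h0
    have := h.sum_nonneg 1 (fun _ => y) (fun _ => t)
    simp only [Finset.univ_unique, Finset.sum_singleton] at this
    simp only [integral_zero_measure]
    linarith
  · have hne : NeZero μ := ⟨h0⟩
    set m := μ.real Set.univ with hm
    have hmpos : 0 < m := by
      rw [hm, Measure.real, ENNReal.toReal_pos_iff]
      exact ⟨Measure.measure_univ_pos.2 h0, measure_lt_top _ _⟩
    let ν : Measure X := (μ Set.univ)⁻¹ • μ
    have hprob : IsProbabilityMeasure ν := isProbabilityMeasureSMul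
    have hint : ∀ g : X → ℝ, ∫ x, g x ∂ν = m⁻¹ * ∫ x, g x ∂μ := by
      intro g
      rw [integral_smul_measure, ENNReal.toReal_inv, smul_eq_mul]
      rfl
    have hfν : MemLp (fun x => m * f x) 2 ν :=
      (hf.const_mul m).smul_measure (by simp [h0])
    have := h.quadratic_nonneg_of_isProbabilityMeasure hκ hfν y t
    simp only [hint] at this
    have e1 : ∀ x, m * f x * (m⁻¹ * ∫ z, κ x z * (m * f z) ∂μ) =
        m * (f x * ∫ z, κ x z * f z ∂μ) := by
      intro x
      have : ∀ z, κ x z * (m * f z) = m * (κ x z * f z) := fun z => by ring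
      simp only [this, integral_const_mul]
      field_simp
    have e2 : ∀ x, κ y x * (m * f x) = m * (κ y x * f x) := fun x => by ring
    simp only [e1, e2, integral_const_mul, inv_mul_cancel_left₀ hmpos.ne'] at this
    exact this

/-- Without its quadratic part the form is 2tL + t²κ(y, y), which can be nonnegative for all t only
if L = 0. The point mass at y turns an almost everywhere statement into one for every y; this is
needed because the samples may be arbitrary points. -/
theorem IsPSDKernel.integral_eq_zero (h : IsPSDKernel κ) (hκ : Continuous (Function.uncurry κ))
    {f : X → ℝ} (hf : MemLp f 2 μ) (h0 : ∀ᵐ x ∂μ, ∫ z, κ x z * f z ∂μ = 0) (y : X) :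
    ∫ x, κ y x * f x ∂μ = 0 := by
  have hQ : ∫ x, f x * ∫ z, κ x z * f z ∂μ ∂μ = 0 := by
    rw [integral_eq_zero_of_ae]
    filter_upwards [h0] with x hx
    simp [hx]
  have key := h.quadratic_nonneg hκ hf y
  rw [hQ] at key
  set L := ∫ x, κ y x * f x ∂μ
  by_contra hL
  have h1 : 0 < |κ y y| + 1 := by positivity
  -- A near-minimiser of the quadratic in t; adding 1 avoids division by zero.
  have h2 := key (-L / (|κ y y| + 1))
  have h3 : 0 + 2 * (-L / (|κ y y| + 1)) * L + (-L / (|κ y y| + 1)) ^ 2 * κ y y =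
      L ^ 2 / (|κ y y| + 1) ^ 2 * (κ y y - 2 * (|κ y y| + 1)) := by
    field_simp
    ring
  rw [h3] at h2
  have h4 : κ y y - 2 * (|κ y y| + 1) < 0 := by
    have := le_abs_self (κ y y)
    have := abs_nonneg (κ y y)
    linarith
  have h5 : 0 < L ^ 2 / (|κ y y| + 1) ^ 2 := by positivity
  nlinarith

/-! ### Truncation errors of a kernel in terms of its eigenvalues -/

variable {lam : ℕ → ℝ} {φ : ℕ → X → ℝ}

theorem IsEigensystem.orthonormalSeq (h : IsEigensystem μ κ lam φ) : OrthonormalSeq μ φ :=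
  ⟨fun j => memLp_of_continuous (h.continuous j) 2, h.orthonormal⟩

theorem IsEigensystem.coef_kernel (h : IsEigensystem μ κ lam φ) (y : X) (j : ℕ) :
    coef μ φ (κ y) j = lam j * φ j y := h.eigen j y

theorem IsEigensystem.inClosedSpan_kernel (h : IsEigensystem μ κ lam φ) (hpsd : IsPSDKernel κ)
    (hκ : Continuous (Function.uncurry κ)) (y : X) : InClosedSpan μ φ (κ y) :=
  fun f hf hf0 => hpsd.integral_eq_zero hκ hf (h.complete f hf hf0) y

theorem IsEigensystem.inClosedSpan_integral (h : IsEigensystem μ κ lam φ)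
    (hpsd : IsPSDKernel κ) (hκ : Continuous (Function.uncurry κ)) {g : X → ℝ}
    (hg : Integrable g μ) : InClosedSpan μ φ fun x => ∫ y, κ x y * g y ∂μ := by
  intro f hf hf0
  have h1 := integral_quadratic_swap hκ (hf.integrable (by norm_num)) hg
  simp only [mul_comm (f _)] at h1
  rw [h1]
  have h2 : ∀ y, ∫ x, κ x y * f x ∂μ = 0 := by
    intro y
    simp only [hpsd.symm _ y]
    exact hpsd.integral_eq_zero hκ hf (h.complete f hf hf0) y
  simp [h2]

theorem IsEigensystem.coef_integral (h : IsEigensystem μ κ lam φ)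
    (hpsd : IsPSDKernel κ) (hκ : Continuous (Function.uncurry κ)) {g : X → ℝ}
    (hg : Integrable g μ) (j : ℕ) :
    coef μ φ (fun x => ∫ y, κ x y * g y ∂μ) j = lam j * ∫ y, g y * φ j y ∂μ := by
  have h1 := integral_quadratic_swap hκ (integrable_of_continuous (μ := μ) (h.continuous j)) hg
  rw [coef]
  simp only [mul_comm _ (φ j _)]
  rw [h1, ← integral_const_mul]
  congr 1 with y
  have : ∀ x, φ j x * κ x y = κ y x * φ j x := fun x => by rw [hpsd.symm x y, mul_comm]
  simp only [this, h.eigen]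
  ring

/-- The half of Mercer's theorem that is needed, at every point and not only almost everywhere:
positivity of κ on the signed measure f μ − (point mass at y), where f = Σ φ_j(y) φ_j. -/
theorem IsEigensystem.sum_le_diag (h : IsEigensystem μ κ lam φ) (hpsd : IsPSDKernel κ)
    (hκ : Continuous (Function.uncurry κ)) (y : X) (s : Finset ℕ) :
    ∑ j ∈ s, lam j * φ j y ^ 2 ≤ κ y y := by
  set f : X → ℝ := fun x => ∑ j ∈ s, φ j y * φ j x with hf
  have hfm : MemLp f 2 μ := h.orthonormalSeq.memLp_sum s _
  have hK : ∀ x, ∫ z, κ x z * f z ∂μ = ∑ j ∈ s, φ j y * (lam j * φ j x) := by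
    intro x
    have hc : Continuous (κ x) := hκ.comp (Continuous.prodMk_right x)
    rw [hf, h.orthonormalSeq.integral_mul_sum (memLp_of_continuous hc 2)]
    simp only [h.coef_kernel]
  have key := h.orthonormalSeq.integral_mul_sum hfm s (fun j => φ j y * lam j)
  have hq := hpsd.quadratic_nonneg hκ hfm y (-1)
  simp only [hK] at hq
  have e : ∀ x, f x * ∑ j ∈ s, φ j y * (lam j * φ j x) =
      f x * ∑ j ∈ s, φ j y * lam j * φ j x := by
    intro x
    simp only [mul_assoc]
  simp only [e, key] at hq
  have hcf : ∀ j ∈ s, φ j y * lam j * coef μ φ f j = lam j * φ j y ^ 2 := by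
    intro j hj
    rw [hf, h.orthonormalSeq.coef_sum, if_pos hj]
    ring
  rw [Finset.sum_congr rfl hcf] at hq
  have e2 : ∑ j ∈ s, φ j y * (lam j * φ j y) = ∑ j ∈ s, lam j * φ j y ^ 2 :=
    Finset.sum_congr rfl fun j _ => by ring
  rw [e2] at hq
  linarith

theorem nonneg_of_antitone_of_summable {lam : ℕ → ℝ} (ha : Antitone lam) (hs : Summable lam)
    (j : ℕ) : 0 ≤ lam j :=
  ha.le_of_tendsto hs.tendsto_atTop_zero j

/-- The coefficients of κ(y, ·) are λ_j φ_j(y). From index r on, one factor λ_j of their squares is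
at most λ_r, and the remaining sum is bounded by the diagonal. This gives the order √δ for the
truncation of a single Γ(·, y). -/
theorem IsEigensystem.resid_kernel_sq_le (h : IsEigensystem μ κ lam φ) (hpsd : IsPSDKernel κ)
    (hκ : Continuous (Function.uncurry κ)) (hlam : ∀ j, 0 ≤ lam j) (y : X) (r : ℕ) :
    ∫ x, resid μ φ r (κ y) x ^ 2 ∂μ ≤ lam r * κ y y := by
  have hc : Continuous (κ y) := hκ.comp (Continuous.prodMk_right y)
  have hs := h.orthonormalSeq.hasSum_resid_sq (memLp_of_continuous hc 2)
    (h.inClosedSpan_kernel hpsd hκ y) r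
  refine hasSum_le_of_sum_le hs fun s => ?_
  have h1 : ∀ j ∈ s, coef μ φ (κ y) (j + r) ^ 2 ≤
      lam r * (lam (j + r) * φ (j + r) y ^ 2) := by
    intro j _
    rw [h.coef_kernel]
    have h1 := h.antitone (Nat.le_add_left r j)
    have h2 : 0 ≤ lam (j + r) * φ (j + r) y ^ 2 := mul_nonneg (hlam _) (sq_nonneg _)
    nlinarith
  refine (Finset.sum_le_sum h1).trans ?_
  rw [← Finset.mul_sum]
  refine mul_le_mul_of_nonneg_left ?_ (hlam r)
  have := h.sum_le_diag hpsd hκ y (s.map (addRightEmbedding r))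
  simpa using this

/-- The integral is an inner product with the constant 1, and only the tail of 1 meets the residual.
The extra factor, the squared tail of 1, tends to 0 with r; it improves O(√δ) to o(√δ). -/
theorem IsEigensystem.integral_resid_kernel_sq_le (h : IsEigensystem μ κ lam φ)
    (hpsd : IsPSDKernel κ) (hκ : Continuous (Function.uncurry κ)) (hlam : ∀ j, 0 ≤ lam j)
    (y : X) (r : ℕ) :
    (∫ x, resid μ φ r (κ y) x ∂μ) ^ 2 ≤
      (∑' j, coef μ φ (fun _ => 1) (j + r) ^ 2) * (lam r * κ y y) := by
  have hc : Continuous (κ y) := hκ.comp (Continuous.prodMk_right y)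
  have h1 : MemLp (fun _ : X => (1 : ℝ)) 2 μ := memLp_of_continuous continuous_const 2
  have hsp := h.inClosedSpan_kernel hpsd hκ y
  have ht := h.orthonormalSeq.hasSum_tail (memLp_of_continuous hc 2) h1 hsp r
  simp only [one_mul] at ht
  have hsum : Summable fun j => coef μ φ (fun _ => 1) (j + r) ^ 2 :=
    (summable_nat_add_iff r).2 (h.orthonormalSeq.summable_coef_sq h1)
  have h2 := HasSum.sq_le_mul ht hsum.hasSum
    (h.orthonormalSeq.hasSum_resid_sq (memLp_of_continuous hc 2) hsp r)
  refine h2.trans (mul_le_mul_of_nonneg_left (h.resid_kernel_sq_le hpsd hκ hlam y r) ?_)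
  exact tsum_nonneg fun _ => sq_nonneg _

/-- For a function in the range of the operator every coefficient carries a full factor λ_j, so the
norm of the tail is of order λ_r and not only √λ_r. -/
theorem IsEigensystem.resid_integral_sq_le (h : IsEigensystem μ κ lam φ)
    (hpsd : IsPSDKernel κ) (hκ : Continuous (Function.uncurry κ)) (hlam : ∀ j, 0 ≤ lam j)
    {g : X → ℝ} (hg : MemLp g 2 μ) (hm : MemLp (fun x => ∫ y, κ x y * g y ∂μ) 2 μ) (r : ℕ) :
    ∫ x, resid μ φ r (fun x => ∫ y, κ x y * g y ∂μ) x ^ 2 ∂μ ≤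
      lam r ^ 2 * ∫ x, g x ^ 2 ∂μ := by
  have hg1 : Integrable g μ := hg.integrable (by norm_num)
  have hs := h.orthonormalSeq.hasSum_resid_sq hm (h.inClosedSpan_integral hpsd hκ hg1) r
  refine hasSum_le_of_sum_le hs fun s => ?_
  have h1 : ∀ j ∈ s, coef μ φ (fun x => ∫ y, κ x y * g y ∂μ) (j + r) ^ 2 ≤
      lam r ^ 2 * coef μ φ g (j + r) ^ 2 := by
    intro j _
    rw [h.coef_integral hpsd hκ hg1, mul_pow]
    exact mul_le_mul_of_nonneg_right
      (pow_le_pow_left₀ (hlam _) (h.antitone (Nat.le_add_left r j)) 2) (sq_nonneg _)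
  refine (Finset.sum_le_sum h1).trans ?_
  rw [← Finset.mul_sum]
  refine mul_le_mul_of_nonneg_left ?_ (sq_nonneg _)
  have := h.orthonormalSeq.sum_coef_sq_le hg (s.map (addRightEmbedding r))
  simpa using this

end Kernel

/-! ## Recursions with step size `1 / (γ (t + 1))` -/

section Recursion

/-- The step size of iteration `t`. -/
noncomputable def stepSize (γ : ℝ) (t : ℕ) : ℝ := 1 / (γ * ((t : ℝ) + 1))

/-- The rate at which the influence of the initial iterates disappears. -/
noncomputable def decay (γ : ℝ) (t : ℕ) : ℝ := ((t : ℝ) + 1) ^ (-(1 / γ))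

variable {γ : ℝ}

theorem stepSize_pos (hγ : 0 < γ) (t : ℕ) : 0 < stepSize γ t := by
  unfold stepSize
  positivity

theorem decay_pos (γ : ℝ) (t : ℕ) : 0 < decay γ t := by
  unfold decay
  positivity

theorem decay_le_one (hγ : 0 < γ) (t : ℕ) : decay γ t ≤ 1 := by
  unfold decay
  refine Real.rpow_le_one_of_one_le_of_nonpos ?_ ?_
  · linarith [Nat.cast_nonneg (α := ℝ) t]
  · have : 0 < 1 / γ := by positivity
    linarith

theorem exists_stepSize_le_one (hγ : 0 < γ) : ∃ N : ℕ, ∀ t, N ≤ t → stepSize γ t ≤ 1 := by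
  obtain ⟨N, hN⟩ := exists_nat_ge (1 / γ)
  refine ⟨N, fun t ht => ?_⟩
  have h1 : (N : ℝ) ≤ t := by exact_mod_cast ht
  unfold stepSize
  rw [div_le_one (by positivity)]
  rw [div_le_iff₀ hγ] at hN
  nlinarith

theorem tendsto_decay (hγ : 0 < γ) :
    Filter.Tendsto (decay γ) Filter.atTop (nhds 0) := by
  unfold decay
  have h := (tendsto_rpow_neg_atTop (y := 1 / γ) (by positivity)).comp
    (Filter.tendsto_atTop_add_const_right _ (1 : ℝ) (tendsto_natCast_atTop_atTop (R := ℝ)))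
  exact h

/-- From 1 − η ≤ exp(−η) and log((t+2)/(t+1)) ≤ 1/(t+1): the exponent −1/γ is exactly what the step
size 1/(γ(t+1)) produces. -/
theorem one_sub_stepSize_mul_decay_le (hγ : 0 < γ) (t : ℕ) :
    (1 - stepSize γ t) * decay γ t ≤ decay γ (t + 1) := by
  have ht : (0 : ℝ) < (t : ℝ) + 1 := by positivity
  have h1 : 1 - stepSize γ t ≤ Real.exp (-(stepSize γ t)) := by
    have := Real.add_one_le_exp (-(stepSize γ t))
    linarith
  have h2 : decay γ (t + 1) = (((t : ℝ) + 2) / (t + 1)) ^ (-(1 / γ)) * decay γ t := by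
    unfold decay
    rw [← Real.mul_rpow (by positivity) (by positivity)]
    congr 1
    push_cast
    field_simp
    ring
  rw [h2]
  refine mul_le_mul_of_nonneg_right ?_ (decay_pos γ t).le
  refine h1.trans ?_
  rw [Real.rpow_def_of_pos (by positivity)]
  refine Real.exp_le_exp.2 ?_
  have h3 : Real.log (((t : ℝ) + 2) / (t + 1)) ≤ 1 / (t + 1) := by
    have := Real.log_le_sub_one_of_pos (x := ((t : ℝ) + 2) / (t + 1)) (by positivity)
    refine this.trans (le_of_eq ?_)
    field_simp
    ring
  have h4 : Real.log (((t : ℝ) + 2) / (t + 1)) * (1 / γ) ≤ 1 / (t + 1) * (1 / γ) :=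
    mul_le_mul_of_nonneg_right h3 (by positivity)
  have h5 : stepSize γ t = 1 / ((t : ℝ) + 1) * (1 / γ) := by
    unfold stepSize
    field_simp
  rw [h5]
  linarith

/-- Once the step size is at most 1, the recursion forms convex combinations and preserves a bound.
The finitely many earlier steps, in which 1 − η may be negative, cost a constant factor. -/
theorem exists_recursion_bound (hγ : 0 < γ) : ∃ W : ℝ, 1 ≤ W ∧ ∀ (q : ℕ → ℝ) (B : ℝ), 0 ≤ B →
    q 0 ≤ B → (∀ t, q (t + 1) ≤ |1 - stepSize γ t| * q t + stepSize γ t * B) →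
    ∀ t, q t ≤ W * B := by
  obtain ⟨N, hN⟩ := exists_stepSize_le_one hγ
  -- Since |1 − η| ≤ 1 + η and W ≥ 1, one step multiplies the bound by at most 1 + 2η.
  let W : ℕ → ℝ := fun t => ∏ s ∈ Finset.range t, (1 + 2 * stepSize γ s)
  have hWsucc : ∀ t, W (t + 1) = W t * (1 + 2 * stepSize γ t) := fun t =>
    Finset.prod_range_succ _ _
  have hW1 : ∀ t, 1 ≤ W t := by
    intro t
    induction t with
    | zero => simp [W]
    | succ t ih =>
      rw [hWsucc]
      have := stepSize_pos hγ t
      nlinarith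
  have hmono : Monotone W := monotone_nat_of_le_succ fun t => by
    rw [hWsucc]
    have := stepSize_pos hγ t
    have := hW1 t
    nlinarith
  refine ⟨W N, hW1 N, fun q B hB h0 hstep => ?_⟩
  have h1 : ∀ t, q t ≤ W t * B := by
    intro t
    induction t with
    | zero => simpa [W] using h0
    | succ t ih =>
      refine (hstep t).trans ?_
      rw [hWsucc]
      have hs := stepSize_pos hγ t
      have ha : |1 - stepSize γ t| ≤ 1 + stepSize γ t := by
        rw [abs_le]
        constructor <;> linarith
      have h2 : |1 - stepSize γ t| * q t ≤ |1 - stepSize γ t| * (W t * B) :=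
        mul_le_mul_of_nonneg_left ih (abs_nonneg _)
      have hWB : B ≤ W t * B := le_mul_of_one_le_left hB (hW1 t)
      have h3 : |1 - stepSize γ t| * (W t * B) ≤ (1 + stepSize γ t) * (W t * B) :=
        mul_le_mul_of_nonneg_right ha (by linarith)
      nlinarith
  intro t
  rcases le_total t N with ht | ht
  · exact (h1 t).trans (mul_le_mul_of_nonneg_right (hmono ht) hB)
  · induction t, ht using Nat.le_induction with
    | base => exact h1 N
    | succ t ht ih =>
      refine (hstep t).trans ?_
      have hs := stepSize_pos hγ t
      have hs1 := hN t ht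
      rw [abs_of_nonneg (by linarith)]
      have hWB : B ≤ W N * B := le_mul_of_one_le_left hB (hW1 N)
      nlinarith

theorem exists_decay_bound (hγ : 0 < γ) (N : ℕ) : ∃ C : ℝ, 0 < C ∧ ∀ x : ℕ → ℝ,
    0 ≤ x N → (∀ t, N ≤ t → x (t + 1) ≤ (1 - stepSize γ t) * x t) →
    (∀ t, N ≤ t → stepSize γ t ≤ 1) →
    ∀ t, N ≤ t → x t ≤ C * x N * decay γ t := by
  refine ⟨(decay γ N)⁻¹, inv_pos.2 (decay_pos γ N), fun x h0 hstep hs t ht => ?_⟩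
  induction t, ht using Nat.le_induction with
  | base =>
    have := decay_pos γ N
    field_simp
    exact le_rfl
  | succ t ht ih =>
    have h1 : 0 ≤ 1 - stepSize γ t := by linarith [hs t ht]
    have h2 : 0 ≤ (decay γ N)⁻¹ * x N := mul_nonneg (inv_pos.2 (decay_pos γ N)).le h0
    calc x (t + 1) ≤ (1 - stepSize γ t) * x t := hstep t ht
      _ ≤ (1 - stepSize γ t) * ((decay γ N)⁻¹ * x N * decay γ t) :=
          mul_le_mul_of_nonneg_left ih h1
      _ = (decay γ N)⁻¹ * x N * ((1 - stepSize γ t) * decay γ t) := by ring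
      _ ≤ _ := mul_le_mul_of_nonneg_left (one_sub_stepSize_mul_decay_le hγ t) h2

theorem exists_abs_prod_le_decay (hγ : 0 < γ) : ∃ C : ℝ, 0 < C ∧
    ∀ t, |∏ s ∈ Finset.range t, (1 - stepSize γ s)| ≤ C * decay γ t := by
  obtain ⟨N, hN⟩ := exists_stepSize_le_one hγ
  obtain ⟨C, hC0, hC⟩ := exists_decay_bound hγ N
  let x : ℕ → ℝ := fun t => |∏ s ∈ Finset.range t, (1 - stepSize γ s)|
  have hx : ∀ t, x (t + 1) = |1 - stepSize γ t| * x t := by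
    intro t
    simp only [x, Finset.prod_range_succ, abs_mul, mul_comm]
  have h1 := hC x (abs_nonneg _) (fun t ht => by
    rw [hx, abs_of_nonneg (by linarith [hN t ht])]) hN
  let S := ∑ t ∈ Finset.range N, x t / decay γ t
  have hS : 0 ≤ S := Finset.sum_nonneg fun t _ => div_nonneg (abs_nonneg _) (decay_pos γ t).le
  have hxN : 0 ≤ C * x N := mul_nonneg hC0.le (abs_nonneg _)
  refine ⟨S + C * x N + 1, by linarith, fun t => ?_⟩
  have hd := decay_pos γ t
  rcases lt_or_ge t N with ht | ht
  · have h2 : x t / decay γ t ≤ S := Finset.single_le_sum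
      (f := fun t => x t / decay γ t)
      (fun t _ => div_nonneg (abs_nonneg _) (decay_pos γ t).le) (Finset.mem_range.2 ht)
    rw [div_le_iff₀ hd] at h2
    change x t ≤ _
    nlinarith
  · have := h1 t ht
    change x t ≤ _
    nlinarith

theorem sum_inv_sqrt_le (T : ℕ) : ∑ s ∈ Finset.range T, 1 / Real.sqrt s ≤ 2 * Real.sqrt T := by
  have key : ∀ T : ℕ, ∑ s ∈ Finset.range (T + 1), 1 / Real.sqrt s ≤ 2 * Real.sqrt T := by
    intro T
    induction T with
    -- The term with s = 0 is 1 / 0 = 0.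
    | zero => simp
    | succ T ih =>
      rw [Finset.sum_range_succ]
      refine (add_le_add ih le_rfl).trans ?_
      have h1 : 0 < Real.sqrt ((T + 1 : ℕ) : ℝ) := Real.sqrt_pos.2 (by positivity)
      have h2 : Real.sqrt ((T + 1 : ℕ) : ℝ) ^ 2 = T + 1 := by
        rw [Real.sq_sqrt (by positivity)]
        push_cast
        ring
      have h3 : Real.sqrt (T : ℝ) ^ 2 = T := Real.sq_sqrt (by positivity)
      set a := Real.sqrt ((T + 1 : ℕ) : ℝ)
      set b := Real.sqrt (T : ℝ)
      have h4 : 1 / a * a = 1 := one_div_mul_cancel h1.ne'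
      have h5 : (2 * b + 1 / a) * a ≤ 2 * a * a := by nlinarith [sq_nonneg (a - b)]
      exact le_of_mul_le_mul_right h5 h1
  refine le_trans ?_ (key T)
  rw [Finset.sum_range_succ]
  have : 0 ≤ 1 / Real.sqrt (T : ℝ) := by positivity
  linarith

theorem summable_rpow_succ {s : ℝ} (hs : 1 < s) : Summable fun n : ℕ => ((n : ℝ) + 1) ^ (-s) := by
  refine ((Real.summable_one_div_nat_add_rpow 1 s).2 hs).congr fun n => ?_
  have : (0 : ℝ) < (n : ℝ) + 1 := by positivity
  rw [abs_of_pos this, Real.rpow_neg this.le, one_div]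

/-- The exponent is 2/γ, which exceeds 1 because γ < 2. -/
theorem summable_decay_sq (hγ0 : 0 < γ) (hγ2 : γ < 2) : Summable fun t => decay γ t ^ 2 := by
  have h1 : 1 < 2 / γ := by rwa [one_lt_div hγ0]
  refine (summable_rpow_succ h1).congr fun n => ?_
  have : (0 : ℝ) < (n : ℝ) + 1 := by positivity
  unfold decay
  rw [← Real.rpow_mul_natCast this.le]
  congr 1
  push_cast
  ring

/-- The exponent is 1/γ + 1/2, again above 1 exactly when γ < 2. The sum controls the cross term of
the decaying perturbation with an error of order 1/√t. -/
theorem summable_decay_div_sqrt (hγ0 : 0 < γ) (hγ2 : γ < 2) :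
    Summable fun t : ℕ => decay γ t / Real.sqrt t := by
  have h1 : 1 < 1 / γ + 1 / 2 := by
    have : 1 / 2 < 1 / γ := one_div_lt_one_div_of_lt hγ0 hγ2
    linarith
  have h2 := (summable_rpow_succ h1).mul_left (Real.sqrt 2)
  refine Summable.of_nonneg_of_le (fun t => div_nonneg (decay_pos γ t).le (Real.sqrt_nonneg _))
    (fun t => ?_) h2
  have h0 : (0 : ℝ) < (t : ℝ) + 1 := by positivity
  have h3 : ((t : ℝ) + 1) ^ (-(1 / γ + 1 / 2)) = decay γ t * (Real.sqrt ((t : ℝ) + 1))⁻¹ := by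
    rw [neg_add, Real.rpow_add h0, Real.sqrt_eq_rpow, ← Real.rpow_neg h0.le]
    rfl
  rw [h3]
  rcases Nat.eq_zero_or_pos t with ht | ht
  · subst ht
    have := decay_pos γ 0
    simp only [Nat.cast_zero, Real.sqrt_zero, div_zero]
    positivity
  · have ht1 : (1 : ℝ) ≤ t := by exact_mod_cast ht
    have h4 : Real.sqrt ((t : ℝ) + 1) ≤ Real.sqrt 2 * Real.sqrt t := by
      rw [← Real.sqrt_mul (by norm_num)]
      exact Real.sqrt_le_sqrt (by linarith)
    have h5 : 0 < Real.sqrt (t : ℝ) := Real.sqrt_pos.2 (by linarith)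
    have h6 : 0 < Real.sqrt ((t : ℝ) + 1) := Real.sqrt_pos.2 h0
    rw [div_le_iff₀ h5]
    have h7 : 1 ≤ Real.sqrt 2 * Real.sqrt t * (Real.sqrt ((t : ℝ) + 1))⁻¹ := by
      rw [← div_eq_mul_inv, one_le_div h6]
      exact h4
    have := decay_pos γ t
    nlinarith

theorem sum_inv_succ_le (T : ℕ) :
    ∑ s ∈ Finset.range T, 1 / ((s : ℝ) + 1) ≤ 1 + Real.log T := by
  have := harmonic_le_one_add_log T
  simpa [harmonic] using this

set_option maxHeartbeats 1000000 in
/-- A perturbed contraction with the rate of stochastic approximation: the perturbations `e` and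
`decay γ t` of the contraction have a second-order effect only. -/
theorem exists_stochastic_recursion_bound (hγ0 : 0 < γ) (hγ2 : γ < 2) {A B C : ℝ} (hA : 0 ≤ A)
    (hB : 0 ≤ B) (hC : 0 ≤ C) (t₀ : ℕ) (ht₀ : 1 ≤ t₀) : ∃ K : ℝ, 0 < K ∧
    ∀ (ι : Type*) (e : ℝ) (x : ℕ → ι → ℝ), 0 ≤ e → (∀ i, x t₀ i ≤ A) →
      (∀ t, t₀ ≤ t → ∀ b, 0 ≤ b → (∀ i, x t i ≤ b) → ∀ i, x (t + 1) i ≤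
        (1 - 1 / ((t : ℝ) + 1)) * b + stepSize γ t *
          (2 * (e + C * decay γ t) * Real.sqrt b + (e + C * decay γ t) ^ 2) +
          B / ((t : ℝ) + 1) ^ 2) →
      ∀ T, t₀ ≤ T → ∀ i, x T i ≤
        K * ((1 + Real.log T) / T) + (4 / γ + 16 / γ ^ 2) * e ^ 2 := by
  set S1 := ∑' t, decay γ t ^ 2 with hS1
  set S2 := ∑' t : ℕ, decay γ t / Real.sqrt t with hS2
  have hS1' : ∀ T, ∑ s ∈ Finset.range T, decay γ s ^ 2 ≤ S1 := fun T =>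
    (summable_decay_sq hγ0 hγ2).sum_le_tsum _ fun _ _ => sq_nonneg _
  have hS2' : ∀ T, ∑ s ∈ Finset.range T, decay γ s / Real.sqrt s ≤ S2 := fun T =>
    (summable_decay_div_sqrt hγ0 hγ2).sum_le_tsum _ fun t _ =>
      div_nonneg (decay_pos γ t).le (Real.sqrt_nonneg _)
  have hS10 : 0 ≤ S1 := tsum_nonneg fun _ => sq_nonneg _
  have hS20 : 0 ≤ S2 := tsum_nonneg fun t => div_nonneg (decay_pos γ t).le (Real.sqrt_nonneg _)
  -- The constants are read off from (√(A' + Q) + P)² ≤ 2(A' + Q) + 2P² with the bounds on Q and P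
  -- proved below; the final 1 only makes K positive.
  refine ⟨2 * (t₀ * A + 2 * C ^ 2 * S1 / γ + B + 2 * C ^ 2 * S2 ^ 2 / γ ^ 2) + 1,
    by positivity, fun ι e x he hx0 hstep T hT i => ?_⟩
  let p : ℕ → ℝ := fun s => (e + C * decay γ s) / (γ * Real.sqrt s)
  let q : ℕ → ℝ := fun s => (e + C * decay γ s) ^ 2 / γ + B / ((s : ℝ) + 1)
  have hec : ∀ s, 0 ≤ e + C * decay γ s := fun s =>
    add_nonneg he (mul_nonneg hC (decay_pos γ s).le)
  have hp : ∀ s, 0 ≤ p s := fun s => div_nonneg (hec s) (mul_nonneg hγ0.le (Real.sqrt_nonneg _))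
  have hq : ∀ s, 0 ≤ q s := fun s => by
    have := hec s
    positivity
  let P : ℕ → ℝ := fun t => ∑ s ∈ Finset.range t, p s
  let Q : ℕ → ℝ := fun t => ∑ s ∈ Finset.range t, q s
  have hP : ∀ t, 0 ≤ P t := fun t => Finset.sum_nonneg fun s _ => hp s
  have hQ : ∀ t, 0 ≤ Q t := fun t => Finset.sum_nonneg fun s _ => hq s
  have hPs : ∀ t, P (t + 1) = P t + p t := fun t => Finset.sum_range_succ _ _
  have hQs : ∀ t, Q (t + 1) = Q t + q t := fun t => Finset.sum_range_succ _ _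
  set A' := (t₀ : ℝ) * A with hA'
  have hA'0 : 0 ≤ A' := by positivity
  -- An explicit supersolution. Multiplication by t turns the contraction 1 − 1/(t+1) into a plain
  -- sum; P collects the perturbations that multiply √b, and Q the additive ones.
  let b : ℕ → ℝ := fun t => (Real.sqrt (A' + Q t) + P t) ^ 2 / t
  have main : ∀ t, t₀ ≤ t → ∀ i, x t i ≤ b t := by
    intro t ht
    induction t, ht using Nat.le_induction with
    | base =>
      intro i
      have h0 : (0 : ℝ) < t₀ := by exact_mod_cast ht₀
      refine (hx0 i).trans ?_
      change A ≤ _ / _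
      rw [le_div_iff₀ h0]
      have h1 : Real.sqrt (A' + Q t₀) ^ 2 = A' + Q t₀ := Real.sq_sqrt (add_nonneg hA'0 (hQ _))
      have h2 := Real.sqrt_nonneg (A' + Q t₀)
      nlinarith [hP t₀, hQ t₀, mul_nonneg h2 (hP t₀), sq_nonneg (P t₀)]
    | succ t ht ih =>
      intro i
      have ht0 : (0 : ℝ) < t := by exact_mod_cast lt_of_lt_of_le ht₀ ht
      have ht1 : (0 : ℝ) < (t : ℝ) + 1 := by positivity
      have hb0 : 0 ≤ b t := by positivity
      have h := hstep t ht (b t) hb0 ih i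
      set y := Real.sqrt (A' + Q t) with hy
      have hy0 : 0 ≤ y := Real.sqrt_nonneg _
      have hsb : Real.sqrt (b t) = (y + P t) / Real.sqrt t := by
        change Real.sqrt ((y + P t) ^ 2 / t) = _
        rw [Real.sqrt_div (sq_nonneg _), Real.sqrt_sq (add_nonneg hy0 (hP t))]
      have hst : 0 < Real.sqrt (t : ℝ) := Real.sqrt_pos.2 ht0
      -- Here (1 − 1/(t+1))(t+1) = t cancels the denominator of `b t`, and the step size times t + 1
      -- is 1/γ.
      have h1 : x (t + 1) i * ((t : ℝ) + 1) ≤ (y + P t) ^ 2 + 2 * p t * (y + P t) + q t := by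
        refine (mul_le_mul_of_nonneg_right h ht1.le).trans (le_of_eq ?_)
        rw [hsb]
        change ((1 - 1 / ((t : ℝ) + 1)) * ((y + P t) ^ 2 / t) + 1 / (γ * ((t : ℝ) + 1)) *
          (2 * (e + C * decay γ t) * ((y + P t) / Real.sqrt t) + (e + C * decay γ t) ^ 2) +
          B / ((t : ℝ) + 1) ^ 2) * ((t : ℝ) + 1) = (y + P t) ^ 2 +
            2 * ((e + C * decay γ t) / (γ * Real.sqrt t)) * (y + P t) +
            ((e + C * decay γ t) ^ 2 / γ + B / ((t : ℝ) + 1))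
        field_simp
        ring
      change _ ≤ (Real.sqrt (A' + Q (t + 1)) + P (t + 1)) ^ 2 / ((t + 1 : ℕ) : ℝ)
      rw [le_div_iff₀ (by positivity)]
      push_cast
      refine h1.trans ?_
      rw [hPs, hQs]
      set z := Real.sqrt (A' + (Q t + q t)) with hz
      have hy2 : y ^ 2 = A' + Q t := Real.sq_sqrt (add_nonneg hA'0 (hQ t))
      have hz2 : z ^ 2 = A' + (Q t + q t) :=
        Real.sq_sqrt (add_nonneg hA'0 (add_nonneg (hQ t) (hq t)))
      have hyz : y ≤ z := Real.sqrt_le_sqrt (by linarith [hq t])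
      -- Since z² = y² + q and y ≤ z, the left side (y + P)² + 2p(y + P) + q equals z² + 2y(P + p) +
      -- (P + p)² − p², which is at most (z + P + p)².
      nlinarith [mul_le_mul_of_nonneg_right hyz (add_nonneg (hP t) (hp t)), sq_nonneg (p t)]
  refine (main T hT i).trans ?_
  have hT1 : 1 ≤ T := ht₀.trans hT
  have hT0 : (0 : ℝ) < T := by exact_mod_cast hT1
  have hlog : 0 ≤ Real.log T := Real.log_nonneg (by exact_mod_cast hT1)
  have hQT : Q T ≤ 2 * e ^ 2 * T / γ + 2 * C ^ 2 * S1 / γ + B * (1 + Real.log T) := by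
    have h1 : ∀ s ∈ Finset.range T, q s ≤
        2 * e ^ 2 / γ + 2 * C ^ 2 / γ * decay γ s ^ 2 + B * (1 / ((s : ℝ) + 1)) := by
      intro s _
      have : (e + C * decay γ s) ^ 2 / γ ≤ (2 * e ^ 2 + 2 * C ^ 2 * decay γ s ^ 2) / γ := by
        gcongr
        nlinarith [sq_nonneg (e - C * decay γ s)]
      change (e + C * decay γ s) ^ 2 / γ + B / ((s : ℝ) + 1) ≤ _
      refine (add_le_add this le_rfl).trans (le_of_eq ?_)
      field_simp
    refine (Finset.sum_le_sum h1).trans ?_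
    rw [Finset.sum_add_distrib, Finset.sum_add_distrib, ← Finset.mul_sum, ← Finset.mul_sum]
    simp only [Finset.sum_const, Finset.card_range, nsmul_eq_mul]
    have h2 := mul_le_mul_of_nonneg_left (hS1' T) (show 0 ≤ 2 * C ^ 2 / γ by positivity)
    have h3 := mul_le_mul_of_nonneg_left (sum_inv_succ_le T) hB
    have e1 : (T : ℝ) * (2 * e ^ 2 / γ) = 2 * e ^ 2 * T / γ := by ring
    have e2 : 2 * C ^ 2 / γ * S1 = 2 * C ^ 2 * S1 / γ := by ring
    linarith
  have hPT : P T ≤ (2 * e * Real.sqrt T + C * S2) / γ := by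
    have h1 : ∀ s ∈ Finset.range T, p s =
        e / γ * (1 / Real.sqrt s) + C / γ * (decay γ s / Real.sqrt s) := by
      intro s _
      change (e + C * decay γ s) / (γ * Real.sqrt s) = _
      rw [← div_div, div_mul_div_comm, div_mul_div_comm, ← div_div, add_div]
      simp only [mul_one, add_div, mul_div_assoc, ← div_div]
    change ∑ s ∈ Finset.range T, p s ≤ _
    rw [Finset.sum_congr rfl h1, Finset.sum_add_distrib, ← Finset.mul_sum, ← Finset.mul_sum]
    have h2 := mul_le_mul_of_nonneg_left (sum_inv_sqrt_le T) (show 0 ≤ e / γ by positivity)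
    have h3 := mul_le_mul_of_nonneg_left (hS2' T) (show 0 ≤ C / γ by positivity)
    have e1 : (2 * e * Real.sqrt T + C * S2) / γ = e / γ * (2 * Real.sqrt T) + C / γ * S2 := by
      ring
    linarith
  have hP2 : P T ^ 2 ≤ 8 * e ^ 2 * T / γ ^ 2 + 2 * C ^ 2 * S2 ^ 2 / γ ^ 2 := by
    refine (pow_le_pow_left₀ (hP T) hPT 2).trans ?_
    rw [div_pow, ← add_div]
    gcongr
    have h1 : Real.sqrt (T : ℝ) ^ 2 = T := Real.sq_sqrt hT0.le
    have h2 : 8 * e ^ 2 * (T : ℝ) = 2 * (2 * e * Real.sqrt T) ^ 2 := by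
      rw [mul_pow, h1]
      ring
    rw [h2]
    nlinarith [sq_nonneg (2 * e * Real.sqrt T - C * S2)]
  change (Real.sqrt (A' + Q T) + P T) ^ 2 / (T : ℝ) ≤ _
  rw [div_le_iff₀ hT0]
  have h1 : Real.sqrt (A' + Q T) ^ 2 = A' + Q T := Real.sq_sqrt (add_nonneg hA'0 (hQ _))
  have h2 : (Real.sqrt (A' + Q T) + P T) ^ 2 ≤ 2 * (A' + Q T) + 2 * P T ^ 2 := by
    nlinarith [sq_nonneg (Real.sqrt (A' + Q T) - P T)]
  refine h2.trans ?_
  set M := A' + 2 * C ^ 2 * S1 / γ + 2 * C ^ 2 * S2 ^ 2 / γ ^ 2 with hM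
  have hM0 : 0 ≤ M := by positivity
  have e1 : ((2 * (A' + 2 * C ^ 2 * S1 / γ + B + 2 * C ^ 2 * S2 ^ 2 / γ ^ 2) + 1) *
      ((1 + Real.log T) / T) + (4 / γ + 16 / γ ^ 2) * e ^ 2) * T =
      (2 * (M + B) + 1) * (1 + Real.log T) + 2 * (2 * e ^ 2 * T / γ) +
        2 * (8 * e ^ 2 * T / γ ^ 2) := by
    rw [hM]
    field_simp
    ring
  rw [e1]
  have h4 : M ≤ M * (1 + Real.log T) := le_mul_of_one_le_right hM0 (by linarith)
  nlinarith

/-- A number of iterations of the order `(1 / δ) log (1 / δ)` is sufficient for the accuracy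
`δ`. -/
theorem exists_iterations {K : ℝ} (hK : 0 < K) (N : ℕ) : ∃ A : ℝ, 0 < A ∧
    ∀ᶠ δ in nhdsWithin (0 : ℝ) (Set.Ioi 0), ∃ T : ℕ, N ≤ T ∧
      (T : ℝ) ≤ A * ((1 / δ) * Real.log (1 / δ)) ∧ K * ((1 + Real.log T) / T) ≤ δ / 4 := by
  have hlim : Filter.Tendsto (fun y : ℝ => 2 * K * (3 / y + Real.log y / y)) Filter.atTop
      (nhds 0) := by
    have h1 : Filter.Tendsto (fun y : ℝ => Real.log y / y) Filter.atTop (nhds 0) :=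
      Real.isLittleO_log_id_atTop.tendsto_div_nhds_zero
    have h2 : Filter.Tendsto (fun y : ℝ => 3 / y) Filter.atTop (nhds 0) :=
      Filter.Tendsto.div_atTop tendsto_const_nhds Filter.tendsto_id
    simpa using (h2.add h1).const_mul (2 * K)
  -- The constant A is this y, independent of δ. The number of iterations is (y/2)(1/δ) log(1/δ)
  -- rounded up, and the factor 1/2 leaves room for the rounding.
  obtain ⟨y, hy, hy2⟩ := ((hlim.eventually (gt_mem_nhds (show (0 : ℝ) < 1 / 4 by norm_num))).and
    (Filter.eventually_ge_atTop 2)).exists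
  refine ⟨y, by linarith, ?_⟩
  have hsmall : ∀ᶠ δ in nhdsWithin (0 : ℝ) (Set.Ioi 0),
      0 < δ ∧ δ < min (Real.exp (-1)) (1 / ((N : ℝ) + 1)) := by
    have : Set.Ioo (0 : ℝ) (min (Real.exp (-1)) (1 / ((N : ℝ) + 1))) ∈
        nhdsWithin (0 : ℝ) (Set.Ioi 0) :=
      Ioo_mem_nhdsGT (lt_min (Real.exp_pos _) (by positivity))
    exact this
  filter_upwards [hsmall] with δ ⟨h0, h1⟩
  have h2 : δ < Real.exp (-1) := h1.trans_le (min_le_left _ _)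
  have h3 : δ < 1 / ((N : ℝ) + 1) := h1.trans_le (min_le_right _ _)
  set L := Real.log (1 / δ) with hL
  have hL1 : 1 ≤ L := by
    rw [hL, one_div, Real.log_inv]
    have := (Real.log_lt_log_iff h0 (Real.exp_pos _)).2 h2
    rw [Real.log_exp] at this
    linarith
  have hδ1 : (N : ℝ) + 1 < 1 / δ := by
    rw [lt_div_iff₀ (by positivity)] at h3
    rw [lt_div_iff₀ h0]
    linarith
  have hLδ : L ≤ 1 / δ := (Real.log_le_sub_one_of_pos (by positivity)).trans (by linarith)
  have hid : 0 < 1 / δ := by positivity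
  set z := y / 2 * (1 / δ * L) with hz
  have hzid : 1 / δ ≤ z := by
    have h4 : 1 / δ ≤ 1 / δ * L := le_mul_of_one_le_right hid.le hL1
    have h5 : 1 / δ * L ≤ z := le_mul_of_one_le_left (by positivity) (by linarith)
    linarith
  have hN0 : (0 : ℝ) ≤ N := Nat.cast_nonneg N
  have hz1 : 1 ≤ z := by linarith
  refine ⟨⌈z⌉₊, ?_, ?_, ?_⟩
  · have : (N : ℝ) ≤ (⌈z⌉₊ : ℝ) := by linarith [Nat.le_ceil z]
    exact_mod_cast this
  · have := Nat.ceil_lt_add_one (show 0 ≤ z by linarith)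
    have e1 : y * (1 / δ * L) = 2 * z := by rw [hz]; ring
    linarith
  · have hT1 : z ≤ (⌈z⌉₊ : ℝ) := Nat.le_ceil z
    have hT2 : (⌈z⌉₊ : ℝ) ≤ y * (1 / δ * L) := by
      have := Nat.ceil_lt_add_one (show 0 ≤ z by linarith)
      have e1 : y * (1 / δ * L) = 2 * z := by rw [hz]; ring
      linarith
    have hT0 : (0 : ℝ) < (⌈z⌉₊ : ℝ) := by linarith
    have hlogT : Real.log (⌈z⌉₊ : ℝ) ≤ Real.log y + 2 * L := by
      refine (Real.log_le_log hT0 hT2).trans ?_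
      rw [Real.log_mul (by linarith) (by positivity), Real.log_mul (by positivity) (by linarith)]
      have : Real.log L ≤ L := Real.log_le_self (by linarith)
      linarith
    have hly : 0 ≤ Real.log y := Real.log_nonneg (by linarith)
    have h6 : 1 + Real.log (⌈z⌉₊ : ℝ) ≤ (3 + Real.log y) * L := by nlinarith
    have h7 : (1 + Real.log (⌈z⌉₊ : ℝ)) / (⌈z⌉₊ : ℝ) ≤ (3 + Real.log y) * L / z :=
      div_le_div₀ (by positivity) h6 (by linarith) hT1
    have h8 : K * ((3 + Real.log y) * L / z) = 2 * K * (3 / y + Real.log y / y) * δ := by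
      rw [hz]
      have : y ≠ 0 := by linarith
      field_simp
    calc K * ((1 + Real.log (⌈z⌉₊ : ℝ)) / (⌈z⌉₊ : ℝ)) ≤ K * ((3 + Real.log y) * L / z) :=
          mul_le_mul_of_nonneg_left h7 hK.le
      _ = 2 * K * (3 / y + Real.log y / y) * δ := h8
      _ ≤ 1 / 4 * δ := mul_le_mul_of_nonneg_right hy.le h0.le
      _ = δ / 4 := by ring

end Recursion

/-! ## Regular models -/

section Regular

variable {V : Type*} [Fintype V] [DecidableEq V] {G : SimpleGraph V} [DecidableRel G.Adj]
variable {X : Type*} [MetricSpace X] [CompactSpace X] [MeasurableSpace X] [BorelSpace X]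

/-- Continuous potentials whose kernels are positive semidefinite with common summable eigenvalues
`lam` and eigenfunctions `φ e`. -/
structure IsRegular (μ : Measure X) (M : PairwiseMRF G X) (lam : ℕ → ℝ)
    (φ : G.Dart → ℕ → X → ℝ) : Prop where
  node : ∀ v, Continuous (M.nodePot v)
  edge : ∀ e : G.Dart, Continuous (Function.uncurry (M.edgePot e.snd e.fst))
  psd : ∀ e : G.Dart, IsPSDKernel (M.edgePot e.snd e.fst)
  eig : ∀ e : G.Dart, IsEigensystem μ (M.edgePot e.snd e.fst) lam (φ e)
  trace : Summable lam
  ne_zero : μ ≠ 0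

/-- The marginal `y ↦ ∫ ψ_{uv}(x, y) μ(dx)` of the edge potential. -/
noncomputable def edgeMass (μ : Measure X) (M : PairwiseMRF G X) (e : G.Dart) (y : X) : ℝ :=
  ∫ x, M.edgePot e.snd e.fst x y ∂μ

variable {μ : Measure X} [IsFiniteMeasure μ] {M : PairwiseMRF G X} {lam : ℕ → ℝ}
  {φ : G.Dart → ℕ → X → ℝ}

namespace IsRegular

theorem mass_pos (h : IsRegular μ M lam φ) : 0 < μ.real Set.univ := by
  rw [Measure.real, ENNReal.toReal_pos_iff]
  exact ⟨Measure.measure_univ_pos.2 h.ne_zero, measure_lt_top _ _⟩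

theorem orthonormalSeq (h : IsRegular μ M lam φ) (e : G.Dart) : OrthonormalSeq μ (φ e) :=
  (h.eig e).orthonormalSeq

theorem edgePot_pos (_h : IsRegular μ M lam φ) (e : G.Dart) (x y : X) :
    0 < M.edgePot e.snd e.fst x y := M.edgePot_pos _ _ e.adj.symm x y

theorem lam_nonneg (h : IsRegular μ M lam φ) (e : G.Dart) (j : ℕ) : 0 ≤ lam j :=
  nonneg_of_antitone_of_summable (h.eig e).antitone h.trace j

theorem exists_edgePot_bounds (h : IsRegular μ M lam φ) : ∃ C : ℝ, 0 < C ∧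
    ∀ (e : G.Dart) (x y : X), 1 / C ≤ M.edgePot e.snd e.fst x y ∧
      M.edgePot e.snd e.fst x y ≤ C := by
  have h1 : ∀ e : G.Dart, ∃ C : ℝ, 0 < C ∧ ∀ x y : X, 1 / C ≤ M.edgePot e.snd e.fst x y ∧
      M.edgePot e.snd e.fst x y ≤ C := by
    intro e
    obtain ⟨C, hC0, hC⟩ := exists_bound_of_continuous (h.edge e)
    have hinv : Continuous fun z : X × X => (M.edgePot e.snd e.fst z.1 z.2)⁻¹ :=
      (h.edge e).inv₀ fun z => (h.edgePot_pos e z.1 z.2).ne'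
    obtain ⟨D, hD0, hD⟩ := exists_bound_of_continuous hinv
    refine ⟨max C D, lt_max_of_lt_left hC0, fun x y => ⟨?_, ?_⟩⟩
    · have h2 := (le_abs_self _).trans (hD (x, y))
      rw [one_div]
      exact inv_le_of_inv_le₀ (h.edgePot_pos e x y) (h2.trans (le_max_right _ _))
    · exact ((le_abs_self _).trans (hC (x, y))).trans (le_max_left _ _)
  choose C hC0 hC using h1
  obtain ⟨D, hD⟩ := Finite.exists_le C
  refine ⟨max D 1, lt_max_of_lt_right one_pos, fun e x y => ⟨?_, ?_⟩⟩
  · exact (one_div_le_one_div_of_le (hC0 e) ((hD e).trans (le_max_left _ _))).trans (hC e x y).1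
  · exact (hC e x y).2.trans ((hD e).trans (le_max_left _ _))

theorem continuous_edgePot_left (h : IsRegular μ M lam φ) (e : G.Dart) (y : X) :
    Continuous fun x => M.edgePot e.snd e.fst x y :=
  (h.edge e).comp (Continuous.prodMk_left y)

theorem continuous_edgeMass (h : IsRegular μ M lam φ) (e : G.Dart) :
    Continuous (edgeMass μ M e) :=
  continuous_integral_right (f := fun y x => M.edgePot e.snd e.fst x y)
    ((h.edge e).comp continuous_swap)

theorem exists_edgeMass_bounds (h : IsRegular μ M lam φ) : ∃ C : ℝ, 0 < C ∧
    (∀ (e : G.Dart) (x y : X), 1 / C ≤ M.edgePot e.snd e.fst x y ∧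
      M.edgePot e.snd e.fst x y ≤ C) ∧
    ∀ (e : G.Dart) (y : X), μ.real Set.univ * (1 / C) ≤ edgeMass μ M e y ∧
      edgeMass μ M e y ≤ μ.real Set.univ * C := by
  obtain ⟨C, hC0, hC⟩ := h.exists_edgePot_bounds
  refine ⟨C, hC0, hC, fun e y => ?_⟩
  have hi : Integrable (fun x => M.edgePot e.snd e.fst x y) μ :=
    integrable_of_continuous (h.continuous_edgePot_left e y)
  have h1 := integral_mono (integrable_const (μ := μ) (1 / C)) hi fun x => (hC e x y).1
  have h2 := integral_mono hi (integrable_const (μ := μ) C) fun x => (hC e x y).2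
  simp only [integral_const, smul_eq_mul] at h1 h2
  exact ⟨h1, h2⟩

theorem edgeMass_pos (h : IsRegular μ M lam φ) (e : G.Dart) (y : X) : 0 < edgeMass μ M e y := by
  obtain ⟨C, hC0, _, hC⟩ := h.exists_edgeMass_bounds
  have := h.mass_pos
  exact lt_of_lt_of_le (by positivity) (hC e y).1

/-- The node potential cancels, so up to a factor depending on y alone, Γ(·, y) is a section of the
kernel. All truncation bounds for kernels therefore carry over to Γ. -/
theorem normCompat_eq (_h : IsRegular μ M lam φ) (e : G.Dart) (x y : X) :
    normCompat μ M e x y = M.edgePot e.snd e.fst x y * (edgeMass μ M e y)⁻¹ := by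
  have h1 := M.nodePot_pos e.fst y
  unfold normCompat betaFun
  rw [div_mul_eq_div_div, div_self h1.ne', one_div]
  rfl

theorem exists_normCompat_bounds (h : IsRegular μ M lam φ) : ∃ c B : ℝ, 0 < c ∧ 0 < B ∧
    ∀ (e : G.Dart) (x y : X), c ≤ normCompat μ M e x y ∧ normCompat μ M e x y ≤ B := by
  obtain ⟨C, hC0, hC1, hC2⟩ := h.exists_edgeMass_bounds
  have hm := h.mass_pos
  refine ⟨1 / C * (μ.real Set.univ * C)⁻¹, C * (μ.real Set.univ * (1 / C))⁻¹, by positivity,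
    by positivity, fun e x y => ?_⟩
  have hI := h.edgeMass_pos e y
  rw [h.normCompat_eq]
  constructor
  · exact mul_le_mul (hC1 e x y).1 (inv_anti₀ hI (hC2 e y).2) (by positivity)
      (h.edgePot_pos e x y).le
  · exact mul_le_mul (hC1 e x y).2 (inv_anti₀ (by positivity) (hC2 e y).1) (by positivity) hC0.le

theorem continuous_normCompat (h : IsRegular μ M lam φ) (e : G.Dart) (y : X) :
    Continuous fun x => normCompat μ M e x y := by
  simp only [h.normCompat_eq]
  exact (h.continuous_edgePot_left e y).mul continuous_const

theorem memLp_normCompat (h : IsRegular μ M lam φ) (e : G.Dart) (y : X) :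
    MemLp (fun x => normCompat μ M e x y) 2 μ :=
  memLp_of_continuous (h.continuous_normCompat e y) 2

theorem integral_normCompat (h : IsRegular μ M lam φ) (e : G.Dart) (y : X) :
    ∫ x, normCompat μ M e x y ∂μ = 1 := by
  simp only [h.normCompat_eq, integral_mul_const]
  exact mul_inv_cancel₀ (h.edgeMass_pos e y).ne'

theorem normCompat_eq_kernel (h : IsRegular μ M lam φ) (e : G.Dart) (x y : X) :
    normCompat μ M e x y = (edgeMass μ M e y)⁻¹ * M.edgePot e.snd e.fst y x := by
  rw [h.normCompat_eq, (h.psd e).symm x y, mul_comm]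

theorem compatCoeff_eq (h : IsRegular μ M lam φ) (e : G.Dart) (j : ℕ) (y : X) :
    compatCoeff μ M φ e j y = (edgeMass μ M e y)⁻¹ * (lam j * φ e j y) := by
  unfold compatCoeff
  simp only [h.normCompat_eq_kernel, mul_assoc, integral_const_mul]
  rw [(h.eig e).eigen]

theorem continuous_compatCoeff (h : IsRegular μ M lam φ) (e : G.Dart) (j : ℕ) :
    Continuous (compatCoeff μ M φ e j) := by
  have : compatCoeff μ M φ e j = fun y => (edgeMass μ M e y)⁻¹ * (lam j * φ e j y) :=
    funext fun y => h.compatCoeff_eq e j y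
  rw [this]
  exact ((h.continuous_edgeMass e).inv₀ fun y => (h.edgeMass_pos e y).ne').mul
    (continuous_const.mul ((h.eig e).continuous j))

theorem resid_normCompat (h : IsRegular μ M lam φ) (e : G.Dart) (y : X) (r : ℕ) (x : X) :
    resid μ (φ e) r (fun x => normCompat μ M e x y) x =
      (edgeMass μ M e y)⁻¹ * resid μ (φ e) r (M.edgePot e.snd e.fst y) x := by
  unfold resid
  rw [mul_sub, Finset.mul_sum]
  refine congrArg₂ _ (h.normCompat_eq_kernel e x y) ?_
  refine Finset.sum_congr rfl fun j _ => ?_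
  change compatCoeff μ M φ e j y * _ = _
  rw [h.compatCoeff_eq, (h.eig e).coef_kernel, mul_assoc]

theorem exists_diag_bound (h : IsRegular μ M lam φ) : ∃ B : ℝ, 0 < B ∧
    ∀ (e : G.Dart) (y : X), (edgeMass μ M e y)⁻¹ ^ 2 * M.edgePot e.snd e.fst y y ≤ B := by
  obtain ⟨C, hC0, hC1, hC2⟩ := h.exists_edgeMass_bounds
  have hm := h.mass_pos
  refine ⟨(μ.real Set.univ * (1 / C))⁻¹ ^ 2 * C, by positivity, fun e y => ?_⟩
  have hI := h.edgeMass_pos e y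
  exact mul_le_mul (pow_le_pow_left₀ (by positivity) (inv_anti₀ (by positivity) (hC2 e y).1) 2)
    (hC1 e y y).2 (h.edgePot_pos e y y).le (by positivity)

theorem exists_l2norm_resid_normCompat_le (h : IsRegular μ M lam φ) : ∃ B : ℝ, 0 < B ∧
    ∀ (e : G.Dart) (y : X) (r : ℕ),
      l2norm μ (resid μ (φ e) r fun x => normCompat μ M e x y) ≤ B * Real.sqrt (lam r) := by
  obtain ⟨B, hB0, hB⟩ := h.exists_diag_bound
  refine ⟨Real.sqrt B, Real.sqrt_pos.2 hB0, fun e y r => ?_⟩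
  rw [← Real.sqrt_mul hB0.le]
  refine Real.sqrt_le_sqrt ?_
  simp only [h.resid_normCompat, mul_pow, integral_const_mul]
  have h1 := (h.eig e).resid_kernel_sq_le (h.psd e) (h.edge e) (h.lam_nonneg e) y r
  have h2 : 0 ≤ (edgeMass μ M e y)⁻¹ ^ 2 := sq_nonneg _
  have h3 := hB e y
  have h4 := h.lam_nonneg e r
  calc (edgeMass μ M e y)⁻¹ ^ 2 * ∫ x, resid μ (φ e) r (M.edgePot e.snd e.fst y) x ^ 2 ∂μ
      ≤ (edgeMass μ M e y)⁻¹ ^ 2 * (lam r * M.edgePot e.snd e.fst y y) :=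
        mul_le_mul_of_nonneg_left h1 h2
    _ = (edgeMass μ M e y)⁻¹ ^ 2 * M.edgePot e.snd e.fst y y * lam r := by ring
    _ ≤ B * lam r := mul_le_mul_of_nonneg_right h3 h4

/-- If the largest eigenvalue vanished, so would the r = 0 residual bound, that is the norm of Γ(·,
y) itself, although Γ is bounded below by a positive constant. -/
theorem lam_zero_pos (h : IsRegular μ M lam φ) (e : G.Dart) : 0 < lam 0 := by
  by_contra h0
  have hz : ∀ r, lam r ≤ 0 := fun r => ((h.eig e).antitone (Nat.zero_le r)).trans (not_lt.1 h0)
  obtain ⟨B, _, hB⟩ := h.exists_l2norm_resid_normCompat_le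
  have hne : Nonempty X := by
    by_contra hX
    have := not_nonempty_iff.1 hX
    exact h.ne_zero (Measure.eq_zero_of_isEmpty μ)
  obtain ⟨y⟩ := hne
  obtain ⟨c, _, hc0, _, hc⟩ := h.exists_normCompat_bounds
  have h1 := hB e y 0
  rw [Real.sqrt_eq_zero_of_nonpos (hz 0), mul_zero] at h1
  have h2 : l2norm μ (fun _ : X => c) ≤
      l2norm μ (resid μ (φ e) 0 fun x => normCompat μ M e x y) := by
    refine l2norm_mono ((h.orthonormalSeq e).memLp_resid (h.memLp_normCompat e y) 0) fun x => ?_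
    simp only [resid, Finset.range_zero, Finset.sum_empty, sub_zero]
    rw [abs_of_pos hc0]
    exact (hc e x y).1.trans (le_abs_self _)
  have h3 : 0 < l2norm μ (fun _ : X => c) := by
    unfold l2norm
    refine Real.sqrt_pos.2 ?_
    rw [integral_const, smul_eq_mul]
    exact mul_pos h.mass_pos (pow_pos hc0 2)
  linarith

end IsRegular

/-! ### The critical dimension as δ tends to 0 -/

theorem exists_criticalDim {lam : ℕ → ℝ} (hs : Summable lam) {δ : ℝ} (hδ : 0 < δ) :
    1 ≤ criticalDim lam δ ∧ lam (criticalDim lam δ - 1) ≤ δ := by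
  have hne : {r : ℕ | 1 ≤ r ∧ lam (r - 1) ≤ δ}.Nonempty := by
    obtain ⟨n, hn⟩ := (hs.tendsto_atTop_zero.eventually (gt_mem_nhds hδ)).exists
    exact ⟨n + 1, by omega, by simpa using hn.le⟩
  exact Nat.sInf_mem hne

/-- For operators of finite rank, where the critical dimension stays bounded as δ → 0: below this d
it can stop at a small index only at a vanishing eigenvalue. -/
theorem exists_pos_le_of_pos (lam : ℕ → ℝ) (R : ℕ) :
    ∃ d : ℝ, 0 < d ∧ ∀ j < R, 0 < lam j → d ≤ lam j := by
  induction R with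
  | zero => exact ⟨1, one_pos, fun j hj => by omega⟩
  | succ R ih =>
    obtain ⟨d, hd, h⟩ := ih
    by_cases hR : 0 < lam R
    · refine ⟨min d (lam R), lt_min hd hR, fun j hj hl => ?_⟩
      rcases Nat.lt_succ_iff_lt_or_eq.1 hj with h1 | h1
      · exact (min_le_left _ _).trans (h j h1 hl)
      · rw [h1]
        exact min_le_right _ _
    · refine ⟨d, hd, fun j hj hl => ?_⟩
      rcases Nat.lt_succ_iff_lt_or_eq.1 hj with h1 | h1
      · exact h j h1 hl
      · rw [h1] at hl
        exact absurd hl hR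

theorem eventually_lt_nhdsGT {d : ℝ} (hd : 0 < d) :
    ∀ᶠ δ in nhdsWithin (0 : ℝ) (Set.Ioi 0), 0 < δ ∧ δ < d :=
  Ioo_mem_nhdsGT hd

namespace IsRegular

theorem lam_criticalDim_le (h : IsRegular μ M lam φ) (e : G.Dart) {δ : ℝ} (hδ : 0 < δ) :
    lam (criticalDim lam δ) ≤ δ :=
  ((h.eig e).antitone (Nat.sub_le _ _)).trans (exists_criticalDim h.trace hδ).2

/-- As δ → 0, either r grows beyond any R, so that the tail of the constant 1 becomes small, or r
stays bounded and λ_r = 0 for small δ. In both cases the integral of the residual is o(√δ),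
uniformly in y. -/
theorem eventually_abs_integral_resid_le (h : IsRegular μ M lam φ) {ε : ℝ} (hε : 0 < ε) :
    ∀ᶠ δ in nhdsWithin (0 : ℝ) (Set.Ioi 0), ∀ (e : G.Dart) (y : X),
      |∫ x, resid μ (φ e) (criticalDim lam δ) (fun x => normCompat μ M e x y) x ∂μ| ≤
        ε * Real.sqrt δ := by
  rw [Filter.eventually_all]
  intro e
  obtain ⟨B, hB0, hB⟩ := h.exists_diag_bound
  have htail := (tendsto_sum_nat_add fun j => coef μ (φ e) (fun _ => 1) j ^ 2).mul_const B
  rw [zero_mul] at htail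
  obtain ⟨R, hR⟩ := Filter.eventually_atTop.1 (htail.eventually (gt_mem_nhds (pow_pos hε 2)))
  obtain ⟨d, hd, hdR⟩ := exists_pos_le_of_pos lam R
  filter_upwards [eventually_lt_nhdsGT hd] with δ ⟨hδ, hδd⟩ y
  obtain ⟨h1, h2⟩ := exists_criticalDim h.trace hδ
  set r := criticalDim lam δ with hr
  have hlr : lam r ≤ δ := h.lam_criticalDim_le e hδ
  have hlr0 := h.lam_nonneg e r
  set τ := ∑' j, coef μ (φ e) (fun _ => 1) (j + r) ^ 2 with hτ
  have hτ0 : 0 ≤ τ := tsum_nonneg fun _ => sq_nonneg _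
  have key : (∫ x, resid μ (φ e) r (fun x => normCompat μ M e x y) x ∂μ) ^ 2 ≤
      τ * B * lam r := by
    simp only [h.resid_normCompat, integral_const_mul, mul_pow]
    have h3 := (h.eig e).integral_resid_kernel_sq_le (h.psd e) (h.edge e) (h.lam_nonneg e) y r
    calc (edgeMass μ M e y)⁻¹ ^ 2 * (∫ x, resid μ (φ e) r (M.edgePot e.snd e.fst y) x ∂μ) ^ 2
        ≤ (edgeMass μ M e y)⁻¹ ^ 2 * (τ * (lam r * M.edgePot e.snd e.fst y y)) :=
          mul_le_mul_of_nonneg_left h3 (sq_nonneg _)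
      _ = τ * lam r * ((edgeMass μ M e y)⁻¹ ^ 2 * M.edgePot e.snd e.fst y y) := by ring
      _ ≤ τ * lam r * B := mul_le_mul_of_nonneg_left (hB e y) (mul_nonneg hτ0 hlr0)
      _ = τ * B * lam r := by ring
  have key2 : τ * B * lam r ≤ ε ^ 2 * δ := by
    -- Below R, the inequality λ_{r−1} ≤ δ < d excludes a positive eigenvalue, and there is no
    -- truncation error.
    rcases lt_or_ge (r - 1) R with hrR | hrR
    · have h0 : lam (r - 1) ≤ 0 := by
        by_contra hpos
        have := hdR _ hrR (not_le.1 hpos)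
        linarith
      have h3 : lam r = 0 :=
        le_antisymm (((h.eig e).antitone (Nat.sub_le r 1)).trans h0) hlr0
      rw [h3, mul_zero]
      positivity
    · have h3 := (hR r (by omega)).le
      exact mul_le_mul h3 hlr hlr0 (by positivity)
  have h4 := Real.abs_le_sqrt (key.trans key2)
  rwa [Real.sqrt_mul (sq_nonneg _), Real.sqrt_sq hε.le] at h4

end IsRegular

end Regular

/-! ## The iterates of the algorithm -/

section Iterates

variable {V : Type*} [Fintype V] [DecidableEq V] {G : SimpleGraph V} [DecidableRel G.Adj]
variable {X : Type*} [MeasurableSpace X]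

theorem sumEval_val {α : Type*} (f : α → ℝ) (l : List α) :
    (Counted.sumEval f l).val = (l.map f).sum := by
  induction l with
  | nil => rfl
  | cons a l ih =>
    simp only [Counted.sumEval, Counted.andThen, Counted.eval, Counted.add, List.map_cons,
      List.sum_cons, ih]

theorem sumEval_ops {α : Type*} (f : α → ℝ) (l : List α) :
    (Counted.sumEval f l).ops = 2 * l.length := by
  induction l with
  | nil => rfl
  | cons a l ih =>
    simp only [Counted.sumEval, Counted.andThen, Counted.eval, Counted.add, List.length_cons, ih]
    ring

variable (μ : Measure X) (M : PairwiseMRF G X) (φ : G.Dart → ℕ → X → ℝ)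

theorem sosmp_ops (γ : ℝ) (c r k : ℕ) (y : ℕ → G.Dart → Fin k → X) (t : ℕ) (e : G.Dart) :
    (sosmp μ M φ γ c r k y t e).ops = r + t * (k * (c * r) + 4 + r * (2 * k + 4)) := by
  induction t with
  | zero => simp [sosmp, Counted.forAll, Counted.div]
  | succ t ih =>
    simp only [sosmp, Counted.andThen, ih, edgeStep, Counted.forAll, Counted.add, Counted.sub,
      Counted.mul, Counted.div, sumEval_ops, List.length_ofFn, Finset.sum_const,
      Finset.card_univ, Fintype.card_fin, smul_eq_mul]
    ring

theorem coeffs_zero (γ : ℝ) (r k : ℕ) (y : ℕ → G.Dart → Fin k → X) (e : G.Dart) (j : Fin r) :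
    coeffs μ M φ γ r k y 0 e j = 1 / r := rfl

theorem coeffs_succ (γ : ℝ) (r k : ℕ) (y : ℕ → G.Dart → Fin k → X) (t : ℕ) (e : G.Dart)
    (j : Fin r) :
    coeffs μ M φ γ r k y (t + 1) e j = (1 - stepSize γ t) * coeffs μ M φ γ r k y t e j +
      stepSize γ t * ((∑ i, compatCoeff μ M φ e j (y t e i)) / k) := by
  unfold coeffs
  simp only [sosmp, Counted.andThen, edgeStep, Counted.forAll, Counted.add, Counted.sub,
    Counted.mul, Counted.div, sumEval_val, List.map_ofFn, List.sum_ofFn, stepSize,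
    Function.comp_apply]

/-- The iterates of the algorithm without truncation to `r` coefficients, started at the message
`Γ(·, z)`. -/
noncomputable def fullMessage (γ : ℝ) (k : ℕ) (z : X) (y : ℕ → G.Dart → Fin k → X) :
    ℕ → G.Dart → X → ℝ
  | 0, e, x => normCompat μ M e x z
  | t + 1, e, x => (1 - stepSize γ t) * fullMessage γ k z y t e x +
      stepSize γ t * ((∑ i, normCompat μ M e x (y t e i)) / k)

end Iterates

/-! ### The untruncated iterates: mass, size, lower bound and truncation error -/

section Bounds

variable {V : Type*} [Fintype V] [DecidableEq V] {G : SimpleGraph V} [DecidableRel G.Adj]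
variable {X : Type*} [MetricSpace X] [CompactSpace X] [MeasurableSpace X] [BorelSpace X]
variable {μ : Measure X} [IsFiniteMeasure μ] {M : PairwiseMRF G X} {lam : ℕ → ℝ}
  {φ : G.Dart → ℕ → X → ℝ} {γ : ℝ} {k : ℕ}

/-- Each step is an affine combination with coefficients 1 − η and η, so the weights sum to 1. They
may be negative while η > 1; `exists_recursion_bound` keeps their absolute sum bounded uniformly in
t and in the points. Every uniform bound on Γ(·, y) thus passes to the iterates. -/
theorem exists_fullMessage_eq_sum (hγ : 0 < γ) (hk : 0 < k) (μ : Measure X)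
    (M : PairwiseMRF G X) : ∃ W : ℝ, 1 ≤ W ∧
    ∀ (z : X) (y : ℕ → G.Dart → Fin k → X) (t : ℕ) (e : G.Dart),
      ∃ (ι : Type) (_ : Fintype ι) (w : ι → ℝ) (p : ι → X), ∑ i, w i = 1 ∧ ∑ i, |w i| ≤ W ∧
        ∀ x, fullMessage μ M γ k z y t e x = ∑ i, w i * normCompat μ M e x (p i) := by
  obtain ⟨W, hW1, hW⟩ := exists_recursion_bound hγ
  -- The worst-case recursion for the sum of the absolute weights, with the inequality made an
  -- equality.
  let q : ℕ → ℝ := fun t => Nat.rec 1 (fun t q => |1 - stepSize γ t| * q + stepSize γ t * 1) t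
  have hq : ∀ t, q t ≤ W * 1 := hW q 1 zero_le_one le_rfl fun t => le_rfl
  have hk' : (k : ℝ) ≠ 0 := by exact_mod_cast hk.ne'
  refine ⟨W, hW1, fun z y t e => ?_⟩
  have key : ∃ (ι : Type) (_ : Fintype ι) (w : ι → ℝ) (p : ι → X), ∑ i, w i = 1 ∧
      ∑ i, |w i| ≤ q t ∧
      ∀ x, fullMessage μ M γ k z y t e x = ∑ i, w i * normCompat μ M e x (p i) := by
    induction t with
    | zero => exact ⟨Unit, inferInstance, fun _ => 1, fun _ => z, by simp, by simp [q],
        fun x => by simp [fullMessage]⟩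
    | succ t ih =>
      obtain ⟨ι, _, w, p, h1, h2, h3⟩ := ih
      refine ⟨ι ⊕ Fin k, inferInstance,
        Sum.elim (fun i => (1 - stepSize γ t) * w i) (fun _ => stepSize γ t / k),
        Sum.elim p (y t e), ?_, ?_, fun x => ?_⟩
      · simp only [Fintype.sum_sum_type, Sum.elim_inl, Sum.elim_inr, ← Finset.mul_sum, h1,
          Finset.sum_const, Finset.card_univ, Fintype.card_fin, nsmul_eq_mul]
        field_simp
        ring
      · have hs := stepSize_pos hγ t
        have hkp : (0 : ℝ) < k := by exact_mod_cast hk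
        simp only [Fintype.sum_sum_type, Sum.elim_inl, Sum.elim_inr, abs_mul, ← Finset.mul_sum,
          Finset.sum_const, Finset.card_univ, Fintype.card_fin, nsmul_eq_mul]
        rw [abs_of_pos (div_pos hs hkp), mul_div_cancel₀ _ hk']
        change _ ≤ |1 - stepSize γ t| * q t + stepSize γ t * 1
        rw [mul_one]
        exact add_le_add (mul_le_mul_of_nonneg_left h2 (abs_nonneg _)) le_rfl
      · simp only [Fintype.sum_sum_type, Sum.elim_inl, Sum.elim_inr, fullMessage, h3, mul_assoc,
          ← Finset.mul_sum]
        ring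
  obtain ⟨ι, hι, w, p, h1, h2, h3⟩ := key
  exact ⟨ι, hι, w, p, h1, h2.trans ((hq t).trans (mul_one W).le), h3⟩

theorem resid_sum {ι : Type*} [Fintype ι] {ψ : ℕ → X → ℝ} (hψ : OrthonormalSeq μ ψ)
    (w : ι → ℝ) {f : ι → X → ℝ} (hf : ∀ i, MemLp (f i) 2 μ) (r : ℕ) (x : X) :
    resid μ ψ r (fun x => ∑ i, w i * f i x) x = ∑ i, w i * resid μ ψ r (f i) x := by
  have hc : ∀ j, coef μ ψ (fun x => ∑ i, w i * f i x) j = ∑ i, w i * coef μ ψ (f i) j := by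
    intro j
    unfold coef
    simp only [Finset.sum_mul, mul_assoc]
    rw [integral_finsetSum _ fun i _ =>
      (MemLp.integrable_mul_two (hf i) (hψ.1 j)).const_mul (w i)]
    simp only [integral_const_mul]
  unfold resid
  simp only [hc, mul_sub, Finset.sum_sub_distrib, Finset.sum_mul, Finset.mul_sum]
  congr 1
  rw [Finset.sum_comm]
  simp only [mul_assoc]

namespace IsRegular

theorem continuous_fullMessage (h : IsRegular μ M lam φ) (z : X) (y : ℕ → G.Dart → Fin k → X)
    (t : ℕ) (e : G.Dart) : Continuous (fullMessage μ M γ k z y t e) := by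
  induction t with
  | zero => exact h.continuous_normCompat e z
  | succ t ih =>
    change Continuous fun x => (1 - stepSize γ t) * fullMessage μ M γ k z y t e x +
      stepSize γ t * ((∑ i, normCompat μ M e x (y t e i)) / k)
    exact (continuous_const.mul ih).add (continuous_const.mul
      ((continuous_finsetSum _ fun i _ => h.continuous_normCompat e _).div_const _))

theorem integral_fullMessage (h : IsRegular μ M lam φ) (hγ : 0 < γ) (hk : 0 < k) (z : X)
    (y : ℕ → G.Dart → Fin k → X) (t : ℕ) (e : G.Dart) :
    ∫ x, fullMessage μ M γ k z y t e x ∂μ = 1 := by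
  obtain ⟨W, _, hW⟩ := exists_fullMessage_eq_sum hγ hk μ M
  obtain ⟨ι, _, w, p, h1, _, h3⟩ := hW z y t e
  simp only [h3]
  rw [integral_finsetSum _ fun i _ =>
    (integrable_of_continuous (h.continuous_normCompat e _)).const_mul _]
  simp only [integral_const_mul, h.integral_normCompat, mul_one, h1]

theorem exists_abs_fullMessage_le (h : IsRegular μ M lam φ) (hγ : 0 < γ) (hk : 0 < k) :
    ∃ B : ℝ, 0 < B ∧ ∀ (z : X) (y : ℕ → G.Dart → Fin k → X) (t : ℕ) (e : G.Dart) (x : X),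
      |fullMessage μ M γ k z y t e x| ≤ B := by
  obtain ⟨W, hW1, hW⟩ := exists_fullMessage_eq_sum hγ hk μ M
  obtain ⟨c, B, hc0, hB0, hB⟩ := h.exists_normCompat_bounds
  refine ⟨W * B, by positivity, fun z y t e x => ?_⟩
  obtain ⟨ι, _, w, p, h1, h2, h3⟩ := hW z y t e
  rw [h3]
  refine (Finset.abs_sum_le_sum_abs _ _).trans ?_
  refine le_trans ?_ (mul_le_mul_of_nonneg_right h2 hB0.le)
  rw [Finset.sum_mul]
  refine Finset.sum_le_sum fun i _ => ?_
  rw [abs_mul]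
  refine mul_le_mul_of_nonneg_left ?_ (abs_nonneg _)
  rw [abs_of_pos (hc0.trans_le (hB e x (p i)).1)]
  exact (hB e x (p i)).2

theorem exists_l2norm_resid_fullMessage_le (h : IsRegular μ M lam φ) (hγ : 0 < γ) (hk : 0 < k) :
    ∃ B : ℝ, 0 < B ∧ ∀ (z : X) (y : ℕ → G.Dart → Fin k → X) (t : ℕ) (e : G.Dart) (r : ℕ),
      l2norm μ (resid μ (φ e) r (fullMessage μ M γ k z y t e)) ≤ B * Real.sqrt (lam r) := by
  obtain ⟨W, hW1, hW⟩ := exists_fullMessage_eq_sum hγ hk μ M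
  obtain ⟨B, hB0, hB⟩ := h.exists_l2norm_resid_normCompat_le
  refine ⟨W * B, by positivity, fun z y t e r => ?_⟩
  obtain ⟨ι, _, w, p, h1, h2, h3⟩ := hW z y t e
  have h4 : resid μ (φ e) r (fullMessage μ M γ k z y t e) = fun x =>
      ∑ i, w i * resid μ (φ e) r (fun x => normCompat μ M e x (p i)) x := by
    funext x
    rw [funext h3, resid_sum (h.orthonormalSeq e) w fun i => h.memLp_normCompat e (p i)]
  rw [h4]
  refine (l2norm_sum_le _ fun i _ => ((h.orthonormalSeq e).memLp_resid
    (h.memLp_normCompat e (p i)) r).const_mul _).trans ?_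
  rw [mul_assoc]
  refine le_trans ?_ (mul_le_mul_of_nonneg_right h2 (by positivity))
  rw [Finset.sum_mul]
  refine Finset.sum_le_sum fun i _ => ?_
  rw [l2norm_const_mul]
  exact mul_le_mul_of_nonneg_left (hB e (p i) r) (abs_nonneg _)

theorem eventually_abs_integral_resid_fullMessage_le (h : IsRegular μ M lam φ) (hγ : 0 < γ)
    (hk : 0 < k) {ε : ℝ} (hε : 0 < ε) :
    ∀ᶠ δ in nhdsWithin (0 : ℝ) (Set.Ioi 0), ∀ (z : X) (y : ℕ → G.Dart → Fin k → X) (t : ℕ)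
      (e : G.Dart), |∫ x, resid μ (φ e) (criticalDim lam δ) (fullMessage μ M γ k z y t e) x ∂μ| ≤
        ε * Real.sqrt δ := by
  obtain ⟨W, hW1, hW⟩ := exists_fullMessage_eq_sum hγ hk μ M
  have hW0 : 0 < W := by linarith
  filter_upwards [h.eventually_abs_integral_resid_le (div_pos hε hW0)] with δ hδ z y t e
  set r := criticalDim lam δ
  obtain ⟨ι, _, w, p, h1, h2, h3⟩ := hW z y t e
  have h4 : resid μ (φ e) r (fullMessage μ M γ k z y t e) = fun x =>
      ∑ i, w i * resid μ (φ e) r (fun x => normCompat μ M e x (p i)) x := by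
    funext x
    rw [funext h3, resid_sum (h.orthonormalSeq e) w fun i => h.memLp_normCompat e (p i)]
  rw [h4, integral_finsetSum _ fun i _ => (((h.orthonormalSeq e).memLp_resid
    (h.memLp_normCompat e (p i)) r).const_mul _).integrable (by norm_num)]
  simp only [integral_const_mul]
  refine (Finset.abs_sum_le_sum_abs _ _).trans ?_
  have h5 : ε * Real.sqrt δ = W * (ε / W * Real.sqrt δ) := by field_simp
  rw [h5]
  refine le_trans ?_ (mul_le_mul_of_nonneg_right h2 (by positivity))
  rw [Finset.sum_mul]
  refine Finset.sum_le_sum fun i _ => ?_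
  rw [abs_mul]
  exact mul_le_mul_of_nonneg_left (hδ e (p i)) (abs_nonneg _)

/-- Averages of Γ(·, y) are at least c, so once η ≤ 1 the deficit max(0, c − value) shrinks by 1 − η
in every step and falls below c/2. The time does not depend on the sampled points. -/
theorem exists_le_fullMessage (h : IsRegular μ M lam φ) (hγ : 0 < γ) (hk : 0 < k) :
    ∃ (c : ℝ) (t₀ : ℕ), 0 < c ∧ ∀ (z : X) (y : ℕ → G.Dart → Fin k → X) (t : ℕ), t₀ ≤ t →
      ∀ (e : G.Dart) (x : X), c ≤ fullMessage μ M γ k z y t e x := by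
  obtain ⟨c, _, hc0, _, hc⟩ := h.exists_normCompat_bounds
  obtain ⟨B, hB0, hB⟩ := h.exists_abs_fullMessage_le (γ := γ) hγ hk
  obtain ⟨N, hN⟩ := exists_stepSize_le_one hγ
  obtain ⟨C, hC0, hC⟩ := exists_decay_bound hγ N
  have hlim := (tendsto_decay hγ).const_mul (C * (c + B))
  rw [mul_zero] at hlim
  obtain ⟨t₀, ht₀⟩ := Filter.eventually_atTop.1
    (hlim.eventually (gt_mem_nhds (show (0 : ℝ) < c / 2 by positivity)))
  refine ⟨c / 2, max N t₀, by positivity, fun z y t ht e x => ?_⟩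
  let u : ℕ → ℝ := fun t => max 0 (c - fullMessage μ M γ k z y t e x)
  have hk' : (0 : ℝ) < k := by exact_mod_cast hk
  have h1 := hC u (le_max_left _ _) (fun t ht => ?_) hN t ((le_max_left _ _).trans ht)
  · have h2 : u N ≤ c + B := by
      refine max_le (by positivity) ?_
      have := (abs_le.1 (hB z y N e x)).1
      linarith
    have h3 := (ht₀ t ((le_max_right _ _).trans ht)).le
    have h4 : C * u N * decay γ t ≤ C * (c + B) * decay γ t :=
      mul_le_mul_of_nonneg_right (mul_le_mul_of_nonneg_left h2 hC0.le) (decay_pos γ t).le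
    have h5 : c - fullMessage μ M γ k z y t e x ≤ u t := le_max_right _ _
    linarith
  · have hs := stepSize_pos hγ t
    have hs1 := hN t ht
    have h2 : c ≤ (∑ i, normCompat μ M e x (y t e i)) / k := by
      rw [le_div_iff₀ hk']
      have := Finset.card_nsmul_le_sum Finset.univ (fun i => normCompat μ M e x (y t e i)) c
        fun i _ => (hc e x (y t e i)).1
      simpa [mul_comm] using this
    have h3 : c - fullMessage μ M γ k z y t e x ≤ u t := le_max_right _ _
    have h4 : 0 ≤ u t := le_max_left _ _
    refine max_le (mul_nonneg (by linarith) h4) ?_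
    have h5 : fullMessage μ M γ k z y (t + 1) e x = (1 - stepSize γ t) *
      fullMessage μ M γ k z y t e x +
      stepSize γ t * ((∑ i, normCompat μ M e x (y t e i)) / k) := rfl
    rw [h5]
    nlinarith

/-- Both recursions receive the same inputs, because ⟨Γ(·, y), φ_j⟩ is what the algorithm evaluates.
The inputs cancel in the difference and only the initial difference remains, multiplied by all
factors 1 − η. -/
theorem coeffs_sub_coef_fullMessage (h : IsRegular μ M lam φ) (r : ℕ) (z : X)
    (y : ℕ → G.Dart → Fin k → X) (t : ℕ) (e : G.Dart) (j : Fin r) :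
    coeffs μ M φ γ r k y t e j - coef μ (φ e) (fullMessage μ M γ k z y t e) j =
      (∏ s ∈ Finset.range t, (1 - stepSize γ s)) * (1 / r - compatCoeff μ M φ e j z) := by
  induction t with
  | zero =>
    rw [coeffs_zero, Finset.range_zero, Finset.prod_empty, one_mul]
    rfl
  | succ t ih =>
    have hc : coef μ (φ e) (fullMessage μ M γ k z y (t + 1) e) j =
        (1 - stepSize γ t) * coef μ (φ e) (fullMessage μ M γ k z y t e) j +
        stepSize γ t * ((∑ i, compatCoeff μ M φ e j (y t e i)) / k) := by
      have i1 : Integrable (fun x => fullMessage μ M γ k z y t e x * φ e j x) μ :=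
        integrable_of_continuous ((h.continuous_fullMessage z y t e).mul
          ((h.eig e).continuous j))
      have i2 : ∀ i, Integrable (fun x => normCompat μ M e x (y t e i) * φ e j x) μ := fun i =>
        integrable_of_continuous ((h.continuous_normCompat e _).mul ((h.eig e).continuous j))
      have h1 : ∀ x, fullMessage μ M γ k z y (t + 1) e x * φ e j x = (1 - stepSize γ t) *
          (fullMessage μ M γ k z y t e x * φ e j x) + stepSize γ t / k *
            ∑ i, normCompat μ M e x (y t e i) * φ e j x := by
        intro x
        rw [← Finset.sum_mul]
        simp only [fullMessage]
        ring
      unfold coef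
      simp only [h1]
      rw [integral_add (i1.const_mul _) ((integrable_finsetSum _ fun i _ => i2 i).const_mul _),
        integral_const_mul, integral_const_mul, integral_finsetSum _ fun i _ => i2 i]
      simp only [compatCoeff]
      ring
    rw [coeffs_succ, hc, Finset.prod_range_succ, mul_right_comm, ← ih]
    ring

end IsRegular

end Bounds

/-! ## The iterates are close to positive densities -/

section Positivity

variable {V : Type*} [Fintype V] [DecidableEq V] {G : SimpleGraph V} [DecidableRel G.Adj]
variable {X : Type*} [MetricSpace X] [CompactSpace X] [MeasurableSpace X] [BorelSpace X]
variable {μ : Measure X} [IsFiniteMeasure μ] {M : PairwiseMRF G X} {lam : ℕ → ℝ}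
  {φ : G.Dart → ℕ → X → ℝ} {γ : ℝ} {k : ℕ}

theorem l2norm_const_one : l2norm μ (fun _ : X => (1 : ℝ)) = Real.sqrt (μ.real Set.univ) := by
  unfold l2norm
  simp

theorem abs_integral_le_l2norm {f : X → ℝ} (hf : MemLp f 2 μ) :
    |∫ x, f x ∂μ| ≤ Real.sqrt (μ.real Set.univ) * l2norm μ f := by
  have := abs_integral_mul_le (memLp_of_continuous (μ := μ) (continuous_const (y := (1 : ℝ))) 2) hf
  rw [l2norm_const_one] at this
  simpa using this

theorem l2norm_le_of_abs_le {f : X → ℝ} {B : ℝ} (hB : 0 ≤ B) (h : ∀ x, |f x| ≤ B) :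
    l2norm μ f ≤ B * Real.sqrt (μ.real Set.univ) := by
  have h1 : l2norm μ f ≤ l2norm μ fun _ : X => B :=
    l2norm_mono (memLp_of_continuous continuous_const 2) fun x =>
      (h x).trans (le_abs_self _)
  have h2 := l2norm_const_mul (μ := μ) B fun _ : X => (1 : ℝ)
  rw [l2norm_const_one, abs_of_nonneg hB] at h2
  simp only [mul_one] at h2
  rwa [h2] at h1

namespace IsRegular

theorem continuous_message (h : IsRegular μ M lam φ) {r : ℕ} (a : G.Dart → Fin r → ℝ)
    (e : G.Dart) : Continuous (message φ a e) :=
  continuous_finsetSum _ fun j _ => continuous_const.mul ((h.eig e).continuous j)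

theorem continuous_posMessage (h : IsRegular μ M lam φ) {r : ℕ} (a : G.Dart → Fin r → ℝ)
    (e : G.Dart) : Continuous (posMessage φ a e) :=
  continuous_const.max (h.continuous_message a e)

theorem continuous_betaFun (h : IsRegular μ M lam φ) (e : G.Dart) :
    Continuous (betaFun μ M e) := (h.node e.fst).mul (h.continuous_edgeMass e)

theorem betaFun_pos (h : IsRegular μ M lam φ) (e : G.Dart) (y : X) : 0 < betaFun μ M e y :=
  mul_pos (M.nodePot_pos _ _) (h.edgeMass_pos e y)

theorem continuous_sampleWeight (h : IsRegular μ M lam φ) {r : ℕ} (a : G.Dart → Fin r → ℝ)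
    (e : G.Dart) : Continuous (sampleWeight μ M φ a e) :=
  (h.continuous_betaFun e).mul (continuous_finsetProd _ fun d _ => h.continuous_posMessage a d)

theorem sampleWeight_nonneg (h : IsRegular μ M lam φ) {r : ℕ} (a : G.Dart → Fin r → ℝ)
    (e : G.Dart) (y : X) : 0 ≤ sampleWeight μ M φ a e y :=
  mul_nonneg (h.betaFun_pos e y).le (Finset.prod_nonneg fun _ _ => le_max_left _ _)

/-- The initial vector has squared norm r · (1/r)² ≤ 1 and the coefficients of Γ(·, z) obey Bessel's
inequality, so the bound is uniform in r and hence in δ. -/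
theorem exists_l2norm_initial_le (h : IsRegular μ M lam φ) : ∃ D : ℝ, 0 < D ∧
    ∀ (e : G.Dart) (z : X) (r : ℕ), l2norm μ (fun x => ∑ j ∈ Finset.range r,
      (1 / (r : ℝ) - compatCoeff μ M φ e j z) * φ e j x) ≤ D := by
  obtain ⟨c, B, hc0, hB0, hB⟩ := h.exists_normCompat_bounds
  refine ⟨Real.sqrt (2 + 2 * (B ^ 2 * μ.real Set.univ)), by positivity, fun e z r => ?_⟩
  refine Real.sqrt_le_sqrt ?_
  rw [(h.orthonormalSeq e).integral_sum_sq]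
  have h1 : ∀ j ∈ Finset.range r, (1 / (r : ℝ) - compatCoeff μ M φ e j z) ^ 2 ≤
      2 * (1 / (r : ℝ)) ^ 2 + 2 * compatCoeff μ M φ e j z ^ 2 := by
    intro j _
    nlinarith [sq_nonneg (1 / (r : ℝ) + compatCoeff μ M φ e j z)]
  refine (Finset.sum_le_sum h1).trans ?_
  rw [Finset.sum_add_distrib, ← Finset.mul_sum, ← Finset.mul_sum]
  have h2 : ∑ j ∈ Finset.range r, (1 / (r : ℝ)) ^ 2 ≤ 1 := by
    simp only [Finset.sum_const, Finset.card_range, nsmul_eq_mul]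
    rcases Nat.eq_zero_or_pos r with h0 | h0
    · simp [h0]
    · have : (1 : ℝ) ≤ r := by exact_mod_cast h0
      rw [one_div, sq, ← mul_assoc, mul_inv_cancel₀ (by linarith), one_mul]
      exact inv_le_one_of_one_le₀ this
  have h3 : ∑ j ∈ Finset.range r, compatCoeff μ M φ e j z ^ 2 ≤ B ^ 2 * μ.real Set.univ := by
    refine ((h.orthonormalSeq e).sum_coef_sq_le (h.memLp_normCompat e z) _).trans ?_
    have h4 := l2norm_le_of_abs_le (μ := μ) (f := fun x => normCompat μ M e x z) hB0.le fun x => by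
      rw [abs_of_pos (hc0.trans_le (hB e x z).1)]
      exact (hB e x z).2
    have h5 := pow_le_pow_left₀ (l2norm_nonneg _) h4 2
    rwa [l2norm_sq, mul_pow, Real.sq_sqrt h.mass_pos.le] at h5
  linarith

/-- Two sources of error: the forgotten initial values, which decay in t, and the truncation, which
is governed by δ. -/
theorem message_sub_fullMessage (h : IsRegular μ M lam φ) (r : ℕ) (z : X)
    (y : ℕ → G.Dart → Fin k → X) (t : ℕ) (e : G.Dart) (x : X) :
    message φ (coeffs μ M φ γ r k y t) e x - fullMessage μ M γ k z y t e x =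
      (∏ s ∈ Finset.range t, (1 - stepSize γ s)) * (∑ j ∈ Finset.range r,
        (1 / (r : ℝ) - compatCoeff μ M φ e j z) * φ e j x) -
      resid μ (φ e) r (fullMessage μ M γ k z y t e) x := by
  unfold message resid
  rw [Finset.sum_range, Finset.sum_range, Finset.mul_sum]
  have h1 : ∀ j : Fin r, coeffs μ M φ γ r k y t e j * φ e j x =
      (∏ s ∈ Finset.range t, (1 - stepSize γ s)) *
        ((1 / (r : ℝ) - compatCoeff μ M φ e j z) * φ e j x) +
      coef μ (φ e) (fullMessage μ M γ k z y t e) j * φ e j x := by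
    intro j
    have := h.coeffs_sub_coef_fullMessage (γ := γ) r z y t e j
    rw [← mul_assoc, ← this]
    ring
  rw [Finset.sum_congr rfl fun j _ => h1 j, Finset.sum_add_distrib]
  ring

theorem exists_l2norm_message_sub_fullMessage_le (h : IsRegular μ M lam φ) (hγ : 0 < γ)
    (hk : 0 < k) : ∃ C : ℝ, 0 < C ∧ ∀ δ : ℝ, 0 < δ →
      ∀ (z : X) (y : ℕ → G.Dart → Fin k → X) (t : ℕ) (e : G.Dart),
      l2norm μ (fun x => message φ (coeffs μ M φ γ (criticalDim lam δ) k y t) e x -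
        fullMessage μ M γ k z y t e x) ≤ C * (Real.sqrt δ + decay γ t) := by
  obtain ⟨D, hD0, hD⟩ := h.exists_l2norm_initial_le
  obtain ⟨E, hE0, hE⟩ := exists_abs_prod_le_decay hγ
  obtain ⟨B, hB0, hB⟩ := h.exists_l2norm_resid_fullMessage_le (γ := γ) hγ hk
  refine ⟨max B (E * D), lt_max_of_lt_left hB0, fun δ hδ z y t e => ?_⟩
  set r := criticalDim lam δ
  have hs := (h.orthonormalSeq e).memLp_sum (Finset.range r)
    fun j => 1 / (r : ℝ) - compatCoeff μ M φ e j z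
  have hf : MemLp (fullMessage μ M γ k z y t e) 2 μ :=
    memLp_of_continuous (h.continuous_fullMessage z y t e) 2
  simp only [h.message_sub_fullMessage]
  refine (l2norm_sub_le (hs.const_mul _) ((h.orthonormalSeq e).memLp_resid hf r)).trans ?_
  rw [l2norm_const_mul]
  have h1 : |∏ s ∈ Finset.range t, (1 - stepSize γ s)| * l2norm μ (fun x =>
      ∑ j ∈ Finset.range r, (1 / (r : ℝ) - compatCoeff μ M φ e j z) * φ e j x) ≤
      E * decay γ t * D :=
    mul_le_mul (hE t) (hD e z r) (l2norm_nonneg _)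
      (mul_nonneg hE0.le (decay_pos γ t).le)
  have h2 : B * Real.sqrt (lam r) ≤ B * Real.sqrt δ :=
    mul_le_mul_of_nonneg_left (Real.sqrt_le_sqrt (h.lam_criticalDim_le e hδ)) hB0.le
  have h3 := hB z y t e r
  have h4 : B * Real.sqrt δ ≤ max B (E * D) * Real.sqrt δ :=
    mul_le_mul_of_nonneg_right (le_max_left _ _) (Real.sqrt_nonneg _)
  have h5 : E * D * decay γ t ≤ max B (E * D) * decay γ t :=
    mul_le_mul_of_nonneg_right (le_max_right _ _) (decay_pos γ t).le
  linarith

/-- The untruncated iterate has integral exactly 1. Cauchy–Schwarz is used only for the initial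
part; for the truncation it would lose the arbitrary factor ε. -/
theorem exists_eventually_abs_integral_message_sub_one_le (h : IsRegular μ M lam φ) (hγ : 0 < γ)
    (hk : 0 < k) (z : X) : ∃ C : ℝ, 0 < C ∧ ∀ ε : ℝ, 0 < ε →
      ∀ᶠ δ in nhdsWithin (0 : ℝ) (Set.Ioi 0),
        ∀ (y : ℕ → G.Dart → Fin k → X) (t : ℕ) (e : G.Dart),
        |∫ x, message φ (coeffs μ M φ γ (criticalDim lam δ) k y t) e x ∂μ - 1| ≤
          ε * Real.sqrt δ + C * decay γ t := by
  obtain ⟨D, hD0, hD⟩ := h.exists_l2norm_initial_le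
  obtain ⟨E, hE0, hE⟩ := exists_abs_prod_le_decay hγ
  have hm := h.mass_pos
  refine ⟨E * (Real.sqrt (μ.real Set.univ) * D), by positivity, fun ε hε => ?_⟩
  filter_upwards [h.eventually_abs_integral_resid_fullMessage_le (γ := γ) hγ hk hε]
    with δ hδ y t e
  set r := criticalDim lam δ
  have hs := (h.orthonormalSeq e).memLp_sum (μ := μ) (Finset.range r)
    fun j => 1 / (r : ℝ) - compatCoeff μ M φ e j z
  have hf : MemLp (fullMessage μ M γ k z y t e) 2 μ :=
    memLp_of_continuous (h.continuous_fullMessage z y t e) 2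
  have hr := ((h.orthonormalSeq e).memLp_resid hf r).integrable (by norm_num)
  have h1 : ∫ x, message φ (coeffs μ M φ γ r k y t) e x ∂μ - 1 =
      (∏ s ∈ Finset.range t, (1 - stepSize γ s)) * (∫ x, ∑ j ∈ Finset.range r,
        (1 / (r : ℝ) - compatCoeff μ M φ e j z) * φ e j x ∂μ) -
      ∫ x, resid μ (φ e) r (fullMessage μ M γ k z y t e) x ∂μ := by
    have h0 : ∫ x, message φ (coeffs μ M φ γ r k y t) e x - fullMessage μ M γ k z y t e x ∂μ =
        ∫ x, message φ (coeffs μ M φ γ r k y t) e x ∂μ - 1 := by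
      rw [integral_sub (integrable_of_continuous (h.continuous_message _ e))
        (hf.integrable (by norm_num)), h.integral_fullMessage hγ hk z y t e]
    rw [← integral_const_mul, ← integral_sub ((hs.integrable (by norm_num)).const_mul _) hr, ← h0]
    simp only [h.message_sub_fullMessage]
  rw [h1]
  refine (abs_sub _ _).trans ?_
  rw [abs_mul, add_comm]
  refine add_le_add (hδ z y t e) ?_
  have h2 := (abs_integral_le_l2norm hs).trans
    (mul_le_mul_of_nonneg_left (hD e z r) (Real.sqrt_nonneg _))
  have h3 := mul_le_mul (hE t) h2 (abs_nonneg _) (mul_nonneg hE0.le (decay_pos γ t).le)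
  linarith

/-- The positive part adds mass only where the message is negative, and there it is at distance at
least c from the untruncated iterate. The added mass is therefore at most 1/c times the squared
distance, of order δ + `decay γ t`². -/
theorem exists_eventually_abs_integral_posMessage_sub_one_le (h : IsRegular μ M lam φ)
    (hγ : 0 < γ) (hk : 0 < k) (z : X) : ∃ (C : ℝ) (t₀ : ℕ), 0 < C ∧ ∀ ε : ℝ, 0 < ε →
      ∀ᶠ δ in nhdsWithin (0 : ℝ) (Set.Ioi 0),
        ∀ (y : ℕ → G.Dart → Fin k → X) (t : ℕ), t₀ ≤ t → ∀ e : G.Dart,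
        |∫ x, posMessage φ (coeffs μ M φ γ (criticalDim lam δ) k y t) e x ∂μ - 1| ≤
          ε * Real.sqrt δ + C * decay γ t := by
  obtain ⟨C, hC0, hC⟩ := h.exists_l2norm_message_sub_fullMessage_le (γ := γ) hγ hk
  obtain ⟨D, hD0, hD⟩ :=
    h.exists_eventually_abs_integral_message_sub_one_le (γ := γ) hγ hk z
  obtain ⟨c, t₀, hc0, hc⟩ := h.exists_le_fullMessage (γ := γ) hγ hk
  refine ⟨D + 2 * C ^ 2 / c, t₀, by positivity, fun ε hε => ?_⟩
  -- For such δ the quadratic term 2C²δ/c is at most (ε/2)√δ; the other half of ε serves the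
  -- integral of the message itself.
  have hd : 0 < (ε / 2 * c / (2 * C ^ 2)) ^ 2 := by positivity
  filter_upwards [hD (ε / 2) (by positivity), eventually_lt_nhdsGT hd] with δ h1 ⟨hδ0, hδ⟩ y t ht e
  set a := coeffs μ M φ γ (criticalDim lam δ) k y t
  set g := fullMessage μ M γ k z y t e
  have hsq : Real.sqrt δ ≤ ε / 2 * c / (2 * C ^ 2) := Real.sqrt_le_iff.2 ⟨by positivity, hδ.le⟩
  have hcm := h.continuous_message a e
  have hcg := h.continuous_fullMessage (γ := γ) z y t e
  have hpt : ∀ x, 0 ≤ posMessage φ a e x - message φ a e x ∧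
      posMessage φ a e x - message φ a e x ≤ 1 / c * (message φ a e x - g x) ^ 2 := by
    intro x
    have hg := hc z y t ht e x
    unfold posMessage
    rcases le_total 0 (message φ a e x) with h0 | h0
    · rw [max_eq_right h0, sub_self]
      exact ⟨le_rfl, by positivity⟩
    · rw [max_eq_left h0]
      refine ⟨by linarith, ?_⟩
      rw [one_div, inv_mul_eq_div, le_div_iff₀ hc0]
      change c ≤ g x at hg
      nlinarith
  have i1 : Integrable (posMessage φ a e) μ := integrable_of_continuous (h.continuous_posMessage a e)
  have i2 : Integrable (message φ a e) μ := integrable_of_continuous hcm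
  have i3 : Integrable (fun x => 1 / c * (message φ a e x - g x) ^ 2) μ :=
    integrable_of_continuous (continuous_const.mul ((hcm.sub hcg).pow 2))
  have h2 : 0 ≤ ∫ x, posMessage φ a e x - message φ a e x ∂μ :=
    integral_nonneg fun x => (hpt x).1
  have h3 : ∫ x, posMessage φ a e x - message φ a e x ∂μ ≤
      1 / c * (C * (Real.sqrt δ + decay γ t)) ^ 2 := by
    refine (integral_mono (i1.sub i2) i3 fun x => (hpt x).2).trans ?_
    rw [integral_const_mul, ← l2norm_sq]
    exact mul_le_mul_of_nonneg_left (pow_le_pow_left₀ (l2norm_nonneg _) (hC δ hδ0 z y t e) 2)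
      (by positivity)
  rw [integral_sub i1 i2] at h2 h3
  have h4 := h1 y t e
  have hdec := decay_pos γ t
  have hdec1 := decay_le_one hγ t
  have hs0 := Real.sqrt_nonneg δ
  have h5 : 1 / c * (C * (Real.sqrt δ + decay γ t)) ^ 2 ≤
      2 * C ^ 2 / c * (Real.sqrt δ * Real.sqrt δ) + 2 * C ^ 2 / c * decay γ t := by
    have h6 : (Real.sqrt δ + decay γ t) ^ 2 ≤ 2 * (Real.sqrt δ * Real.sqrt δ) + 2 * decay γ t := by
      nlinarith [sq_nonneg (Real.sqrt δ - decay γ t)]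
    have h7 : 0 ≤ C ^ 2 / c := by positivity
    calc 1 / c * (C * (Real.sqrt δ + decay γ t)) ^ 2
        = C ^ 2 / c * (Real.sqrt δ + decay γ t) ^ 2 := by ring
      _ ≤ C ^ 2 / c * (2 * (Real.sqrt δ * Real.sqrt δ) + 2 * decay γ t) :=
          mul_le_mul_of_nonneg_left h6 h7
      _ = _ := by ring
  have h8 : 2 * C ^ 2 / c * (Real.sqrt δ * Real.sqrt δ) ≤ ε / 2 * Real.sqrt δ := by
    rw [← mul_assoc]
    refine mul_le_mul_of_nonneg_right ?_ hs0
    calc 2 * C ^ 2 / c * Real.sqrt δ ≤ 2 * C ^ 2 / c * (ε / 2 * c / (2 * C ^ 2)) :=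
          mul_le_mul_of_nonneg_left hsq (by positivity)
      _ = ε / 2 := by field_simp
  rw [abs_le] at h4 ⊢
  constructor
  · have : 0 ≤ 2 * C ^ 2 / c * decay γ t := by positivity
    have : 0 ≤ ε / 2 * Real.sqrt δ := by positivity
    linarith [h4.1]
  · linarith [h4.2]

/-- If the weight vanished almost everywhere, then at almost every point some incoming message would
be at most 0 and so at distance at least c from its untruncated counterpart. Summed over all edges,
the squared L² distances would be at least c² times the total mass, too much for small δ and late t.
Hence late samples always have a well-defined law. -/
theorem exists_eventually_sampleWeight_pos (h : IsRegular μ M lam φ)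
    (hγ : 0 < γ) (hk : 0 < k) (z : X) : ∃ t₀ : ℕ,
      ∀ᶠ δ in nhdsWithin (0 : ℝ) (Set.Ioi 0),
        ∀ (y : ℕ → G.Dart → Fin k → X) (t : ℕ), t₀ ≤ t → ∀ e : G.Dart,
        0 < ∫ x, sampleWeight μ M φ (coeffs μ M φ γ (criticalDim lam δ) k y t) e x ∂μ := by
  obtain ⟨C, hC0, hC⟩ := h.exists_l2norm_message_sub_fullMessage_le (γ := γ) hγ hk
  obtain ⟨c, t₀, hc0, hc⟩ := h.exists_le_fullMessage (γ := γ) hγ hk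
  have hm := h.mass_pos
  let N : ℝ := (Fintype.card G.Dart : ℝ)
  have hN0 : 0 ≤ N := Nat.cast_nonneg _
  -- A common bound s for √δ and `decay γ t` that contradicts the lower bound on the summed squared
  -- distances.
  obtain ⟨s, hs0, hs⟩ : ∃ s : ℝ, 0 < s ∧ N * (C * (s + s)) ^ 2 < c ^ 2 * μ.real Set.univ := by
    have hcont : Continuous fun s : ℝ => N * (C * (s + s)) ^ 2 := by fun_prop
    have hlim := hcont.tendsto 0
    simp only [add_zero, mul_zero, ne_eq, OfNat.ofNat_ne_zero, not_false_eq_true, zero_pow] at hlim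
    have hev := hlim.eventually (gt_mem_nhds (show 0 < c ^ 2 * μ.real Set.univ by positivity))
    obtain ⟨s, h1, h2⟩ := ((hev.filter_mono nhdsWithin_le_nhds).and
      (self_mem_nhdsWithin : Set.Ioi (0 : ℝ) ∈ nhdsWithin 0 (Set.Ioi 0))).exists
    exact ⟨s, h2, h1⟩
  obtain ⟨t₁, ht₁⟩ := Filter.eventually_atTop.1 ((tendsto_decay hγ).eventually (gt_mem_nhds hs0))
  refine ⟨max t₀ t₁, ?_⟩
  filter_upwards [eventually_lt_nhdsGT (pow_pos hs0 2)] with δ ⟨hδ0, hδ⟩ y t ht e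
  have ht0 := (le_max_left _ _).trans ht
  have ht1 := (ht₁ t ((le_max_right _ _).trans ht)).le
  have hsq : Real.sqrt δ ≤ s := Real.sqrt_le_iff.2 ⟨hs0.le, hδ.le⟩
  set a := coeffs μ M φ γ (criticalDim lam δ) k y t
  have hw0 := h.sampleWeight_nonneg a e
  refine (integral_nonneg hw0).lt_of_ne fun hzero => ?_
  have hae := (integral_eq_zero_iff_of_nonneg hw0
    (integrable_of_continuous (h.continuous_sampleWeight a e))).1 hzero.symm
  let f : G.Dart → X → ℝ := fun d x => (message φ a d x - fullMessage μ M γ k z y t d x) ^ 2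
  have hf : ∀ d, Integrable (f d) μ := fun d => integrable_of_continuous
    (((h.continuous_message a d).sub (h.continuous_fullMessage z y t d)).pow 2)
  have h1 : ∀ᵐ x ∂μ, c ^ 2 ≤ ∑ d, f d x := by
    filter_upwards [hae] with x hx
    have h2 : ∏ d ∈ incoming e, posMessage φ a d x = 0 := by
      rcases mul_eq_zero.1 hx with h3 | h3
      · exact absurd h3 (h.betaFun_pos e x).ne'
      · exact h3
    obtain ⟨d, _, hd⟩ := Finset.prod_eq_zero_iff.1 h2
    have h3 : message φ a d x ≤ 0 := by
      have : message φ a d x ≤ posMessage φ a d x := le_max_right _ _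
      linarith
    have h4 := hc z y t ht0 d x
    have h5 : c ^ 2 ≤ f d x := by
      simp only [f]
      nlinarith
    exact h5.trans (Finset.single_le_sum (f := fun d => f d x) (fun d _ => sq_nonneg _)
      (Finset.mem_univ d))
  have h2 := integral_mono_ae (integrable_const (μ := μ) (c ^ 2))
    (integrable_finsetSum _ fun d _ => hf d) h1
  rw [integral_const, smul_eq_mul, integral_finsetSum _ fun d _ => hf d] at h2
  have h3 : ∀ d ∈ Finset.univ, ∫ x, f d x ∂μ ≤ (C * (s + s)) ^ 2 := by
    intro d _
    rw [← l2norm_sq]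
    refine pow_le_pow_left₀ (l2norm_nonneg _) ((hC δ hδ0 z y t d).trans ?_) 2
    exact mul_le_mul_of_nonneg_left (add_le_add hsq ht1) hC0.le
  have h4 := Finset.sum_le_card_nsmul _ _ _ h3
  rw [nsmul_eq_mul, Finset.card_univ] at h4
  have h5 : N * (C * (s + s)) ^ 2 = (Fintype.card G.Dart : ℝ) * (C * (s + s)) ^ 2 := rfl
  linarith [mul_comm (c ^ 2) (μ.real Set.univ)]

theorem exists_l2norm_message_le (h : IsRegular μ M lam φ) (hγ : 0 < γ)
    (hk : 0 < k) (z : X) : ∃ D : ℝ, 0 < D ∧ ∀ δ : ℝ, 0 < δ → δ < 1 →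
      ∀ (y : ℕ → G.Dart → Fin k → X) (t : ℕ) (e : G.Dart),
      l2norm μ (message φ (coeffs μ M φ γ (criticalDim lam δ) k y t) e) ≤ D := by
  obtain ⟨C, hC0, hC⟩ := h.exists_l2norm_message_sub_fullMessage_le (γ := γ) hγ hk
  obtain ⟨B, hB0, hB⟩ := h.exists_abs_fullMessage_le (γ := γ) hγ hk
  have hm := h.mass_pos
  refine ⟨C * (1 + 1) + B * Real.sqrt (μ.real Set.univ), by positivity,
    fun δ hδ0 hδ1 y t e => ?_⟩
  set a := coeffs μ M φ γ (criticalDim lam δ) k y t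
  have hcm : MemLp (message φ a e) 2 μ := memLp_of_continuous (h.continuous_message a e) 2
  have hcg : MemLp (fullMessage μ M γ k z y t e) 2 μ :=
    memLp_of_continuous (h.continuous_fullMessage (γ := γ) z y t e) 2
  have h1 := l2norm_add_le (hcm.sub hcg) hcg
  simp only [Pi.sub_apply, sub_add_cancel] at h1
  refine h1.trans (add_le_add ((hC δ hδ0 z y t e).trans ?_) (l2norm_le_of_abs_le hB0.le (hB z y t e)))
  refine mul_le_mul_of_nonneg_left (add_le_add ?_ (decay_le_one hγ t)) hC0.le
  exact Real.sqrt_le_one.2 hδ1.le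

end IsRegular

end Positivity

/-! ## The fixed point and the contraction -/

section FixedPoint

variable {V : Type*} [Fintype V] [DecidableEq V] {G : SimpleGraph V} [DecidableRel G.Adj]
variable {X : Type*} [MetricSpace X] [CompactSpace X] [MeasurableSpace X] [BorelSpace X]
variable {μ : Measure X} [IsFiniteMeasure μ] {M : PairwiseMRF G X} {lam : ℕ → ℝ}
  {φ : G.Dart → ℕ → X → ℝ} {γ : ℝ} {k : ℕ}

/-- The squared distance of the coefficients `a` on the edge `e` from those of `m`. -/
noncomputable def sqErr (μ : Measure X) (φ : G.Dart → ℕ → X → ℝ) (m : G.Dart → X → ℝ) {r : ℕ}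
    (a : G.Dart → Fin r → ℝ) (e : G.Dart) : ℝ :=
  ∑ j, (a e j - coef μ (φ e) (m e) j) ^ 2

theorem sqErr_nonneg (m : G.Dart → X → ℝ) {r : ℕ} (a : G.Dart → Fin r → ℝ) (e : G.Dart) :
    0 ≤ sqErr μ φ m a e := Finset.sum_nonneg fun _ _ => sq_nonneg _

theorem coef_congr {ψ : ℕ → X → ℝ} {f g : X → ℝ} (h : f =ᵐ[μ] g) (j : ℕ) :
    coef μ ψ f j = coef μ ψ g j := by
  refine integral_congr_ae ?_
  filter_upwards [h] with x hx
  rw [hx]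

theorem resid_congr {ψ : ℕ → X → ℝ} {f g : X → ℝ} (h : f =ᵐ[μ] g) (r : ℕ) :
    resid μ ψ r f =ᵐ[μ] resid μ ψ r g := by
  filter_upwards [h] with x hx
  unfold resid
  simp only [hx, coef_congr h]

theorem integral_kernel_mul_continuous {κ : X → X → ℝ} (hκ : Continuous (Function.uncurry κ))
    {g : X → ℝ} (hg : Integrable g μ) : Continuous fun x => ∫ y, κ x y * g y ∂μ := by
  obtain ⟨C, _, hC⟩ := exists_kernel_bound hκ
  refine continuous_of_dominated (bound := fun y => C * ‖g y‖)
    (fun x => (integrable_kernel_mul hκ hg x).aestronglyMeasurable)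
    (fun x => Filter.Eventually.of_forall fun y => ?_) (hg.norm.const_mul C)
    (Filter.Eventually.of_forall fun y => ?_)
  · rw [norm_mul]
    exact mul_le_mul_of_nonneg_right (hC x y) (norm_nonneg _)
  · exact (hκ.comp (Continuous.prodMk_left y)).mul continuous_const

theorem ae_bounded_prod {ι : Type*} (s : Finset ι) {f : ι → X → ℝ}
    (h : ∀ i ∈ s, ∃ C, ∀ᵐ x ∂μ, ‖f i x‖ ≤ C) : ∃ C, ∀ᵐ x ∂μ, ‖∏ i ∈ s, f i x‖ ≤ C := by
  classical
  induction s using Finset.induction_on with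
  | empty => exact ⟨1, by simp⟩
  | insert a s ha ih =>
    obtain ⟨C, hC⟩ := h a (Finset.mem_insert_self _ _)
    obtain ⟨D, hD⟩ := ih fun i hi => h i (Finset.mem_insert_of_mem hi)
    refine ⟨C * D, ?_⟩
    filter_upwards [hC, hD] with x h1 h2
    rw [Finset.prod_insert ha, norm_mul]
    exact mul_le_mul h1 h2 (norm_nonneg _) ((norm_nonneg _).trans h1)

namespace IsRegular

theorem memLp_bpUpdate (h : IsRegular μ M lam φ) {e : G.Dart} {m : G.Dart → X → ℝ}
    (hm : BPDefined μ M e m) : MemLp (bpUpdate μ M e m) 2 μ :=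
  memLp_of_continuous (continuous_const.mul
    (integral_kernel_mul_continuous (h.edge e) hm.1)) 2

/-- A fixed point agrees almost everywhere with its update, which is continuous on a compact space.
This makes products of several messages square integrable. -/
theorem ae_bounded_fixedPoint (h : IsRegular μ M lam φ) {m : G.Dart → X → ℝ}
    (hm : IsBPFixedPoint μ M m) (e : G.Dart) : ∃ C, ∀ᵐ x ∂μ, ‖m e x‖ ≤ C := by
  obtain ⟨C, _, hC⟩ := exists_bound_of_continuous (continuous_const.mul
    (integral_kernel_mul_continuous (h.edge e) (hm e).2.1.1) : Continuous (bpUpdate μ M e m))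
  refine ⟨C, ?_⟩
  filter_upwards [(hm e).2.2] with x hx
  rw [← hx]
  exact hC x

theorem memLp_nodeProduct_fixedPoint (h : IsRegular μ M lam φ) {m : G.Dart → X → ℝ}
    (hm : IsBPFixedPoint μ M m) (e : G.Dart) : MemLp (nodeProduct M e m) 2 μ := by
  obtain ⟨C, _, hC⟩ := exists_bound_of_continuous (h.node e.fst)
  obtain ⟨D, hD⟩ := ae_bounded_prod (μ := μ) (incoming e) (f := m)
    fun d _ => h.ae_bounded_fixedPoint hm d
  refine MemLp.of_bound (hm e).2.1.1.aestronglyMeasurable (C * D) ?_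
  filter_upwards [hD] with x hx
  unfold nodeProduct
  rw [norm_mul]
  exact mul_le_mul (hC x) hx (norm_nonneg _) ((abs_nonneg _).trans (hC x))

/-- The fixed point is the integral operator applied to a square-integrable function, so its tail is
O(δ), while that of a general iterate is only O(√δ). -/
theorem exists_l2norm_resid_fixedPoint_le (h : IsRegular μ M lam φ) {m : G.Dart → X → ℝ}
    (hm : IsBPFixedPoint μ M m) : ∃ D : ℝ, 0 < D ∧ ∀ δ : ℝ, 0 < δ → ∀ e : G.Dart,
      l2norm μ (resid μ (φ e) (criticalDim lam δ) (m e)) ≤ D * δ := by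
  have key : ∀ e : G.Dart, ∃ D : ℝ, ∀ δ : ℝ, 0 < δ →
      l2norm μ (resid μ (φ e) (criticalDim lam δ) (m e)) ≤ D * δ := by
    intro e
    set s := (∫ x', bpIntegral μ M e m x' ∂μ)⁻¹ with hs
    let g : X → ℝ := fun y => s * nodeProduct M e m y
    have hg : MemLp g 2 μ := (h.memLp_nodeProduct_fixedPoint hm e).const_mul s
    have hu : m e =ᵐ[μ] fun x => ∫ y, M.edgePot e.snd e.fst x y * g y ∂μ := by
      filter_upwards [(hm e).2.2] with x hx
      rw [← hx, bpUpdate, bpIntegral, ← integral_const_mul]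
      congr 1 with y
      simp only [g]
      ring
    refine ⟨l2norm μ g, fun δ hδ => ?_⟩
    rw [l2norm_congr (resid_congr hu _)]
    have hum : MemLp (fun x => ∫ y, M.edgePot e.snd e.fst x y * g y ∂μ) 2 μ :=
      memLp_of_continuous
        (integral_kernel_mul_continuous (h.edge e) (hg.integrable (by norm_num))) 2
    have h1 := (h.eig e).resid_integral_sq_le (h.psd e) (h.edge e) (h.lam_nonneg e) hg hum
      (criticalDim lam δ)
    have h2 := Real.sqrt_le_sqrt h1
    rw [Real.sqrt_mul (sq_nonneg _), Real.sqrt_sq (h.lam_nonneg e _)] at h2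
    refine h2.trans ?_
    rw [mul_comm]
    exact mul_le_mul_of_nonneg_left (h.lam_criticalDim_le e hδ) (l2norm_nonneg _)
  choose D hD using key
  obtain ⟨E, hE⟩ := Finite.exists_le D
  refine ⟨max E 1, lt_max_of_lt_right one_pos, fun δ hδ e => (hD e δ hδ).trans ?_⟩
  exact mul_le_mul_of_nonneg_right ((hE e).trans (le_max_left _ _)) hδ.le

theorem l2norm_sum_fin (h : IsRegular μ M lam φ) (e : G.Dart) {r : ℕ} (a : Fin r → ℝ) :
    l2norm μ (fun x => ∑ j, a j * φ e j x) = Real.sqrt (∑ j, a j ^ 2) := by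
  let b : ℕ → ℝ := fun j => if hj : j < r then a ⟨j, hj⟩ else 0
  have hb : ∀ j : Fin r, b j = a j := fun j => by simp [b]
  have h1 := (h.orthonormalSeq e).integral_sum_sq (Finset.range r) b
  simp only [Finset.sum_range, hb] at h1
  rw [l2norm, h1]

theorem l2norm_message_sub_le (h : IsRegular μ M lam φ) {m : G.Dart → X → ℝ} {e : G.Dart}
    (hm : MemLp (m e) 2 μ) {r : ℕ} (a : G.Dart → Fin r → ℝ) :
    l2norm μ (fun x => message φ a e x - m e x) ≤
      Real.sqrt (sqErr μ φ m a e) + l2norm μ (resid μ (φ e) r (m e)) := by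
  have h1 : (fun x => message φ a e x - m e x) = fun x =>
      (∑ j : Fin r, (a e j - coef μ (φ e) (m e) j) * φ e j x) - resid μ (φ e) r (m e) x := by
    funext x
    unfold message resid
    rw [Finset.sum_range]
    simp only [sub_mul, Finset.sum_sub_distrib]
    ring
  rw [h1]
  have hc : Continuous fun x => ∑ j : Fin r, (a e j - coef μ (φ e) (m e) j) * φ e j x :=
    continuous_finsetSum _ fun j _ => continuous_const.mul ((h.eig e).continuous j)
  refine (l2norm_sub_le (memLp_of_continuous hc 2)
    ((h.orthonormalSeq e).memLp_resid hm r)).trans ?_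
  rw [h.l2norm_sum_fin]
  exact le_rfl

/-- The coefficients of the update of the normalised messages are the means of the pre-computed
functions under the sampling distribution. -/
theorem integral_compatCoeff_mul_sampleDensity (h : IsRegular μ M lam φ) {r : ℕ}
    (a : G.Dart → Fin r → ℝ) (e : G.Dart) {n : G.Dart → X → ℝ}
    (hn : n = fun e x => posMessage φ a e x / ∫ z, posMessage φ a e z ∂μ)
    (hZ : ∀ e, 0 < ∫ x, posMessage φ a e x ∂μ)
    (hw : 0 < ∫ x, sampleWeight μ M φ a e x ∂μ) :
    BPDefined μ M e n ∧ ∀ j, ∫ y, compatCoeff μ M φ e j y *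
      (sampleWeight μ M φ a e y / ∫ z, sampleWeight μ M φ a e z ∂μ) ∂μ =
        coef μ (φ e) (bpUpdate μ M e n) j := by
  set W := ∫ z, sampleWeight μ M φ a e z ∂μ with hW
  let ν : X → ℝ := fun y => M.nodePot e.fst y * ∏ d ∈ incoming e, posMessage φ a d y
  have hνc : Continuous ν := (h.node e.fst).mul
    (continuous_finsetProd _ fun d _ => h.continuous_posMessage a d)
  have hνi : Integrable ν μ := integrable_of_continuous hνc
  have hν0 : ∀ y, 0 ≤ ν y := fun y => mul_nonneg (M.nodePot_pos _ _).le
    (Finset.prod_nonneg fun _ _ => le_max_left _ _)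
  have hwν : ∀ y, sampleWeight μ M φ a e y = edgeMass μ M e y * ν y := by
    intro y
    simp only [sampleWeight, betaFun, edgeMass, ν]
    ring
  set p := ∏ d ∈ incoming e, (∫ z, posMessage φ a d z ∂μ)⁻¹ with hp
  have hp0 : 0 < p := Finset.prod_pos fun d _ => inv_pos.2 (hZ d)
  have hnode : ∀ y, nodeProduct M e n y = p * ν y := by
    intro y
    simp only [nodeProduct, hn, ν, div_eq_mul_inv, Finset.prod_mul_distrib, hp]
    ring
  have hbp : ∀ x, bpIntegral μ M e n x =
      p * ∫ y, M.edgePot e.snd e.fst x y * ν y ∂μ := by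
    intro x
    unfold bpIntegral
    rw [← integral_const_mul]
    congr 1 with y
    rw [hnode]
    ring
  -- By Fubini the normalising constants of the update and of the sampling density agree: β contains
  -- the integral of the edge potential over x.
  have hW2 : ∫ x, ∫ y, M.edgePot e.snd e.fst x y * ν y ∂μ ∂μ = W := by
    have h1 := integral_quadratic_swap (h.edge e) (integrable_const (μ := μ) (1 : ℝ)) hνi
    simp only [one_mul] at h1
    rw [h1, hW]
    simp only [hwν]
    rfl
  -- The normalising constants p of the incoming messages cancel, because the update is homogeneous
  -- of degree 0.
  have hup : ∀ x, bpUpdate μ M e n x = W⁻¹ * ∫ y, M.edgePot e.snd e.fst x y * ν y ∂μ := by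
    intro x
    unfold bpUpdate
    simp only [hbp, integral_const_mul]
    rw [hW2]
    field_simp
  refine ⟨⟨?_, ?_⟩, fun j => ?_⟩
  · simp only [funext hnode]
    exact hνi.const_mul p
  · simp only [hnode, integral_const_mul]
    refine mul_pos hp0 ((integral_nonneg hν0).lt_of_ne fun hzero => ?_)
    have hae := (integral_eq_zero_iff_of_nonneg hν0 hνi).1 hzero.symm
    have : W = 0 := by
      rw [hW, integral_eq_zero_of_ae]
      filter_upwards [hae] with y hy
      rw [hwν, hy]
      simp
    exact hw.ne' this
  · have h1 : coef μ (φ e) (bpUpdate μ M e n) j =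
        W⁻¹ * coef μ (φ e) (fun x => ∫ y, M.edgePot e.snd e.fst x y * ν y ∂μ) j := by
      unfold coef
      rw [← integral_const_mul]
      congr 1 with x
      rw [hup]
      ring
    rw [h1, (h.eig e).coef_integral (h.psd e) (h.edge e) hνi, ← integral_const_mul,
      ← integral_const_mul]
    congr 1 with y
    have := (h.edgeMass_pos e y).ne'
    rw [h.compatCoeff_eq, hwν]
    field_simp

/-- Both vectors of means are coefficients of BP updates, of n and of the fixed point. Their inner
product with the coefficient error is an L² inner product, to which Cauchy–Schwarz and the
contraction apply. -/
theorem inner_error_le (h : IsRegular μ M lam φ) {K : Set (G.Dart → X → ℝ)}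
    (hcontr : IsBPContractive μ M γ K) {m : G.Dart → X → ℝ} (hm : IsBPFixedPoint μ M m)
    (hmK : m ∈ K) {r : ℕ} (a : G.Dart → Fin r → ℝ) (e : G.Dart) {n : G.Dart → X → ℝ}
    (hn : n = fun e x => posMessage φ a e x / ∫ z, posMessage φ a e z ∂μ) (hnK : n ∈ K)
    (hZ : ∀ e, 0 < ∫ x, posMessage φ a e x ∂μ)
    (hw : 0 < ∫ x, sampleWeight μ M φ a e x ∂μ) :
    ∑ j, (a e j - coef μ (φ e) (m e) j) * ((∫ y, compatCoeff μ M φ e j y *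
      (sampleWeight μ M φ a e y / ∫ z, sampleWeight μ M φ a e z ∂μ) ∂μ) -
        coef μ (φ e) (m e) j) ≤ Real.sqrt (sqErr μ φ m a e) * ((1 - γ / 2) *
      Real.sqrt ((1 / ((incoming e).card : ℝ)) *
        ∑ d ∈ incoming e, l2norm μ (fun x => n d x - m d x) ^ 2)) := by
  obtain ⟨hdef, hq⟩ := h.integral_compatCoeff_mul_sampleDensity a e hn hZ hw
  simp only [hq, ← coef_congr (hm e).2.2]
  have hF1 := h.memLp_bpUpdate hdef
  have hF2 := h.memLp_bpUpdate (hm e).2.1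
  have h1 : ∀ j : ℕ, coef μ (φ e) (bpUpdate μ M e n) j - coef μ (φ e) (bpUpdate μ M e m) j =
      coef μ (φ e) (fun x => bpUpdate μ M e n x - bpUpdate μ M e m x) j := by
    intro j
    unfold coef
    rw [← integral_sub (MemLp.integrable_mul_two hF1 ((h.orthonormalSeq e).1 j))
      (MemLp.integrable_mul_two hF2 ((h.orthonormalSeq e).1 j))]
    simp only [sub_mul]
  simp only [h1]
  have hcc : Continuous fun x => ∑ j : Fin r,
      (a e j - coef μ (φ e) (bpUpdate μ M e m) j) * φ e j x :=
    continuous_finsetSum _ fun j _ => continuous_const.mul ((h.eig e).continuous j)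
  have hc := memLp_of_continuous (μ := μ) hcc 2
  have h2 : ∑ j : Fin r, (a e j - coef μ (φ e) (bpUpdate μ M e m) j) *
      coef μ (φ e) (fun x => bpUpdate μ M e n x - bpUpdate μ M e m x) j =
      ∫ x, (∑ j : Fin r, (a e j - coef μ (φ e) (bpUpdate μ M e m) j) * φ e j x) *
        (bpUpdate μ M e n x - bpUpdate μ M e m x) ∂μ := by
    simp only [Finset.sum_mul]
    rw [integral_finsetSum]
    · refine Finset.sum_congr rfl fun j _ => ?_
      unfold coef
      rw [← integral_const_mul]
      congr 1 with x
      ring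
    · intro j _
      exact MemLp.integrable_mul_two (((h.orthonormalSeq e).1 j).const_mul _) (hF1.sub hF2)
  rw [h2]
  refine (le_abs_self _).trans ((abs_integral_mul_le hc (hF1.sub hF2)).trans ?_)
  rw [h.l2norm_sum_fin]
  have h3 : sqErr μ φ m a e =
      ∑ j : Fin r, (a e j - coef μ (φ e) (bpUpdate μ M e m) j) ^ 2 := by
    unfold sqErr
    simp only [coef_congr (hm e).2.2]
  rw [← h3]
  exact mul_le_mul_of_nonneg_left (hcontr n hnK m hmK e hdef (hm e).2.1) (Real.sqrt_nonneg _)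

/-- Taking the positive part cannot increase the distance to a nonnegative function. Dividing by Z,
which is within τ ≤ 1/2 of 1, rescales by 1/Z with |1/Z − 1| ≤ 2τ. -/
theorem l2norm_normalised_sub_le (h : IsRegular μ M lam φ) {m : X → ℝ} (hm : MemLp m 2 μ)
    (hm0 : ∀ x, 0 ≤ m x) {r : ℕ} (a : G.Dart → Fin r → ℝ) (e : G.Dart) {τ : ℝ}
    (hτ : |∫ x, posMessage φ a e x ∂μ - 1| ≤ τ) (hτ2 : τ ≤ 1 / 2) :
    l2norm μ (fun x => posMessage φ a e x / (∫ z, posMessage φ a e z ∂μ) - m x) ≤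
      l2norm μ (fun x => message φ a e x - m x) +
        2 * τ * (l2norm μ (message φ a e) + 2 * l2norm μ m) := by
  set Z := ∫ z, posMessage φ a e z ∂μ
  have hZ : 1 / 2 ≤ Z := by linarith [(abs_le.1 hτ).1]
  have hZ0 : 0 < Z := by linarith
  have hcm : MemLp (message φ a e) 2 μ := memLp_of_continuous (h.continuous_message a e) 2
  have hcp : MemLp (posMessage φ a e) 2 μ := memLp_of_continuous (h.continuous_posMessage a e) 2
  have h1 : l2norm μ (fun x => posMessage φ a e x - m x) ≤
      l2norm μ (fun x => message φ a e x - m x) := by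
    refine l2norm_mono (hcm.sub hm) fun x => ?_
    have hx := hm0 x
    unfold posMessage
    rcases le_total 0 (message φ a e x) with h0 | h0
    · rw [max_eq_right h0]
    · rw [max_eq_left h0, zero_sub, abs_neg, abs_of_nonneg hx, abs_of_nonpos (by linarith)]
      linarith
  have h2 := l2norm_sub_le hcm hm
  have h3 : |1 / Z - 1| ≤ 2 * τ := by
    have : 1 / Z - 1 = -(Z - 1) * (1 / Z) := by
      field_simp
      ring
    rw [this, abs_mul, abs_neg, abs_of_pos (by positivity : 0 < 1 / Z)]
    have h4 : 1 / Z ≤ 2 := by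
      rw [div_le_iff₀ hZ0]
      linarith
    have := abs_nonneg (Z - 1)
    have : 0 < 1 / Z := by positivity
    nlinarith
  have h4 : (fun x => posMessage φ a e x / Z - m x) = fun x =>
      (posMessage φ a e x - m x) + ((1 / Z - 1) * (posMessage φ a e x - m x) +
        (1 / Z - 1) * m x) := by
    funext x
    ring
  have hd : MemLp (fun x => posMessage φ a e x - m x) 2 μ := hcp.sub hm
  rw [h4]
  refine (l2norm_add_le hd ((hd.const_mul _).add (hm.const_mul _))).trans ?_
  have h5 := l2norm_add_le (hd.const_mul (1 / Z - 1)) (hm.const_mul (1 / Z - 1))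
  rw [l2norm_const_mul, l2norm_const_mul] at h5
  have h6 : |1 / Z - 1| * l2norm μ (fun x => posMessage φ a e x - m x) + |1 / Z - 1| * l2norm μ m ≤
      2 * τ * (l2norm μ (message φ a e) + 2 * l2norm μ m) := by
    rw [← mul_add]
    refine mul_le_mul h3 (by linarith) (add_nonneg (l2norm_nonneg _) (l2norm_nonneg _)) ?_
    exact (abs_nonneg _).trans h3
  exact add_le_add h1 (h5.trans h6)

end IsRegular

end FixedPoint

/-! ## The mean square error of one iteration -/

section Error

variable {V : Type*} [Fintype V] [DecidableEq V] {G : SimpleGraph V} [DecidableRel G.Adj]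
variable {X : Type*} [MetricSpace X] [CompactSpace X] [MeasurableSpace X] [BorelSpace X]
variable {μ : Measure X} [IsFiniteMeasure μ] {M : PairwiseMRF G X} {lam : ℕ → ℝ}
  {φ : G.Dart → ℕ → X → ℝ} {γ : ℝ} {k : ℕ}

namespace IsRegular

/-- Pythagoras: the residual is orthogonal to the first r functions. -/
theorem l2norm_message_sub_sq (h : IsRegular μ M lam φ) {m : G.Dart → X → ℝ} {e : G.Dart}
    (hm : MemLp (m e) 2 μ) {r : ℕ} (a : G.Dart → Fin r → ℝ) :
    l2norm μ (fun x => message φ a e x - m e x) ^ 2 =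
      sqErr μ φ m a e + l2norm μ (resid μ (φ e) r (m e)) ^ 2 := by
  let b : ℕ → ℝ := fun j => if hj : j < r then a e ⟨j, hj⟩ - coef μ (φ e) (m e) j else 0
  have hb : ∀ j : Fin r, b j = a e j - coef μ (φ e) (m e) j := fun j => by simp [b]
  set R := resid μ (φ e) r (m e) with hR
  let S : X → ℝ := fun x => ∑ j ∈ Finset.range r, b j * φ e j x
  have hRm : MemLp R 2 μ := (h.orthonormalSeq e).memLp_resid hm r
  have hSm : MemLp S 2 μ := (h.orthonormalSeq e).memLp_sum _ _
  have h1 : ∀ x, message φ a e x - m e x = S x - R x := by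
    intro x
    simp only [S, hR, message, resid, Finset.sum_range, hb, sub_mul, Finset.sum_sub_distrib]
    ring
  have h2 : ∫ x, R x * S x ∂μ = 0 := by
    rw [(h.orthonormalSeq e).integral_mul_sum hRm]
    refine Finset.sum_eq_zero fun j hj => ?_
    rw [(h.orthonormalSeq e).coef_resid hm, if_pos (Finset.mem_range.1 hj), mul_zero]
  have h3 : ∫ x, S x ^ 2 ∂μ = sqErr μ φ m a e := by
    simp only [S]
    rw [(h.orthonormalSeq e).integral_sum_sq, Finset.sum_range]
    simp only [hb]
    rfl
  rw [l2norm_sq, l2norm_sq]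
  have h4 : ∀ x, (message φ a e x - m e x) ^ 2 = (S x ^ 2 + R x ^ 2) - 2 * (R x * S x) := by
    intro x
    rw [h1]
    ring
  simp only [h4]
  have i1 : Integrable (fun x => S x ^ 2 + R x ^ 2) μ := hSm.integrable_sq.add hRm.integrable_sq
  rw [integral_sub i1 ((MemLp.integrable_mul_two hRm hSm).const_mul 2),
    integral_add hSm.integrable_sq hRm.integrable_sq, integral_const_mul, h2, h3]
  ring

theorem sqErr_le (h : IsRegular μ M lam φ) {m : G.Dart → X → ℝ} {e : G.Dart}
    (hm : MemLp (m e) 2 μ) {r : ℕ} (a : G.Dart → Fin r → ℝ) :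
    sqErr μ φ m a e ≤ 2 * l2norm μ (message φ a e) ^ 2 + 2 * l2norm μ (m e) ^ 2 := by
  have h1 : l2norm μ (message φ a e) ^ 2 = ∑ j, a e j ^ 2 := by
    unfold message
    rw [h.l2norm_sum_fin, Real.sq_sqrt (Finset.sum_nonneg fun _ _ => sq_nonneg _)]
  have h2 : ∑ j : Fin r, coef μ (φ e) (m e) j ^ 2 ≤ l2norm μ (m e) ^ 2 := by
    rw [l2norm_sq, ← Finset.sum_range fun j => coef μ (φ e) (m e) j ^ 2]
    exact (h.orthonormalSeq e).sum_coef_sq_le hm _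
  have h3 : sqErr μ φ m a e ≤ ∑ j : Fin r, (2 * a e j ^ 2 + 2 * coef μ (φ e) (m e) j ^ 2) :=
    Finset.sum_le_sum fun j _ => by nlinarith [sq_nonneg (a e j + coef μ (φ e) (m e) j)]
  rw [Finset.sum_add_distrib, ← Finset.mul_sum, ← Finset.mul_sum] at h3
  linarith

theorem exists_sqErr_le (h : IsRegular μ M lam φ) (hγ : 0 < γ) (hk : 0 < k) (z : X)
    {m : G.Dart → X → ℝ} (hm : ∀ e, MemLp (m e) 2 μ) : ∃ D : ℝ, 0 < D ∧
    ∀ δ : ℝ, 0 < δ → δ < 1 → ∀ (y : ℕ → G.Dart → Fin k → X) (t : ℕ) (e : G.Dart),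
      sqErr μ φ m (coeffs μ M φ γ (criticalDim lam δ) k y t) e ≤ D := by
  obtain ⟨D, hD0, hD⟩ := h.exists_l2norm_message_le (γ := γ) hγ hk z
  obtain ⟨E, hE⟩ := Finite.exists_le fun e => l2norm μ (m e) ^ 2
  refine ⟨2 * D ^ 2 + 2 * max E 1, by positivity, fun δ h0 h1 y t e => ?_⟩
  have h2 := h.sqErr_le (hm e) (coeffs μ M φ γ (criticalDim lam δ) k y t)
  have h3 := pow_le_pow_left₀ (l2norm_nonneg _) (hD δ h0 h1 y t e) 2
  have h4 := (hE e).trans (le_max_left E 1)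
  linarith

theorem exists_compatCoeff_sub_le (h : IsRegular μ M lam φ)
    {m : G.Dart → X → ℝ} (hm : ∀ e, MemLp (m e) 2 μ) : ∃ D : ℝ, 0 < D ∧
    ∀ (r : ℕ) (e : G.Dart) (z : X),
      ∑ j : Fin r, (compatCoeff μ M φ e j z - coef μ (φ e) (m e) j) ^ 2 ≤ D := by
  obtain ⟨c, B, hc0, hB0, hB⟩ := h.exists_normCompat_bounds
  obtain ⟨E, hE⟩ := Finite.exists_le fun e => l2norm μ (m e) ^ 2
  have hmass := h.mass_pos
  refine ⟨2 * (B * Real.sqrt (μ.real Set.univ)) ^ 2 + 2 * max E 1, by positivity,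
    fun r e z => ?_⟩
  have h1 : ∑ j : Fin r, (compatCoeff μ M φ e j z) ^ 2 ≤
      (B * Real.sqrt (μ.real Set.univ)) ^ 2 := by
    rw [← Finset.sum_range fun j => compatCoeff μ M φ e j z ^ 2]
    refine ((h.orthonormalSeq e).sum_coef_sq_le (h.memLp_normCompat e z) _).trans ?_
    rw [← l2norm_sq]
    refine pow_le_pow_left₀ (l2norm_nonneg _) (l2norm_le_of_abs_le hB0.le fun x => ?_) 2
    rw [abs_of_pos (hc0.trans_le (hB e x z).1)]
    exact (hB e x z).2
  have h2 : ∑ j : Fin r, coef μ (φ e) (m e) j ^ 2 ≤ max E 1 := by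
    rw [← Finset.sum_range fun j => coef μ (φ e) (m e) j ^ 2]
    refine ((h.orthonormalSeq e).sum_coef_sq_le (hm e) _).trans ?_
    rw [← l2norm_sq]
    exact (hE e).trans (le_max_left _ _)
  have h3 : ∑ j : Fin r, (compatCoeff μ M φ e j z - coef μ (φ e) (m e) j) ^ 2 ≤
      ∑ j : Fin r, (2 * compatCoeff μ M φ e j z ^ 2 + 2 * coef μ (φ e) (m e) j ^ 2) :=
    Finset.sum_le_sum fun j _ => by
      nlinarith [sq_nonneg (compatCoeff μ M φ e j z + coef μ (φ e) (m e) j)]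
  rw [Finset.sum_add_distrib, ← Finset.mul_sum, ← Finset.mul_sum] at h3
  linarith

/-- The conditional mean of the update is contracted towards the fixed point, up to an error of
smaller order than the accuracy `√δ`. -/
theorem exists_eventually_inner_error_le (h : IsRegular μ M lam φ) (hγ : 0 < γ) (hγ2 : γ < 2)
    (hk : 0 < k) (z : X) {K : Set (G.Dart → X → ℝ)} (hcontr : IsBPContractive μ M γ K)
    {m : G.Dart → X → ℝ} (hm : IsBPFixedPoint μ M m) (hmK : m ∈ K) :
    ∃ (C : ℝ) (t₀ : ℕ), 0 < C ∧ ∀ ε : ℝ, 0 < ε → ∀ᶠ δ in nhdsWithin (0 : ℝ) (Set.Ioi 0),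
      ∀ (y : ℕ → G.Dart → Fin k → X) (t : ℕ), t₀ ≤ t →
      ∀ a, a = coeffs μ M φ γ (criticalDim lam δ) k y t →
      ((∀ e, 0 < ∫ x, posMessage φ a e x ∂μ) →
        (fun e x => posMessage φ a e x / ∫ z, posMessage φ a e z ∂μ) ∈ K) →
      ∀ e : G.Dart, ∑ j, (a e j - coef μ (φ e) (m e) j) * ((∫ y, compatCoeff μ M φ e j y *
        (sampleWeight μ M φ a e y / ∫ z, sampleWeight μ M φ a e z ∂μ) ∂μ) -
          coef μ (φ e) (m e) j) ≤ Real.sqrt (sqErr μ φ m a e) * ((1 - γ / 2) *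
        Real.sqrt ((1 / ((incoming e).card : ℝ)) * ∑ d ∈ incoming e,
          (Real.sqrt (sqErr μ φ m a d) + (ε * Real.sqrt δ + C * decay γ t)) ^ 2)) := by
  obtain ⟨C, t₁, hC0, hC⟩ :=
    h.exists_eventually_abs_integral_posMessage_sub_one_le (γ := γ) hγ hk z
  obtain ⟨t₂, hw⟩ := h.exists_eventually_sampleWeight_pos (γ := γ) hγ hk z
  obtain ⟨D, hD0, hD⟩ := h.exists_l2norm_resid_fixedPoint_le hm
  obtain ⟨E₁, hE₁0, hE₁⟩ := h.exists_l2norm_message_le (γ := γ) hγ hk z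
  obtain ⟨E₂, hE₂⟩ := Finite.exists_le fun e => l2norm μ (m e)
  have hlim := (tendsto_decay hγ).const_mul C
  rw [mul_zero] at hlim
  obtain ⟨t₃, ht₃⟩ := Filter.eventually_atTop.1
    (hlim.eventually (gt_mem_nhds (show (0 : ℝ) < 1 / 4 by norm_num)))
  set E := E₁ + 2 * max E₂ 0 with hE
  have hE0 : 0 < E := by
    have := le_max_right E₂ 0
    linarith
  refine ⟨2 * C * E, max t₁ (max t₂ t₃), by positivity, fun ε hε => ?_⟩
  -- Then 2ε'E = ε/2, so normalisation uses half of the allowance ε√δ; the tail Dδ of the fixed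
  -- point uses the other half.
  set ε' := ε / (4 * E) with hε'
  have hε'0 : 0 < ε' := by positivity
  filter_upwards [hC ε' hε'0, hw, eventually_lt_nhdsGT one_pos,
    eventually_lt_nhdsGT (show 0 < (1 / (4 * ε')) ^ 2 by positivity),
    eventually_lt_nhdsGT (show 0 < (ε / (2 * D)) ^ 2 by positivity)]
    with δ h1 h2 ⟨hδ0, hδ1⟩ ⟨_, hδ2⟩ ⟨_, hδ3⟩ y t ht a ha hK e
  have ht1 : t₁ ≤ t := (le_max_left _ _).trans ht
  have ht2 : t₂ ≤ t := ((le_max_left _ _).trans (le_max_right _ _)).trans ht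
  have ht3 : t₃ ≤ t := ((le_max_right _ _).trans (le_max_right _ _)).trans ht
  have hs0 := Real.sqrt_nonneg δ
  have hs2 : Real.sqrt δ ≤ 1 / (4 * ε') := Real.sqrt_le_iff.2 ⟨by positivity, hδ2.le⟩
  have hs3 : Real.sqrt δ ≤ ε / (2 * D) := Real.sqrt_le_iff.2 ⟨by positivity, hδ3.le⟩
  set τ := ε' * Real.sqrt δ + C * decay γ t with hτ
  have hτ0 : 0 ≤ τ := add_nonneg (by positivity) (mul_nonneg hC0.le (decay_pos γ t).le)
  have hτ2 : τ ≤ 1 / 2 := by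
    have h3 : ε' * Real.sqrt δ ≤ ε' * (1 / (4 * ε')) := mul_le_mul_of_nonneg_left hs2 hε'0.le
    have h4 : ε' * (1 / (4 * ε')) = 1 / 4 := by field_simp
    have := (ht₃ t ht3).le
    linarith
  have hZ1 : ∀ d, |∫ x, posMessage φ a d x ∂μ - 1| ≤ τ := fun d => by
    rw [ha]
    exact h1 y t ht1 d
  have hZ : ∀ d, 0 < ∫ x, posMessage φ a d x ∂μ := fun d => by
    linarith [(abs_le.1 (hZ1 d)).1]
  have hwp : 0 < ∫ x, sampleWeight μ M φ a e x ∂μ := by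
    rw [ha]
    exact h2 y t ht2 e
  refine (h.inner_error_le hcontr hm hmK a e rfl (hK hZ) hZ hwp).trans ?_
  refine mul_le_mul_of_nonneg_left (mul_le_mul_of_nonneg_left (Real.sqrt_le_sqrt
    (mul_le_mul_of_nonneg_left (Finset.sum_le_sum fun d _ => ?_) (by positivity)))
      (by linarith)) (Real.sqrt_nonneg _)
  refine pow_le_pow_left₀ (l2norm_nonneg _) ?_ 2
  have hmd : MemLp (m d) 2 μ := (hm d).1.2.2.1
  have h3 := h.l2norm_normalised_sub_le hmd (hm d).1.2.1 a d (hZ1 d) hτ2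
  have h4 := h.l2norm_message_sub_le hmd a
  have h5 := hD δ hδ0 d
  have h6 : l2norm μ (message φ a d) + 2 * l2norm μ (m d) ≤ E := by
    have h7 := (hE₂ d).trans (le_max_left E₂ 0)
    have h8 := hE₁ δ hδ0 hδ1 y t d
    rw [← ha] at h8
    linarith
  have h7 : 2 * τ * (l2norm μ (message φ a d) + 2 * l2norm μ (m d)) ≤ 2 * τ * E :=
    mul_le_mul_of_nonneg_left h6 (by linarith)
  have h8 : D * δ ≤ ε / 2 * Real.sqrt δ := by
    calc D * δ = D * Real.sqrt δ * Real.sqrt δ := by rw [mul_assoc, Real.mul_self_sqrt hδ0.le]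
      _ ≤ D * (ε / (2 * D)) * Real.sqrt δ :=
          mul_le_mul_of_nonneg_right (mul_le_mul_of_nonneg_left hs3 hD0.le) hs0
      _ = ε / 2 * Real.sqrt δ := by field_simp
  have h9 : 2 * τ * E = ε / 2 * Real.sqrt δ + 2 * C * E * decay γ t := by
    rw [hτ, hε']
    field_simp
    ring
  linarith

end IsRegular

end Error

/-! ## The law of the samples -/

section Law

variable {V : Type*} [Fintype V] [DecidableEq V] {G : SimpleGraph V} [DecidableRel G.Adj]
variable {X : Type*} [MetricSpace X] [CompactSpace X] [MeasurableSpace X] [BorelSpace X]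
variable {μ : Measure X} [IsFiniteMeasure μ] {M : PairwiseMRF G X} {lam : ℕ → ℝ}
  {φ : G.Dart → ℕ → X → ℝ} {γ : ℝ} {k r : ℕ} {Ω : Type*}

/-- The σ-algebra on Ω is arbitrary, and only samples drawn before t must be measurable. The lemma
thus also applies to `history Y t` and shows that the coefficients are determined by the past. -/
theorem IsRegular.measurable_coeffs (h : IsRegular μ M lam φ) [MeasurableSpace Ω]
    {Y : ℕ → G.Dart → Fin k → Ω → X} (t : ℕ) (hY : ∀ s < t, ∀ e i, Measurable (Y s e i)) :
    Measurable fun ω => coeffs μ M φ γ r k (fun s d i => Y s d i ω) t := by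
  induction t with
  | zero =>
    simp only [measurable_pi_iff, coeffs_zero]
    exact fun _ _ => measurable_const
  | succ t ih =>
    have h1 := ih fun s hs => hY s (by omega)
    simp only [measurable_pi_iff] at h1 ⊢
    intro e j
    simp only [coeffs_succ]
    refine ((h1 e j).const_mul _).add (Measurable.const_mul (Measurable.div_const
      (Finset.measurable_sum _ fun i _ => ?_) _) _)
    exact (h.continuous_compatCoeff e j).measurable.comp (hY t (by omega) e i)

theorem measurable_history [MeasurableSpace Ω] (Y : ℕ → G.Dart → Fin k → Ω → X) {s t : ℕ}
    (hst : s < t) (e : G.Dart) (i : Fin k) : Measurable[history Y t] (Y s e i) :=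
  (comap_measurable (Y s e i)).mono
    (le_iSup_of_le (⟨s, hst⟩ : Fin t) (le_iSup_of_le e (le_iSup_of_le i le_rfl))) le_rfl

theorem IsRegular.continuous_sampleWeight_uncurry (h : IsRegular μ M lam φ) (e : G.Dart) :
    Continuous (Function.uncurry fun (a : G.Dart → Fin r → ℝ) y => sampleWeight μ M φ a e y) := by
  unfold sampleWeight posMessage message
  refine Continuous.mul ((h.continuous_betaFun e).comp continuous_snd)
    (continuous_finsetProd _ fun d _ => continuous_const.max (continuous_finsetSum _ fun j _ => ?_))
  exact Continuous.mul (by fun_prop) (((h.eig d).continuous j).comp continuous_snd)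

theorem IsRegular.continuous_integral_sampleWeight (h : IsRegular μ M lam φ) (e : G.Dart) :
    Continuous fun a : G.Dart → Fin r → ℝ => ∫ y, sampleWeight μ M φ a e y ∂μ :=
  continuous_integral_right (h.continuous_sampleWeight_uncurry e)

theorem IsRegular.measurable_sampleDensity (h : IsRegular μ M lam φ) (e : G.Dart) :
    Measurable fun p : (G.Dart → Fin r → ℝ) × X =>
      sampleWeight μ M φ p.1 e p.2 / ∫ z, sampleWeight μ M φ p.1 e z ∂μ :=
  (h.continuous_sampleWeight_uncurry e).measurable.div
    ((h.continuous_integral_sampleWeight e).measurable.comp measurable_fst)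

theorem IsRegular.integral_sampleDensity (_h : IsRegular μ M lam φ) (e : G.Dart)
    {a : G.Dart → Fin r → ℝ} (ha : 0 < ∫ y, sampleWeight μ M φ a e y ∂μ) :
    ∫ y, sampleWeight μ M φ a e y / (∫ z, sampleWeight μ M φ a e z ∂μ) ∂μ = 1 := by
  rw [integral_div, div_self ha.ne']

theorem IsRegular.isProbabilityMeasure_sampleLaw (h : IsRegular μ M lam φ) (e : G.Dart)
    {a : G.Dart → Fin r → ℝ} (ha : 0 < ∫ y, sampleWeight μ M φ a e y ∂μ) :
    IsProbabilityMeasure (sampleLaw μ M φ a e) := by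
  refine ⟨?_⟩
  rw [sampleLaw, withDensity_apply _ MeasurableSet.univ, Measure.restrict_univ,
    ← ofReal_integral_eq_lintegral_ofReal, h.integral_sampleDensity e ha, ENNReal.ofReal_one]
  · exact integrable_of_continuous ((h.continuous_sampleWeight a e).div_const _)
  · exact Filter.Eventually.of_forall fun y => div_nonneg (h.sampleWeight_nonneg a e y) ha.le

/-- The joint law of the current coefficients and a sample. -/
theorem IsRegular.map_coeffs_sample (h : IsRegular μ M lam φ) [MeasurableSpace Ω] {P : Measure Ω}
    [IsProbabilityMeasure P] {Y : ℕ → G.Dart → Fin k → Ω → X} (hrun : IsRun P μ M φ γ r k Y)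
    (t : ℕ) (e : G.Dart) (i : Fin k)
    (hpos : ∀ ω, 0 < ∫ y, sampleWeight μ M φ
      (coeffs μ M φ γ r k (fun s d i => Y s d i ω) t) e y ∂μ) :
    P.map (fun ω => (coeffs μ M φ γ r k (fun s d i => Y s d i ω) t, Y t e i ω)) =
      ((P.map fun ω => coeffs μ M φ γ r k (fun s d i => Y s d i ω) t).prod μ).withDensity
        fun p => ENNReal.ofReal
          (sampleWeight μ M φ p.1 e p.2 / ∫ z, sampleWeight μ M φ p.1 e z ∂μ) := by
  set A : Ω → G.Dart → Fin r → ℝ := fun ω => coeffs μ M φ γ r k (fun s d i => Y s d i ω) t with hA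
  have hAm : Measurable A := h.measurable_coeffs t fun s _ => hrun.measurable s
  -- This allows events about the current coefficients as conditioning events in `IsRun.law`.
  have hAh : Measurable[history Y t] A :=
    @IsRegular.measurable_coeffs _ _ _ _ _ _ _ _ _ _ _ _ _ _ _ γ k r Ω h (history Y t) Y t
      fun s hs e i => measurable_history Y hs e i
  have hYm := hrun.measurable t e i
  have hρ := (h.measurable_sampleDensity (r := r) e).ennreal_ofReal
  have hfin : IsProbabilityMeasure (P.map fun ω => (A ω, Y t e i ω)) :=
    Measure.isProbabilityMeasure_map (hAm.prodMk hYm).aemeasurable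
  refine Measure.ext_prod fun {s} {B} hs hB => ?_
  rw [Measure.map_apply (hAm.prodMk hYm) (hs.prod hB), withDensity_apply _ (hs.prod hB),
    ← Measure.prod_restrict, lintegral_prod _ hρ.aemeasurable,
    setLIntegral_map hs (Measurable.lintegral_prod_right hρ) hAm]
  have hBm : MeasurableSet {y : Fin k → X | y i ∈ B} := measurable_pi_apply i hB
  have hlaw := hrun.law t e (A ⁻¹' s) (hAh hs) (fun ω _ => hpos ω) _ hBm
  have hset : (fun ω => (A ω, Y t e i ω)) ⁻¹' s ×ˢ B =
      A ⁻¹' s ∩ {ω | (fun i => Y t e i ω) ∈ {y : Fin k → X | y i ∈ B}} := rfl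
  rw [hset, hlaw]
  refine lintegral_congr fun ω => ?_
  have hprob := h.isProbabilityMeasure_sampleLaw e (hpos ω)
  -- The i-th marginal of the conditional product law is the sampling law.
  have hev := (measurePreserving_eval (fun _ : Fin k => sampleLaw μ M φ (A ω) e) i).measure_preimage
    hB.nullMeasurableSet
  refine hev.trans ?_
  rw [sampleLaw, withDensity_apply _ hB]

/-- The tower property in concrete form: the conditional expectation of H given the past is an
integral against the sampling density, by the joint law and Fubini. -/
theorem IsRegular.integral_coeffs_sample (h : IsRegular μ M lam φ) [MeasurableSpace Ω]
    {P : Measure Ω} [IsProbabilityMeasure P] {Y : ℕ → G.Dart → Fin k → Ω → X}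
    (hrun : IsRun P μ M φ γ r k Y) (t : ℕ) (e : G.Dart) (i : Fin k)
    (hpos : ∀ ω, 0 < ∫ y, sampleWeight μ M φ
      (coeffs μ M φ γ r k (fun s d i => Y s d i ω) t) e y ∂μ)
    {H : (G.Dart → Fin r → ℝ) × X → ℝ} (hH : Measurable H)
    (hHi : Integrable (fun ω => H (coeffs μ M φ γ r k (fun s d i => Y s d i ω) t, Y t e i ω)) P) :
    Integrable (fun ω => ∫ y, (sampleWeight μ M φ
      (coeffs μ M φ γ r k (fun s d i => Y s d i ω) t) e y / ∫ z, sampleWeight μ M φ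
      (coeffs μ M φ γ r k (fun s d i => Y s d i ω) t) e z ∂μ) *
        H (coeffs μ M φ γ r k (fun s d i => Y s d i ω) t, y) ∂μ) P ∧
    ∫ ω, H (coeffs μ M φ γ r k (fun s d i => Y s d i ω) t, Y t e i ω) ∂P =
      ∫ ω, ∫ y, (sampleWeight μ M φ
      (coeffs μ M φ γ r k (fun s d i => Y s d i ω) t) e y / ∫ z, sampleWeight μ M φ
      (coeffs μ M φ γ r k (fun s d i => Y s d i ω) t) e z ∂μ) *
        H (coeffs μ M φ γ r k (fun s d i => Y s d i ω) t, y) ∂μ ∂P := by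
  set A : Ω → G.Dart → Fin r → ℝ := fun ω => coeffs μ M φ γ r k (fun s d i => Y s d i ω) t with hA
  have hAm : Measurable A := h.measurable_coeffs t fun s _ => hrun.measurable s
  have hYm := hrun.measurable t e i
  have hjm := hAm.prodMk hYm
  have hmap := h.map_coeffs_sample hrun t e i hpos
  rw [← hA] at hmap
  have hρ := (h.measurable_sampleDensity (r := r) e).ennreal_ofReal
  have hρt : ∀ᵐ p ∂((P.map A).prod μ), ENNReal.ofReal
      (sampleWeight μ M φ p.1 e p.2 / ∫ z, sampleWeight μ M φ p.1 e z ∂μ) < ⊤ :=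
    Filter.Eventually.of_forall fun _ => ENNReal.ofReal_lt_top
  have hprob : IsProbabilityMeasure (P.map A) := Measure.isProbabilityMeasure_map hAm.aemeasurable
  have h1 : Integrable H (P.map fun ω => (A ω, Y t e i ω)) :=
    (integrable_map_measure hH.aestronglyMeasurable hjm.aemeasurable).2 hHi
  have h2 : ∫ ω, H (A ω, Y t e i ω) ∂P = ∫ p, H p ∂(P.map fun ω => (A ω, Y t e i ω)) :=
    (integral_map hjm.aemeasurable hH.aestronglyMeasurable).symm
  rw [hmap] at h1 h2
  rw [integrable_withDensity_iff_integrable_smul' hρ hρt] at h1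
  rw [integral_withDensity_eq_integral_toReal_smul hρ hρt] at h2
  have h3 : ∀ p : (G.Dart → Fin r → ℝ) × X, (ENNReal.ofReal
      (sampleWeight μ M φ p.1 e p.2 / ∫ z, sampleWeight μ M φ p.1 e z ∂μ)).toReal • H p =
      (sampleWeight μ M φ p.1 e p.2 / ∫ z, sampleWeight μ M φ p.1 e z ∂μ) * H p := by
    intro p
    rw [ENNReal.toReal_ofReal (div_nonneg (h.sampleWeight_nonneg _ e _)
      (integral_nonneg (h.sampleWeight_nonneg _ e))), smul_eq_mul]
  simp only [h3] at h1 h2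
  rw [integral_prod _ h1] at h2
  have h4 := h1.integral_prod_left
  refine ⟨(integrable_map_measure h4.aestronglyMeasurable hAm.aemeasurable).1 h4, ?_⟩
  rw [h2, integral_map hAm.aemeasurable h4.aestronglyMeasurable]

end Law

/-! ## The mean square error of the algorithm -/

section Step

variable {V : Type*} [Fintype V] [DecidableEq V] {G : SimpleGraph V} [DecidableRel G.Adj]
variable {X : Type*} [MetricSpace X] [CompactSpace X] [MeasurableSpace X] [BorelSpace X]
variable {μ : Measure X} [IsFiniteMeasure μ] {M : PairwiseMRF G X} {lam : ℕ → ℝ}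
  {φ : G.Dart → ℕ → X → ℝ} {γ : ℝ} {k r : ℕ} {Ω : Type*}

theorem continuous_sqErr (m : G.Dart → X → ℝ) (e : G.Dart) :
    Continuous fun a : G.Dart → Fin r → ℝ => sqErr μ φ m a e := by
  unfold sqErr
  fun_prop

/-- The square of the new error, before taking means. -/
theorem sqErr_succ_le {m : G.Dart → X → ℝ} (hk : 0 < k) (y : ℕ → G.Dart → Fin k → X) (t : ℕ)
    (e : G.Dart) {B : ℝ}
    (hB : ∀ z, ∑ j : Fin r, (compatCoeff μ M φ e j z - coef μ (φ e) (m e) j) ^ 2 ≤ B) :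
    sqErr μ φ m (coeffs μ M φ γ r k y (t + 1)) e ≤
      (1 - stepSize γ t) ^ 2 * sqErr μ φ m (coeffs μ M φ γ r k y t) e +
      2 * ((1 - stepSize γ t) * stepSize γ t) * ((∑ i, ∑ j,
        (coeffs μ M φ γ r k y t e j - coef μ (φ e) (m e) j) *
          (compatCoeff μ M φ e j (y t e i) - coef μ (φ e) (m e) j)) / k) +
      stepSize γ t ^ 2 * B := by
  have hk0 : (0 : ℝ) < k := by exact_mod_cast hk
  set a := coeffs μ M φ γ r k y t with ha
  let D : Fin r → ℝ := fun j => a e j - coef μ (φ e) (m e) j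
  let b : Fin r → ℝ := fun j =>
    (∑ i, (compatCoeff μ M φ e j (y t e i) - coef μ (φ e) (m e) j)) / k
  have h1 : ∀ j : Fin r, coeffs μ M φ γ r k y (t + 1) e j - coef μ (φ e) (m e) j =
      (1 - stepSize γ t) * D j + stepSize γ t * b j := by
    intro j
    simp only [D, b, coeffs_succ, Finset.sum_sub_distrib, Finset.sum_const, Finset.card_univ,
      Fintype.card_fin, nsmul_eq_mul, ← ha]
    field_simp
    ring
  have h2 : ∑ j, b j ^ 2 ≤ B := by
    have h3 : ∀ j, b j ^ 2 ≤
        (∑ i, (compatCoeff μ M φ e j (y t e i) - coef μ (φ e) (m e) j) ^ 2) / k := by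
      intro j
      -- By convexity, the squared average is at most the average of the squares, so the bound B for
      -- one sample serves for the average of k.
      have h4 := sq_sum_le_card_mul_sum_sq (s := (Finset.univ : Finset (Fin k)))
        (f := fun i => compatCoeff μ M φ e j (y t e i) - coef μ (φ e) (m e) j)
      rw [Finset.card_univ, Fintype.card_fin] at h4
      simp only [b]
      rw [div_pow, div_le_div_iff₀ (by positivity) hk0]
      nlinarith
    refine (Finset.sum_le_sum fun j _ => h3 j).trans ?_
    rw [← Finset.sum_div, Finset.sum_comm, div_le_iff₀ hk0]
    refine (Finset.sum_le_sum fun i _ => hB (y t e i)).trans (le_of_eq ?_)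
    simp [mul_comm]
  have h3 : ∑ j, D j * b j = (∑ i, ∑ j,
      (a e j - coef μ (φ e) (m e) j) *
        (compatCoeff μ M φ e j (y t e i) - coef μ (φ e) (m e) j)) / k := by
    rw [Finset.sum_comm, Finset.sum_div]
    refine Finset.sum_congr rfl fun j _ => ?_
    simp only [D, b]
    rw [mul_div_assoc', Finset.mul_sum]
  rw [← h3]
  have h4 : sqErr μ φ m (coeffs μ M φ γ r k y (t + 1)) e = (1 - stepSize γ t) ^ 2 * ∑ j, D j ^ 2 +
      2 * ((1 - stepSize γ t) * stepSize γ t) * ∑ j, D j * b j +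
      stepSize γ t ^ 2 * ∑ j, b j ^ 2 := by
    unfold sqErr
    simp only [h1, Finset.mul_sum, ← Finset.sum_add_distrib]
    refine Finset.sum_congr rfl fun j _ => ?_
    ring
  rw [h4]
  exact add_le_add le_rfl (mul_le_mul_of_nonneg_left h2 (sq_nonneg _))

theorem integral_sqrt_le [MeasurableSpace Ω] {P : Measure Ω} [IsProbabilityMeasure P]
    {f : Ω → ℝ} (hf : Measurable f) (hf0 : ∀ ω, 0 ≤ f ω) {D : ℝ} (hD : ∀ ω, f ω ≤ D) :
    Integrable (fun ω => Real.sqrt (f ω)) P ∧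
      ∫ ω, Real.sqrt (f ω) ∂P ≤ Real.sqrt (∫ ω, f ω ∂P) := by
  have h1 : MemLp (fun ω => Real.sqrt (f ω)) 2 P := by
    refine MemLp.of_bound hf.sqrt.aestronglyMeasurable (Real.sqrt D)
      (Filter.Eventually.of_forall fun ω => ?_)
    rw [Real.norm_eq_abs, abs_of_nonneg (Real.sqrt_nonneg _)]
    exact Real.sqrt_le_sqrt (hD ω)
  refine ⟨h1.integrable (by norm_num), ?_⟩
  have h2 := abs_integral_mul_le h1 (memLp_const (1 : ℝ))
  simp only [mul_one] at h2
  refine (le_abs_self _).trans (h2.trans (le_of_eq ?_))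
  unfold l2norm
  simp [Real.sq_sqrt (hf0 _)]

/-- The mean of `sqErr_succ_le`. The cross term is replaced by its conditional mean, which `hinner`
bounds by (1 − γ/2)√S√R, with R the average over the incoming edges. Then √S√R ≤ (S + R)/2, and E√S
≤ √(E S) handles the linear term in τ. -/
theorem IsRegular.integral_sqErr_succ_le (h : IsRegular μ M lam φ) [MeasurableSpace Ω]
    {P : Measure Ω} [IsProbabilityMeasure P] {Y : ℕ → G.Dart → Fin k → Ω → X}
    (hrun : IsRun P μ M φ γ r k Y) (hγ : 0 < γ) (hγ2 : γ < 2) (hk : 0 < k)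
    {m : G.Dart → X → ℝ} {t : ℕ} {B D τ b : ℝ} (ht : stepSize γ t ≤ 1) (hτ : 0 ≤ τ)
    (hB : ∀ (e : G.Dart) (z : X),
      ∑ j : Fin r, (compatCoeff μ M φ e j z - coef μ (φ e) (m e) j) ^ 2 ≤ B)
    (hD : ∀ (y : ℕ → G.Dart → Fin k → X) (t : ℕ) (e : G.Dart),
      sqErr μ φ m (coeffs μ M φ γ r k y t) e ≤ D)
    (hpos : ∀ ω e, 0 < ∫ y, sampleWeight μ M φ
      (coeffs μ M φ γ r k (fun s d i => Y s d i ω) t) e y ∂μ)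
    (hinner : ∀ᵐ ω ∂P, ∀ a, a = coeffs μ M φ γ r k (fun s d i => Y s d i ω) t → ∀ e : G.Dart,
      ∑ j, (a e j - coef μ (φ e) (m e) j) * ((∫ y, compatCoeff μ M φ e j y *
        (sampleWeight μ M φ a e y / ∫ z, sampleWeight μ M φ a e z ∂μ) ∂μ) -
          coef μ (φ e) (m e) j) ≤ Real.sqrt (sqErr μ φ m a e) * ((1 - γ / 2) *
        Real.sqrt ((1 / ((incoming e).card : ℝ)) * ∑ d ∈ incoming e,
          (Real.sqrt (sqErr μ φ m a d) + τ) ^ 2)))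
    (hb : ∀ e, ∫ ω, sqErr μ φ m (coeffs μ M φ γ r k (fun s d i => Y s d i ω) t) e ∂P ≤ b)
    (e : G.Dart) :
    ∫ ω, sqErr μ φ m (coeffs μ M φ γ r k (fun s d i => Y s d i ω) (t + 1)) e ∂P ≤
      (1 - stepSize γ t) ^ 2 * b + (1 - stepSize γ t) * stepSize γ t * (1 - γ / 2) *
        (2 * b + 2 * τ * Real.sqrt b + τ ^ 2) + stepSize γ t ^ 2 * B := by
  set A : Ω → G.Dart → Fin r → ℝ := fun ω => coeffs μ M φ γ r k (fun s d i => Y s d i ω) t with hA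
  have hAm : Measurable A := h.measurable_coeffs t fun s _ => hrun.measurable s
  have hAm1 : Measurable fun ω => coeffs μ M φ γ r k (fun s d i => Y s d i ω) (t + 1) :=
    h.measurable_coeffs (t + 1) fun s _ => hrun.measurable s
  set η := stepSize γ t with hη
  have hη0 : 0 < η := stepSize_pos hγ t
  have hk0 : (0 : ℝ) < k := by exact_mod_cast hk
  have hsm : ∀ d, Measurable fun ω => sqErr μ φ m (A ω) d := fun d =>
    (continuous_sqErr m d).measurable.comp hAm
  have hsb : ∀ d ω, |sqErr μ φ m (A ω) d| ≤ D := fun d ω => by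
    rw [abs_of_nonneg (sqErr_nonneg _ _ _)]
    exact hD _ t d
  have hsi : ∀ d, Integrable (fun ω => sqErr μ φ m (A ω) d) P := fun d =>
    Integrable.of_bound (hsm d).aestronglyMeasurable D (Filter.Eventually.of_forall (hsb d))
  have hsi1 : Integrable (fun ω => sqErr μ φ m
      (coeffs μ M φ γ r k (fun s d i => Y s d i ω) (t + 1)) e) P := by
    refine Integrable.of_bound ((continuous_sqErr m e).measurable.comp hAm1).aestronglyMeasurable D
      (Filter.Eventually.of_forall fun ω => ?_)
    rw [Real.norm_eq_abs, abs_of_nonneg (sqErr_nonneg _ _ _)]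
    exact hD _ (t + 1) e
  -- the cross term
  let H : (G.Dart → Fin r → ℝ) × X → ℝ := fun p =>
    ∑ j, (p.1 e j - coef μ (φ e) (m e) j) * (compatCoeff μ M φ e j p.2 - coef μ (φ e) (m e) j)
  have hHc : Continuous H := by
    refine continuous_finsetSum _ fun j _ => Continuous.mul (by fun_prop) ?_
    exact ((h.continuous_compatCoeff e j).comp continuous_snd).sub continuous_const
  have hHb : ∀ ω z, |H (A ω, z)| ≤ Real.sqrt (D * B) := by
    intro ω z
    refine Real.abs_le_sqrt ((Finset.sum_mul_sq_le_sq_mul_sq _ _ _).trans ?_)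
    have h1 : sqErr μ φ m (A ω) e ≤ D := hD _ t e
    exact mul_le_mul h1 (hB e z) (Finset.sum_nonneg fun _ _ => sq_nonneg _)
      ((sqErr_nonneg _ _ _).trans h1)
  have hHi : ∀ i, Integrable (fun ω => H (A ω, Y t e i ω)) P := fun i =>
    Integrable.of_bound (hHc.measurable.comp
      (hAm.prodMk (hrun.measurable t e i))).aestronglyMeasurable (Real.sqrt (D * B))
      (Filter.Eventually.of_forall fun ω => hHb ω _)
  let R : Ω → ℝ := fun ω => (1 / ((incoming e).card : ℝ)) * ∑ d ∈ incoming e,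
    (Real.sqrt (sqErr μ φ m (A ω) d) + τ) ^ 2
  have hR0 : ∀ ω, 0 ≤ R ω := fun ω =>
    mul_nonneg (by positivity) (Finset.sum_nonneg fun _ _ => sq_nonneg _)
  have hsq := fun d => integral_sqrt_le (P := P) (hsm d) (fun ω => sqErr_nonneg m (A ω) d)
    fun ω => hD _ t d
  have hexp : ∀ d ω, (Real.sqrt (sqErr μ φ m (A ω) d) + τ) ^ 2 =
      sqErr μ φ m (A ω) d + 2 * τ * Real.sqrt (sqErr μ φ m (A ω) d) + τ ^ 2 := by
    intro d ω
    rw [add_sq, Real.sq_sqrt (sqErr_nonneg _ _ _)]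
    ring
  have hti : ∀ d, Integrable (fun ω => (Real.sqrt (sqErr μ φ m (A ω) d) + τ) ^ 2) P := by
    intro d
    simp only [hexp]
    exact ((hsi d).add ((hsq d).1.const_mul _)).add (integrable_const _)
  have hRi : Integrable R P := (integrable_finsetSum _ fun d _ => hti d).const_mul _
  have hb0 : 0 ≤ b := (integral_nonneg fun ω => sqErr_nonneg m (A ω) e).trans (hb e)
  have hRb : ∫ ω, R ω ∂P ≤ b + 2 * τ * Real.sqrt b + τ ^ 2 := by
    have h1 : ∀ d ∈ incoming e, ∫ ω, (Real.sqrt (sqErr μ φ m (A ω) d) + τ) ^ 2 ∂P ≤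
        b + 2 * τ * Real.sqrt b + τ ^ 2 := by
      intro d _
      simp only [hexp]
      have i1 : Integrable (fun ω => sqErr μ φ m (A ω) d +
          2 * τ * Real.sqrt (sqErr μ φ m (A ω) d)) P := (hsi d).add ((hsq d).1.const_mul _)
      rw [integral_add i1 (integrable_const _), integral_add (hsi d) ((hsq d).1.const_mul _),
        integral_const_mul, integral_const, probReal_univ, one_smul]
      have h2 := (hsq d).2.trans (Real.sqrt_le_sqrt (hb d))
      have h3 := mul_le_mul_of_nonneg_left h2 (show 0 ≤ 2 * τ by linarith)
      have h4 := hb d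
      linarith
    simp only [R]
    rw [integral_const_mul, integral_finsetSum _ fun d _ => hti d]
    have h2 := Finset.sum_le_card_nsmul _ _ _ h1
    rw [nsmul_eq_mul] at h2
    have h3 : 0 ≤ b + 2 * τ * Real.sqrt b + τ ^ 2 := by positivity
    -- Without incoming edges the average is 0, because 1 / 0 = 0.
    rcases Nat.eq_zero_or_pos (incoming e).card with h0 | h0
    · rw [h0]
      simpa using h3
    · have hc : (0 : ℝ) < (incoming e).card := by exact_mod_cast h0
      rw [one_div, inv_mul_le_iff₀ hc]
      exact h2
  have hcross : ∀ i, ∫ ω, H (A ω, Y t e i ω) ∂P ≤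
      (1 - γ / 2) / 2 * (2 * b + 2 * τ * Real.sqrt b + τ ^ 2) := by
    intro i
    obtain ⟨j1, j2⟩ := h.integral_coeffs_sample hrun t e i (fun ω => hpos ω e) hHc.measurable
      (hHi i)
    rw [j2]
    have i3 : Integrable (fun ω => (1 - γ / 2) / 2 * (sqErr μ φ m (A ω) e + R ω)) P :=
      ((hsi e).add hRi).const_mul _
    refine (integral_mono_ae j1 i3 ?_).trans ?_
    · filter_upwards [hinner] with ω hω
      have h1 := hω (A ω) rfl e
      have h2 : ∫ y, (sampleWeight μ M φ (A ω) e y / ∫ z, sampleWeight μ M φ (A ω) e z ∂μ) *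
          H (A ω, y) ∂μ = ∑ j, (A ω e j - coef μ (φ e) (m e) j) *
            ((∫ y, compatCoeff μ M φ e j y * (sampleWeight μ M φ (A ω) e y /
              ∫ z, sampleWeight μ M φ (A ω) e z ∂μ) ∂μ) - coef μ (φ e) (m e) j) := by
        set w : X → ℝ := fun y => sampleWeight μ M φ (A ω) e y /
          ∫ z, sampleWeight μ M φ (A ω) e z ∂μ with hw
        have hwc : Continuous w := (h.continuous_sampleWeight (A ω) e).div_const _
        have hw1 : ∫ y, w y ∂μ = 1 := h.integral_sampleDensity e (hpos ω e)
        have i4 : ∀ j : Fin r, Integrable (fun y => compatCoeff μ M φ e j y * w y) μ := fun j =>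
          integrable_of_continuous ((h.continuous_compatCoeff e j).mul hwc)
        have h3 : ∀ y, w y * H (A ω, y) = ∑ j, (A ω e j - coef μ (φ e) (m e) j) *
            (compatCoeff μ M φ e j y * w y - coef μ (φ e) (m e) j * w y) := by
          intro y
          simp only [H, Finset.mul_sum]
          refine Finset.sum_congr rfl fun j _ => ?_
          ring
        have iw : Integrable w μ := integrable_of_continuous hwc
        change ∫ y, w y * H (A ω, y) ∂μ = ∑ j, (A ω e j - coef μ (φ e) (m e) j) *
          ((∫ y, compatCoeff μ M φ e j y * w y ∂μ) - coef μ (φ e) (m e) j)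
        simp only [h3]
        have i7 : ∀ j : Fin r, Integrable (fun y => (A ω e j - coef μ (φ e) (m e) j) *
            (compatCoeff μ M φ e j y * w y - coef μ (φ e) (m e) j * w y)) μ := fun j =>
          ((i4 j).sub (iw.const_mul _)).const_mul _
        rw [integral_finsetSum _ fun j _ => i7 j]
        refine Finset.sum_congr rfl fun j _ => ?_
        rw [integral_const_mul, integral_sub (i4 j) (iw.const_mul _), integral_const_mul, hw1,
          mul_one]
      refine (le_of_eq h2).trans (h1.trans ?_)
      change Real.sqrt (sqErr μ φ m (A ω) e) * ((1 - γ / 2) * Real.sqrt (R ω)) ≤ _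
      have h4 := Real.sq_sqrt (sqErr_nonneg m (A ω) e : 0 ≤ sqErr μ φ m (A ω) e)
      have h5 := Real.sq_sqrt (hR0 ω)
      have h6 : Real.sqrt (sqErr μ φ m (A ω) e) * Real.sqrt (R ω) ≤
          (sqErr μ φ m (A ω) e + R ω) / 2 := by
        nlinarith [sq_nonneg (Real.sqrt (sqErr μ φ m (A ω) e) - Real.sqrt (R ω))]
      have h7 := mul_le_mul_of_nonneg_left h6 (show 0 ≤ 1 - γ / 2 by linarith)
      linarith
    · rw [integral_const_mul, integral_add (hsi e) hRi]
      refine mul_le_mul_of_nonneg_left ?_ (by linarith)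
      have h1 := hb e
      linarith
  have hup : ∀ ω, sqErr μ φ m (coeffs μ M φ γ r k (fun s d i => Y s d i ω) (t + 1)) e ≤
      (1 - η) ^ 2 * sqErr μ φ m (A ω) e + 2 * ((1 - η) * η) *
        ((∑ i, H (A ω, Y t e i ω)) / k) + η ^ 2 * B := fun ω =>
    sqErr_succ_le hk (fun s d i => Y s d i ω) t e (hB e)
  have hSi : Integrable (fun ω => (∑ i, H (A ω, Y t e i ω)) / k) P :=
    (integrable_finsetSum _ fun i _ => hHi i).div_const _
  have i5 : Integrable (fun ω => (1 - η) ^ 2 * sqErr μ φ m (A ω) e + 2 * ((1 - η) * η) *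
      ((∑ i, H (A ω, Y t e i ω)) / k)) P := ((hsi e).const_mul _).add (hSi.const_mul _)
  have i6 : Integrable (fun ω => (1 - η) ^ 2 * sqErr μ φ m (A ω) e + 2 * ((1 - η) * η) *
      ((∑ i, H (A ω, Y t e i ω)) / k) + η ^ 2 * B) P := i5.add (integrable_const _)
  refine (integral_mono hsi1 i6 hup).trans ?_
  rw [integral_add i5 (integrable_const _), integral_add ((hsi e).const_mul _) (hSi.const_mul _),
    integral_const_mul, integral_const_mul, integral_const, probReal_univ, one_smul,
    integral_div, integral_finsetSum _ fun i _ => hHi i]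
  have hS : (∑ i, ∫ ω, H (A ω, Y t e i ω) ∂P) / k ≤
      (1 - γ / 2) / 2 * (2 * b + 2 * τ * Real.sqrt b + τ ^ 2) := by
    rw [div_le_iff₀ hk0]
    refine (Finset.sum_le_sum fun i _ => hcross i).trans (le_of_eq ?_)
    simp [mul_comm]
  have h1 := mul_le_mul_of_nonneg_left (hb e) (sq_nonneg (1 - η))
  have h2 := mul_le_mul_of_nonneg_left hS
    (show 0 ≤ 2 * ((1 - η) * η) from mul_nonneg zero_le_two (mul_nonneg (by linarith) hη0.le))
  linarith

end Step

/-! ## The number of operations and the accuracy -/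

section Accuracy

variable {V : Type*} [Fintype V] [DecidableEq V] {G : SimpleGraph V} [DecidableRel G.Adj]
variable {X : Type*} [MetricSpace X] [CompactSpace X] [MeasurableSpace X] [BorelSpace X]
variable {μ : Measure X} [IsFiniteMeasure μ] {M : PairwiseMRF G X} {lam : ℕ → ℝ}
  {φ : G.Dart → ℕ → X → ℝ} {γ : ℝ} {k : ℕ}

/-- The contraction factor comes from (1 − η)² + 2(1 − η)η(1 − γ/2) = 1 − γη + (γ − 1)η². With γ − 1
≤ 1 and b' ≤ D, the last term joins the O(η²) remainder. -/
theorem step_bound {γ η b b' τ B D s : ℝ} (hγ : 0 < γ) (hγ2 : γ < 2) (hs : 0 ≤ 1 - s)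
    (hη0 : 0 ≤ η) (hη1 : η ≤ 1) (hηs : γ * η = s) (hb0 : 0 ≤ b') (hb : b' ≤ b)
    (hD : b' ≤ D) (hτ : 0 ≤ τ) :
    (1 - η) ^ 2 * b' + (1 - η) * η * (1 - γ / 2) * (2 * b' + 2 * τ * Real.sqrt b' + τ ^ 2) +
      η ^ 2 * B ≤ (1 - s) * b + η * (2 * τ * Real.sqrt b + τ ^ 2) + η ^ 2 * (D + B) := by
  have h1 : Real.sqrt b' ≤ Real.sqrt b := Real.sqrt_le_sqrt hb
  set u := 2 * τ * Real.sqrt b' + τ ^ 2 with hu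
  have hu0 : 0 ≤ u := by positivity
  have huv : u ≤ 2 * τ * Real.sqrt b + τ ^ 2 :=
    add_le_add (mul_le_mul_of_nonneg_left h1 (by linarith)) le_rfl
  have e1 : (1 - η) ^ 2 * b' + (1 - η) * η * (1 - γ / 2) *
      (2 * b' + 2 * τ * Real.sqrt b' + τ ^ 2) + η ^ 2 * B =
      (1 - s) * b' + η ^ 2 * ((γ - 1) * b') + η * (((1 - η) * (1 - γ / 2)) * u) + η ^ 2 * B := by
    rw [← hηs, hu]
    ring
  rw [e1]
  have h2 : (1 - s) * b' ≤ (1 - s) * b := mul_le_mul_of_nonneg_left hb hs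
  have h3 : (γ - 1) * b' ≤ D := by nlinarith
  have h4 : η ^ 2 * ((γ - 1) * b') ≤ η ^ 2 * D := mul_le_mul_of_nonneg_left h3 (sq_nonneg _)
  have h5 : (1 - η) * (1 - γ / 2) ≤ 1 := by nlinarith
  have h6 : ((1 - η) * (1 - γ / 2)) * u ≤ 2 * τ * Real.sqrt b + τ ^ 2 :=
    (mul_le_of_le_one_left hu0 h5).trans huv
  have h7 := mul_le_mul_of_nonneg_left h6 hη0
  linarith

/-- The one-step estimate fed into `exists_stochastic_recursion_bound`, with the edges as index set.
C and t₀ are fixed before ε and δ, which is what allows T to be chosen with constants independent of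
δ. -/
theorem IsRegular.exists_integral_sqErr_le (h : IsRegular μ M lam φ) (hγ : 0 < γ) (hγ2 : γ < 2)
    (hk : 0 < k) (z : X) {K : Set (G.Dart → X → ℝ)} (hcontr : IsBPContractive μ M γ K)
    {m : G.Dart → X → ℝ} (hm : IsBPFixedPoint μ M m) (hmK : m ∈ K) :
    ∃ (C : ℝ) (t₀ : ℕ), 0 < C ∧ ∀ ε : ℝ, 0 < ε → ∀ᶠ δ in nhdsWithin (0 : ℝ) (Set.Ioi 0),
      ∀ (Ω : Type*) [MeasurableSpace Ω] (P : Measure Ω) [IsProbabilityMeasure P]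
        (Y : ℕ → G.Dart → Fin k → Ω → X),
        IsRun P μ M φ γ (criticalDim lam δ) k Y →
        StaysIn P μ M φ γ (criticalDim lam δ) k Y K → ∀ T, t₀ ≤ T → ∀ e : G.Dart,
          ∫ ω, sqErr μ φ m
            (coeffs μ M φ γ (criticalDim lam δ) k (fun s d i => Y s d i ω) T) e ∂P ≤
            C * ((1 + Real.log T) / T) + ε * δ := by
  have hmem : ∀ e, MemLp (m e) 2 μ := fun e => (hm e).1.2.2.1
  obtain ⟨C, t₁, hC0, hC⟩ := h.exists_eventually_inner_error_le hγ hγ2 hk z hcontr hm hmK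
  obtain ⟨t₂, hw⟩ := h.exists_eventually_sampleWeight_pos (γ := γ) hγ hk z
  obtain ⟨t₃, hη⟩ := exists_stepSize_le_one hγ
  obtain ⟨D, hD0, hD⟩ := h.exists_sqErr_le (γ := γ) hγ hk z hmem
  obtain ⟨B, hB0, hB⟩ := h.exists_compatCoeff_sub_le hmem
  set t₀ := max 1 (max t₁ (max t₂ t₃)) with ht₀
  have h01 : 1 ≤ t₀ := le_max_left _ _
  have h02 : t₁ ≤ t₀ := (le_max_left _ _).trans (le_max_right _ _)
  have h03 : t₂ ≤ t₀ :=
    ((le_max_left _ _).trans (le_max_right _ _)).trans (le_max_right _ _)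
  have h04 : t₃ ≤ t₀ :=
    ((le_max_right _ _).trans (le_max_right _ _)).trans (le_max_right _ _)
  obtain ⟨L, hL0, hL⟩ := exists_stochastic_recursion_bound hγ hγ2 hD0.le
    (show 0 ≤ (D + B) / γ ^ 2 by positivity) hC0.le t₀ h01
  refine ⟨L, t₀, hL0, fun ε hε => ?_⟩
  set κ := 4 / γ + 16 / γ ^ 2 with hκ
  have hκ0 : 0 < κ := by positivity
  -- The recursion turns a constant perturbation e into κ e², which is then εδ.
  set ε' := Real.sqrt (ε / κ) with hε'
  have hε'0 : 0 < ε' := Real.sqrt_pos.2 (by positivity)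
  filter_upwards [hC ε' hε'0, hw, eventually_lt_nhdsGT one_pos]
    with δ h1 h2 ⟨hδ0, hδ1⟩ Ω _ P _ Y hrun hstay T hT e
  let x : ℕ → G.Dart → ℝ := fun t e => ∫ ω, sqErr μ φ m
    (coeffs μ M φ γ (criticalDim lam δ) k (fun s d i => Y s d i ω) t) e ∂P
  have hxD : ∀ t e, x t e ≤ D := by
    intro t e
    have h3 : ∫ ω, sqErr μ φ m
        (coeffs μ M φ γ (criticalDim lam δ) k (fun s d i => Y s d i ω) t) e ∂P ≤ ∫ _, D ∂P :=
      integral_mono_of_nonneg (Filter.Eventually.of_forall fun ω => sqErr_nonneg _ _ _)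
        (integrable_const _) (Filter.Eventually.of_forall fun ω => hD δ hδ0 hδ1 _ t e)
    simpa using h3
  have key := hL G.Dart (ε' * Real.sqrt δ) x (by positivity) (hxD t₀) ?_ T hT e
  · refine key.trans (le_of_eq ?_)
    rw [mul_pow, Real.sq_sqrt hδ0.le, Real.sq_sqrt (by positivity)]
    field_simp
  · intro t ht b hb0 hb d
    have hst := hη t (h04.trans ht)
    have hτ : 0 ≤ ε' * Real.sqrt δ + C * decay γ t :=
      add_nonneg (by positivity) (mul_nonneg hC0.le (decay_pos γ t).le)
    -- The bound b may be large; capping it at the a priori bound D keeps the remainder of order η²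
    -- under control.
    have hstep := h.integral_sqErr_succ_le hrun hγ hγ2 hk (b := min b D) hst hτ
      (fun e z => hB _ e z) (fun y t e => hD δ hδ0 hδ1 y t e)
      (fun ω e => h2 _ t (h03.trans ht) e)
      (by
        filter_upwards [hstay] with ω hω a ha e
        exact h1 _ t (h02.trans ht) a ha (hω t a ha) e)
      (fun e => le_min (hb e) (hxD t e)) d
    have ht1 : (0 : ℝ) < (t : ℝ) + 1 := by positivity
    have hs1 : 1 / ((t : ℝ) + 1) ≤ 1 := by
      rw [div_le_one ht1]
      linarith [Nat.cast_nonneg (α := ℝ) t]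
    refine hstep.trans ((step_bound (s := 1 / ((t : ℝ) + 1)) (b := b) (D := D) hγ hγ2
      (by linarith) (stepSize_pos hγ t).le hst ?_ (le_min hb0 hD0.le) (min_le_left _ _)
      (min_le_right _ _) hτ).trans (le_of_eq ?_))
    · unfold stepSize
      field_simp
    · unfold stepSize
      field_simp

/-- The number of operations that `T` iterations with `r` coefficients spend on an edge. -/
theorem sosmp_ops_le (c r k T : ℕ) (hr : 1 ≤ r) (hT : 1 ≤ T) (y : ℕ → G.Dart → Fin k → X)
    (e : G.Dart) : (sosmp μ M φ γ c r k y T e).ops ≤ r * T * (k * c + 2 * k + 9) := by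
  rw [sosmp_ops]
  have h1 : r ≤ r * T := Nat.le_mul_of_pos_right r hT
  have h2 : T ≤ r * T := Nat.le_mul_of_pos_left T hr
  nlinarith

end Accuracy

end SOSMP

/-! ### The theorem: choice of T and of the constants -/

open SOSMP in
theorem theorem3 {V : Type*} [Fintype V] [DecidableEq V] (G : SimpleGraph V) [DecidableRel G.Adj]
    {X : Type*} [MetricSpace X] [CompactSpace X] [MeasurableSpace X] [BorelSpace X]
    (μ : Measure X) [IsFiniteMeasure μ] (M : SOSMP.PairwiseMRF G X)
    (hnode : ∀ v, Continuous (M.nodePot v))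
    (hedge : ∀ u v, G.Adj u v → Continuous (Function.uncurry (M.edgePot u v)))
    (γ : ℝ) (hγ0 : 0 < γ) (hγ2 : γ < 2)
    (K : Set (G.Dart → X → ℝ)) (hK : ∀ m ∈ K, ∀ e, SOSMP.IsDensity μ (m e))
    (hcontr : SOSMP.IsBPContractive μ M γ K)
    (mstar : G.Dart → X → ℝ) (hmstar : SOSMP.IsBPFixedPoint μ M mstar) (hmK : mstar ∈ K)
    (lam : ℕ → ℝ) (φ : G.Dart → ℕ → X → ℝ)
    (hpsd : ∀ e : G.Dart, SOSMP.IsPSDKernel (M.edgePot e.snd e.fst))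
    (heig : ∀ e : G.Dart, SOSMP.IsEigensystem μ (M.edgePot e.snd e.fst) lam (φ e))
    (htrace : Summable lam) (k : ℕ) (hk : 0 < k) (c : ℕ) :
    ∃ C δ₀ : ℝ, 0 < C ∧ 0 < δ₀ ∧ δ₀ < 1 ∧ ∀ δ : ℝ, 0 < δ → δ < δ₀ →
      ∃ T : ℕ,
        (∀ (y : ℕ → G.Dart → Fin k → X) (e : G.Dart),
          ((SOSMP.sosmp μ M φ γ c (SOSMP.criticalDim lam δ) k y T e).ops : ℝ) ≤
            C * ((SOSMP.criticalDim lam δ : ℝ) *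
              (∑ j ∈ Finset.range (SOSMP.criticalDim lam δ), lam j ^ 2) *
              (1 / δ) * Real.log (1 / δ))) ∧
        ∀ (Ω : Type*) [MeasurableSpace Ω] (P : Measure Ω) [IsProbabilityMeasure P]
          (Y : ℕ → G.Dart → Fin k → Ω → X),
          SOSMP.IsRun P μ M φ γ (SOSMP.criticalDim lam δ) k Y →
          SOSMP.StaysIn P μ M φ γ (SOSMP.criticalDim lam δ) k Y K →
          ∀ e : G.Dart,
            Integrable (fun ω => SOSMP.l2norm μ (fun x =>
              SOSMP.message φ (SOSMP.coeffs μ M φ γ (SOSMP.criticalDim lam δ) k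
                (fun s d i => Y s d i ω) T) e x - mstar e x) ^ 2) P ∧
            ∫ ω, SOSMP.l2norm μ (fun x =>
              SOSMP.message φ (SOSMP.coeffs μ M φ γ (SOSMP.criticalDim lam δ) k
                (fun s d i => Y s d i ω) T) e x - mstar e x) ^ 2 ∂P ≤ δ := by
  rcases isEmpty_or_nonempty G.Dart with hempty | ⟨⟨e₀⟩⟩
  · exact ⟨1, 1 / 2, one_pos, by norm_num, by norm_num, fun δ _ _ =>
      ⟨0, fun _ e => isEmptyElim e, fun _ _ _ _ _ _ _ e => isEmptyElim e⟩⟩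
  have hμ : μ ≠ 0 := by
    intro h0
    have h1 := (hmstar e₀).1.2.2.2
    rw [h0, integral_zero_measure] at h1
    exact zero_ne_one h1
  have h : IsRegular μ M lam φ :=
    ⟨hnode, fun e => hedge _ _ e.adj.symm, hpsd, heig, htrace, hμ⟩
  have hX : Nonempty X := by
    by_contra hX
    have := not_nonempty_iff.1 hX
    exact hμ (Measure.eq_zero_of_isEmpty μ)
  obtain ⟨z⟩ := hX
  have hmem : ∀ e, MemLp (mstar e) 2 μ := fun e => (hmstar e).1.2.2.1
  obtain ⟨L, t₀, hL0, hL⟩ := h.exists_integral_sqErr_le hγ0 hγ2 hk z hcontr hmstar hmK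
  obtain ⟨D, hD0, hD⟩ := h.exists_l2norm_resid_fixedPoint_le hmstar
  obtain ⟨A, hA0, hA⟩ := exists_iterations hL0 (max 1 t₀)
  have hlam := h.lam_zero_pos e₀
  have hd : 0 < min (1 / (2 * D ^ 2)) (1 / 2) := lt_min (by positivity) (by norm_num)
  -- The accuracy δ is split into δ/4 for the recursion at time T, δ/4 for the limiting error, and
  -- δ/2 for the squared tail of the fixed point, which is at most (Dδ)².
  have hev := ((hL (1 / 4) (by norm_num)).and hA).and (eventually_lt_nhdsGT hd)
  obtain ⟨d, hd0, hdsub⟩ := mem_nhdsGT_iff_exists_Ioo_subset.1 hev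
  -- The division by `lam 0 ^ 2` pays for the factor Σ λ_j², whose first term is always present
  -- because r ≥ 1.
  refine ⟨A * ((k : ℝ) * c + 2 * k + 9) / lam 0 ^ 2, min d (1 / 2), by positivity,
    lt_min hd0 (by norm_num), (min_le_right _ _).trans_lt (by norm_num), fun δ hδ0 hδ => ?_⟩
  obtain ⟨⟨h1, T, hT, hTA, hTL⟩, _, h2⟩ := hdsub ⟨hδ0, hδ.trans_le (min_le_left _ _)⟩
  have hr := (exists_criticalDim htrace hδ0).1
  have hT1 : 1 ≤ T := (le_max_left _ _).trans hT
  have hT0 : t₀ ≤ T := (le_max_right _ _).trans hT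
  have hδ1 : δ < 1 / 2 := hδ.trans_le (min_le_right _ _)
  have hlog : 0 ≤ Real.log (1 / δ) :=
    Real.log_nonneg ((one_le_div hδ0).2 (by linarith))
  refine ⟨T, fun y e => ?_, fun Ω _ P _ Y hrun hstay e => ?_⟩
  · set r := criticalDim lam δ
    have h3 : ((sosmp μ M φ γ c r k y T e).ops : ℝ) ≤
        (r : ℝ) * T * ((k : ℝ) * c + 2 * k + 9) := by
      exact_mod_cast sosmp_ops_le c r k T hr hT1 y e
    have h4 : lam 0 ^ 2 ≤ ∑ j ∈ Finset.range r, lam j ^ 2 :=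
      Finset.single_le_sum (f := fun j => lam j ^ 2) (fun j _ => sq_nonneg _)
        (Finset.mem_range.2 hr)
    set q : ℝ := (k : ℝ) * c + 2 * k + 9
    have hq0 : 0 ≤ q := by positivity
    have h5 : (r : ℝ) * T * q ≤ r * (A * (1 / δ * Real.log (1 / δ))) * q := by gcongr
    have h6 : (r : ℝ) * (A * (1 / δ * Real.log (1 / δ))) * q =
        A * q / lam 0 ^ 2 * (r * lam 0 ^ 2 * (1 / δ) * Real.log (1 / δ)) := by
      field_simp
    rw [h6] at h5
    refine h3.trans (h5.trans ?_)
    gcongr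
  · set r := criticalDim lam δ
    have hAm : Measurable fun ω => coeffs μ M φ γ r k (fun s d i => Y s d i ω) T :=
      h.measurable_coeffs T fun s _ => hrun.measurable s
    have hδ1' : δ < 1 := by linarith
    obtain ⟨E, _, hE⟩ := h.exists_sqErr_le (γ := γ) hγ0 hk z hmem
    have hsi : Integrable (fun ω => sqErr μ φ mstar
        (coeffs μ M φ γ r k (fun s d i => Y s d i ω) T) e) P := by
      refine Integrable.of_bound ((continuous_sqErr mstar e).measurable.comp
        hAm).aestronglyMeasurable E (Filter.Eventually.of_forall fun ω => ?_)
      rw [Real.norm_eq_abs, abs_of_nonneg (sqErr_nonneg _ _ _)]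
      exact hE δ hδ0 hδ1' _ T e
    simp only [h.l2norm_message_sub_sq (hmem e)]
    refine ⟨hsi.add (integrable_const _), ?_⟩
    rw [integral_add hsi (integrable_const _), integral_const, probReal_univ, one_smul]
    have h3 := h1 Ω P Y hrun hstay T hT0 e
    have h4 := pow_le_pow_left₀ (l2norm_nonneg _) (hD δ hδ0 e) 2
    have h5 : δ * (2 * D ^ 2) < 1 := by
      rw [← lt_div_iff₀ (by positivity)]
      exact h2.trans_le (min_le_left _ _)
    have h6 : (D * δ) ^ 2 ≤ δ / 2 := by nlinarith
    linarith
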